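/- **Model.** Let $d,K,T\ge 1$ be integers, $R_{\max},A_{\max}>0$, and $\mathbf b\in\mathbb R^d$ with $b_i>0$ for all $i$; put $b_{\min}=\min_i b_i$ and $P_{\max}=2R_{\max}/b_{\min}$. There are $K$ configurations; configuration $\theta$ has a fixed distribution $\mathcal D_\theta$ of reward–resource pairs $(r,\mathbf a)\in\mathbb R_+\times\mathbb R_+^d$. Assume: (stationarity and independence) if configuration $\theta$ is selected in a round, the request $(r_t,\mathbf a_t)$ of that round is drawn from $\mathcal D_\theta$, independently of the past; (boundedness) $0\le r\le R_{\max}$ and $\|\mathbf a\|_\infty\le A_{\max}$ almost surely under every $\mathcal D_\theta$; (budget scaling) the total budget over the $T$ rounds is $\mathbf B=T\,\mathbf b$; (continuous valuation) under every $\mathcal D_\theta$ the conditional distribution of $r$ given $\mathbf a$ has no atoms, for almost every value of $\mathbf a$. **Benchmark.** With $\Delta_K$ the probability simplex, let $$V^{\mathrm{mix}}(\mathbf b)=\sup\Big\{\sum_\theta w_\theta\,\mathbb E_\theta[r\,x_\theta(r,\mathbf a)]\;:\;\mathbf w\in\Delta_K,\ x_\theta \text{ measurable with values in }[0,1],\ \sum_\theta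 w_\theta\,\mathbb E_\theta[\mathbf a\,x_\theta(r,\mathbf a)]\le\mathbf b\Big\}.$$ **Algorithm (SP-UCB–OLP)** with exploration parameter $\alpha\ge1$, slack $\varepsilon=\sqrt{\log T/T}$, confidence level $\delta=T^{-2}$ and constants $c_g,c_0>0$. In round $t\le K$ select configuration $t$, observe the request and do not admit it. In round $t$ with $K<t\le T$, let $N_\theta$ be the number of requests observed so far under $\theta$ and $\mathcal S_\theta$ the collection of these requests (admitted or not), and put $$\widehat g_{\theta,t}(\mathbf p)=\frac1{N_\theta\vee1}\sum_{(r,\mathbf a)\in\mathcal S_\theta}(r-\langle\mathbf p,\mathbf a\rangle)_+,\qquad \beta_{\alpha,\theta}(t)=\alpha c_gR_{\max}\sqrt{\frac{d\log\big(c_0dP_{\max}A_{\max}T/R_{\max}\big)+\log(KT/\delta)}{N_\theta\vee1}}$$ (where $\sqrt x:=0$ for $x<0$) and $$L_t^{\mathrm{opt}}(\mathbf w,\mathbf p)=\langle\mathbf p,(1-\varepsilon)\mathbf b\rangle+\sum_\theta w_\theta\big(\widehat g_{\theta,t}(\mathbf p)+\beta_{\alpha,\theta}(t)\big).$$ Choose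 any $\mathbf w_t\in\Delta_K$ maximizing $\min_{\mathbf p\ge0}L_t^{\mathrm{opt}}(\mathbf w,\mathbf p)$ over $\Delta_K$ and any $\mathbf p_t\ge0$ minimizing $L_t^{\mathrm{opt}}(\mathbf w_t,\cdot)$ over $\mathbf p\ge 0$ (measurably in the information available before the round); draw $\theta_t\sim\mathbf w_t$; observe $(r_t,\mathbf a_t)\sim\mathcal D_{\theta_t}$; admit the request if and only if $\mathbf a_t$ is componentwise at most the remaining budget and $r_t>\langle\mathbf p_t,\mathbf a_t\rangle$, in which case $\mathbf a_t$ is subtracted from the remaining budget. Let $R_T$ be the sum of the admitted rewards. **Theorem.** If the absolute constants $c_g,c_0$ are chosen sufficiently large, then for all $d,R_{\max},A_{\max},\mathbf b$ as above there are constants $C_1,C_2>0$ that depend only on $(d,R_{\max},A_{\max},\mathbf b)$ (and on the fixed absolute constants $c_g,c_0$) such that, for all $K,T\ge1$, all $\alpha\ge1$, all distributions $\mathcal D_1,\dots,\mathcal D_K$ satisfying the assumptions and every run of SP-UCB–OLP, $$T\,V^{\mathrm{mix}}(\mathbf b)-\mathbb E[R_T]\;\le\;C_1\,\alpha\sqrt{KT\cdot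 d\log T}+C_2\sqrt{T\log T}+K R_{\max}.$$ In particular the regret is $\tilde O(\alpha\sqrt{KT})$: there are $C>0$ and $m\in\mathbb N$, depending only on the same quantities, such that for all $T\ge2$ and all $K,\alpha,\mathcal D_\theta$ as before, $$T\,V^{\mathrm{mix}}(\mathbf b)-\mathbb E[R_T]\le C\,\alpha\sqrt{KT}\,(\log T)^m.$$ -/

import Mathlib

open MeasureTheory ProbabilityTheory
open scoped Matrix

noncomputable section

namespace SPUCB

/-- A request: its reward `z.1 = r` and its resource vector `z.2 = a`. -/
abbrev Request (d : ℕ) := ℝ × (Fin d → ℝ)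

variable {K d : ℕ}

/-! ### The model -/

/-- Boundedness: almost surely `0 ≤ r ≤ Rmax`, `a ∈ ℝ₊ᵈ` and `‖a‖_∞ ≤ Amax`
(the norm of `Fin d → ℝ` is the sup norm). -/
def BoundedRequests (Rmax Amax : ℝ) (D : Measure (Request d)) : Prop :=
  ∀ᵐ z ∂D, 0 ≤ z.1 ∧ z.1 ≤ Rmax ∧ 0 ≤ z.2 ∧ ‖z.2‖ ≤ Amax

/-- Continuous valuation: the conditional distribution of the reward given the resource vector
is continuous, i.e. it charges no single point, for almost every value of the resource vector. -/
def ContinuousValuation (D : Measure (Request d)) [IsFiniteMeasure D] : Prop :=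
  ∀ᵐ a ∂(D.map Prod.snd), ∀ r : ℝ, condDistrib Prod.fst Prod.snd D a {r} = 0

/-- The value of the switching-aware mixed fluid relaxation with per-period budget `b`:
optimize over mixtures `w` of configurations and measurable acceptance rules
`x k : Request d → [0, 1]` subject to the budget constraint in expectation. -/
def mixFluidValue (D : Fin K → Measure (Request d)) (b : Fin d → ℝ) : ℝ :=
  sSup {v : ℝ | ∃ w ∈ stdSimplex ℝ (Fin K), ∃ x : Fin K → Request d → ℝ,
    (∀ k, Measurable (x k)) ∧ (∀ k z, x k z ∈ Set.Icc (0 : ℝ) 1) ∧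
    (∀ i, ∑ k, w k * ∫ z, z.2 i * x k z ∂(D k) ≤ b i) ∧
    v = ∑ k, w k * ∫ z, z.1 * x k z ∂(D k)}

/-! ### Ingredients of the algorithm

Rounds are numbered `0, 1, …, T - 1`. For one realization, `θ t` is the configuration selected in
round `t` and `z t` the request observed in round `t`. -/

/-- The slack `ε = √(log T / T)`. -/
def slack (T : ℕ) : ℝ := Real.sqrt (Real.log T / T)

/-- The conservative per-period budget `(1 - ε) b`. -/
def safeBudget (T : ℕ) (b : Fin d → ℝ) : Fin d → ℝ := (1 - slack T) • b

/-- The price bound `2 Rmax / b_min`, where `b_min` is the smallest component of `b`. -/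
def priceBound (Rmax : ℝ) (b : Fin d → ℝ) : ℝ := 2 * Rmax / ⨅ i, b i

/-- The number of observations of configuration `k` before round `t`. -/
def sampleCount (θ : ℕ → Fin K) (k : Fin K) (t : ℕ) : ℕ :=
  ((Finset.range t).filter fun s => θ s = k).card

/-- The empirical surplus of configuration `k` at price `p`, computed from all requests that were
observed under `k` before round `t`, admitted or not. -/
def empSurplus (θ : ℕ → Fin K) (z : ℕ → Request d) (k : Fin K) (t : ℕ) (p : Fin d → ℝ) : ℝ :=
  (1 / max (sampleCount θ k t : ℝ) 1) *
    ∑ s ∈ (Finset.range t).filter (fun s => θ s = k), max ((z s).1 - p ⬝ᵥ (z s).2) 0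

/-- The confidence radius of a configuration that was observed `n` times, with exploration
parameter `α`, confidence level `δ` and constants `cg`, `c₀`. -/
def confRadius (cg c₀ Rmax Amax : ℝ) (b : Fin d → ℝ) (K T : ℕ) (α δ : ℝ) (n : ℕ) : ℝ :=
  α * cg * Rmax * Real.sqrt
    ((d * Real.log (c₀ * d * priceBound Rmax b * Amax * T / Rmax) + Real.log (K * T / δ)) /
      max (n : ℝ) 1)

/-- The optimistic Lagrangian of round `t`, as a function of the mixture `w` and the price `p`. -/
def optLagrangian (cg c₀ Rmax Amax : ℝ) (b : Fin d → ℝ) (T : ℕ) (α δ : ℝ)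
    (θ : ℕ → Fin K) (z : ℕ → Request d) (t : ℕ) (w : Fin K → ℝ) (p : Fin d → ℝ) : ℝ :=
  p ⬝ᵥ safeBudget T b + ∑ k, w k * (empSurplus θ z k t p +
    confRadius cg c₀ Rmax Amax b K T α δ (sampleCount θ k t))

/-- `(w, p) ∈ argmax_{w ∈ Δ} argmin_{p ≥ 0} L w p`: the mixture `w` maximizes the value
`min_{q ≥ 0} L w q` over the simplex, and the price `p` attains that minimum for `w`. -/
def IsMaxMin (L : (Fin K → ℝ) → (Fin d → ℝ) → ℝ) (w : Fin K → ℝ) (p : Fin d → ℝ) : Prop :=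
  w ∈ stdSimplex ℝ (Fin K) ∧ 0 ≤ p ∧
  IsMaxOn (fun w' => ⨅ q : {q : Fin d → ℝ // 0 ≤ q}, L w' q) (stdSimplex ℝ (Fin K)) w ∧
  IsMinOn (L w) {q | 0 ≤ q} p

/-- The admission decision of round `t` for the request `z`, given the price `p` and the remaining
budget `rem`: no admission in the first `K` rounds, afterwards admit if and only if the request
fits into the remaining budget and its reward exceeds its bid price. -/
def Admits (K t : ℕ) (rem p : Fin d → ℝ) (z : Request d) : Prop :=
  K ≤ t ∧ z.2 ≤ rem ∧ p ⬝ᵥ z.2 < z.1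

open Classical in
/-- The budget that remains at the beginning of round `t`, when the total budget is `B`, the
observed requests are `z` and the prices are `p`. -/
def remBudget (K : ℕ) (B : Fin d → ℝ) (z : ℕ → Request d) (p : ℕ → Fin d → ℝ) :
    ℕ → Fin d → ℝ
  | 0 => B
  | t + 1 => if Admits K t (remBudget K B z p t) (p t) (z t)
      then remBudget K B z p t - (z t).2 else remBudget K B z p t

open Classical in
/-- The total reward of the rounds `0, …, T - 1`. -/
def totalReward (K T : ℕ) (B : Fin d → ℝ) (z : ℕ → Request d) (p : ℕ → Fin d → ℝ) : ℝ :=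
  ∑ t ∈ Finset.range T, if Admits K t (remBudget K B z p t) (p t) (z t) then (z t).1 else 0

/-! ### A run of the algorithm -/

/-- The processes `θ` (configurations), `Z` (requests), `w` (mixtures) and `p` (prices) on the
probability space `(Ω, P)` form a run of SP-UCB-OLP over `T` rounds in the environment `D`.
Here `ℱ t` is the information available before round `t`; it contains everything that was
selected and observed in the earlier rounds, and possibly further randomness that is used to
choose among the solutions of the optimistic saddle point problem. -/
structure IsRun {Ω : Type*} {mΩ : MeasurableSpace Ω} (P : Measure Ω) (ℱ : Filtration ℕ mΩ)
    (D : Fin K → Measure (Request d)) (cg c₀ Rmax Amax : ℝ) (b : Fin d → ℝ) (T : ℕ) (α δ : ℝ)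
    (θ : ℕ → Ω → Fin K) (Z : ℕ → Ω → Request d)
    (w : ℕ → Ω → Fin K → ℝ) (p : ℕ → Ω → Fin d → ℝ) : Prop where
  /-- The selected configuration is known after its round. -/
  measurable_config : ∀ t < T, Measurable[ℱ (t + 1)] (θ t)
  /-- The request is known after its round. -/
  measurable_request : ∀ t < T, Measurable[ℱ (t + 1)] (Z t)
  /-- The mixture is computed from the information available before the round. -/
  measurable_mixture : ∀ t < T, Measurable[ℱ t] (w t)
  /-- The price is computed from the information available before the round. -/
  measurable_price : ∀ t < T, Measurable[ℱ t] (p t)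
  /-- Stationarity and independence: given the past and given that configuration `k` is selected,
  the request is distributed according to `D k`. -/
  observe : ∀ t < T, ∀ E : Set Ω, MeasurableSet[ℱ t] E → ∀ (k : Fin K) (S : Set (Request d)),
    MeasurableSet S →
      P (E ∩ {ω | θ t ω = k} ∩ {ω | Z t ω ∈ S}) = P (E ∩ {ω | θ t ω = k}) * D k S
  /-- Initialization: each configuration is selected once, in order. -/
  warmStart : ∀ t < T, t < K → ∀ᵐ ω ∂P, (θ t ω : ℕ) = t
  /-- After the initialization, the mixture and the price solve the optimistic saddle point
  problem of the round. -/
  saddle : ∀ t < T, K ≤ t → ∀ᵐ ω ∂P,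
    IsMaxMin (optLagrangian cg c₀ Rmax Amax b T α δ (fun s => θ s ω) (fun s => Z s ω) t)
      (w t ω) (p t ω)
  /-- After the initialization, the configuration is drawn from the mixture: given the past, its
  conditional distribution is `w t`. -/
  draw : ∀ t < T, K ≤ t → ∀ E : Set Ω, MeasurableSet[ℱ t] E → ∀ k : Fin K,
    P (E ∩ {ω | θ t ω = k}) = ∫⁻ ω in E, ENNReal.ofReal (w t ω k) ∂P

/-- The switching-aware regret `T * V^mix(b) - E[R_T]` of a run with total budget `B = T b`. -/
def mixRegret {Ω : Type*} {mΩ : MeasurableSpace Ω} (P : Measure Ω)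
    (D : Fin K → Measure (Request d)) (b : Fin d → ℝ) (T : ℕ)
    (Z : ℕ → Ω → Request d) (p : ℕ → Ω → Fin d → ℝ) : ℝ :=
  T * mixFluidValue D b -
    ∫ ω, totalReward K T ((T : ℝ) • b) (fun t => Z t ω) (fun t => p t ω) ∂P

end SPUCB

end

/-! The proof combines optimism, first-order optimality of the prices and a stopping argument for
the budget. Every comparison is with the value `v` of a single feasible point of the relaxation, so
neither strong duality nor attainment of the supremum is needed.

Concentration. A bid price rule accepts a halfspace of requests in which the coefficient of the
reward is fixed; such sets have VC dimension at most `d + 1`. Symmetrization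
(`integral_sup_symExp_le`, `measure_finite_deviation_le`) gives a sub-Gaussian bound with a
polynomial growth factor for i.i.d. samples. The requests seen under a configuration are collected
adaptively, but writing them one after another into an independent sample preserves the product law
(`IsRun.lintegral_measure_stack`), so the bound transfers to all rounds of a run. The outcome is
`IsTypical`: acceptance probabilities, rewards and consumptions are estimated uniformly over all
prices. Integrating the acceptance frequencies over shifts of the bid price yields the surplus as
well (`IsTypical.surplus_le`), without any bound on the prices.

A single round. Weak duality and the confidence radii make the optimistic value at least `(1 - slack
T) * v` (`IsTypical.le_optLagrangian`). Since the price is a minimizer, raising one coordinate shows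
that the empirical consumption fits the safe budget, and shrinking the whole vector bounds the
optimistic value by the empirical reward plus radii. The perturbations avoid ties in the data; they
are sent to zero in the true expectations, which are continuous in the price because valuations have
no atoms (`IsTypical.consumption_le`, `IsTypical.le_reward`).

The budget. Let the demand run on as if every request above its bid price were served, and let
`inBudget` be the predictable indicator that the past demand fits. While it equals one, the real run
agrees with this picture. If a resource runs out, its demand has exceeded `T * b i` early, and the
excess must come from a martingale with second moment at most `T` or from estimation errors. This
bounds the number of lost rounds (`sum_one_sub_inBudget_le`).

Summation. In expectation the mixture average of the radii equals the radius of the drawn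
configuration, and these add up to order `√(K T)` (`IsRun.integral_sum_mixInvSqrt_le`). The
deviation level `U ^ 2 = (6 * d + 16) * log T` makes the exceptional set cost only a constant.
Horizons with `T ≤ K`, or shorter than a constant of the model, are covered by the trivial bound `T
* Rmax`. -/

noncomputable section

namespace SPUCB

variable {K d : ℕ}

/-! ### Halfspaces of requests and their growth function -/

/-- The requests whose reward exceeds the affine bid price `q.1 ⬝ᵥ a + q.2`. -/
def halfspace (q : (Fin d → ℝ) × ℝ) : Set (Request d) := {z | q.1 ⬝ᵥ z.2 + q.2 < z.1}

lemma measurable_dotProduct_snd (p : Fin d → ℝ) : Measurable fun z : Request d => p ⬝ᵥ z.2 := by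
  unfold dotProduct
  fun_prop

lemma measurableSet_halfspace (q : (Fin d → ℝ) × ℝ) : MeasurableSet (halfspace q) :=
  measurableSet_lt ((measurable_dotProduct_snd q.1).add_const _) measurable_fst

/-- An affine dependence among the resource vectors annihilates every affine bid price, so the
weighted slack no longer depends on `q`. Two cuts that force opposite signs of this quantity
therefore contradict each other. -/
lemma sum_mul_slack_eq {κ : Type*} (y : κ → Request d) (S : Finset κ) (c : κ → ℝ)
    (h₁ : ∑ j ∈ S, c j • (y j).2 = 0) (h₂ : ∑ j ∈ S, c j = 0) (q : (Fin d → ℝ) × ℝ) :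
    ∑ j ∈ S, c j * ((y j).1 - (q.1 ⬝ᵥ (y j).2 + q.2)) = ∑ j ∈ S, c j * (y j).1 := by
  have h : ∑ j ∈ S, c j * (q.1 ⬝ᵥ (y j).2) = q.1 ⬝ᵥ ∑ j ∈ S, c j • (y j).2 := by
    rw [dotProduct_sum]
    simp [dotProduct_smul]
  have h' : ∑ j ∈ S, c j * q.2 = 0 := by rw [← Finset.sum_mul, h₂, zero_mul]
  rw [h₁, dotProduct_zero] at h
  simp only [mul_sub, mul_add, Finset.sum_sub_distrib, Finset.sum_add_distrib, h, h']
  ring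

open Classical in
/-- Halfspaces cut out at most `d + 1` points in all possible ways. -/
lemma card_le_of_shatters_halfspace {κ : Type*} [Fintype κ] (y : κ → Request d)
    (F : Finset ((Fin d → ℝ) × ℝ)) (S : Finset κ)
    (hS : (F.image fun q => Finset.univ.filter fun j => y j ∈ halfspace q).Shatters S) :
    S.card ≤ d + 1 := by
  by_contra hcard
  -- The extra coordinate `1` turns affine into linear dependence in dimension `d + 1`. The reward
  -- needs no coordinate, its coefficient in a halfspace being fixed.
  have hdep : ¬ LinearIndependent ℝ fun j : S => (((y j).2, 1) : (Fin d → ℝ) × ℝ) := fun hli => by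
    have := hli.fintype_card_le_finrank
    simp at this
    omega
  obtain ⟨c, hc, j₀, hj₀⟩ := Fintype.not_linearIndependent_iff.1 hdep
  -- The sign of the dependence is chosen so that some coefficient is positive, which makes the
  -- first sum below strictly positive.
  obtain ⟨e, he₁, he₂, j₁, hj₁, hpos⟩ : ∃ e : κ → ℝ, ∑ j ∈ S, e j • (y j).2 = 0 ∧
      ∑ j ∈ S, e j = 0 ∧ ∃ j ∈ S, 0 < e j := by
    have key : ∀ c : S → ℝ, ∑ j, c j • (((y j).2, 1) : (Fin d → ℝ) × ℝ) = 0 → (∃ j, 0 < c j) →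
        ∃ e : κ → ℝ, ∑ j ∈ S, e j • (y j).2 = 0 ∧ ∑ j ∈ S, e j = 0 ∧ ∃ j ∈ S, 0 < e j := by
      rintro c hc ⟨j, hj⟩
      refine ⟨fun j => if h : j ∈ S then c ⟨j, h⟩ else 0, ?_, ?_, j, j.2, by simpa using hj⟩
      · have := congrArg Prod.fst hc
        rw [Prod.fst_sum] at this
        rw [← Finset.sum_coe_sort]
        simpa using this
      · have := congrArg Prod.snd hc
        rw [Prod.snd_sum] at this
        rw [← Finset.sum_coe_sort]
        simpa using this
    rcases lt_or_gt_of_ne hj₀ with h | h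
    · exact key (-c) (by simp only [Pi.neg_apply, neg_smul, Finset.sum_neg_distrib, hc, neg_zero]) ⟨j₀, by simpa using h⟩
    · exact key c hc ⟨j₀, h⟩
  have hcut : ∀ t ⊆ S, ∃ q : (Fin d → ℝ) × ℝ, ∀ j ∈ S, y j ∈ halfspace q ↔ j ∈ t := by
    intro t ht
    obtain ⟨u, hu, hut⟩ := hS ht
    obtain ⟨q, -, rfl⟩ := Finset.mem_image.1 hu
    refine ⟨q, fun j hj => ?_⟩
    rw [← hut]
    simp [hj]
  -- Cutting out the positive coefficients makes the weighted slack positive, cutting out the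
  -- negative ones makes it nonpositive; yet both equal `∑ j ∈ S, e j * (y j).1`.
  obtain ⟨q₁, hq₁⟩ := hcut (S.filter fun j => 0 < e j) (Finset.filter_subset _ _)
  obtain ⟨q₂, hq₂⟩ := hcut (S.filter fun j => e j < 0) (Finset.filter_subset _ _)
  have h₁ : 0 < ∑ j ∈ S, e j * ((y j).1 - (q₁.1 ⬝ᵥ (y j).2 + q₁.2)) := by
    refine Finset.sum_pos' (fun j hj => ?_) ⟨j₁, hj₁, mul_pos hpos (sub_pos.2 ?_)⟩
    · have := hq₁ j hj
      simp only [halfspace, Set.mem_ofPred_eq, Finset.mem_filter, hj, true_and] at this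
      by_cases h : 0 < e j
      · exact mul_nonneg h.le (sub_nonneg.2 (this.2 h).le)
      · exact mul_nonneg_of_nonpos_of_nonpos (not_lt.1 h)
          (sub_nonpos.2 (not_lt.1 fun h' => h (this.1 h')))
    · exact (hq₁ j₁ hj₁).2 (Finset.mem_filter.2 ⟨hj₁, hpos⟩)
  have h₂ : ∑ j ∈ S, e j * ((y j).1 - (q₂.1 ⬝ᵥ (y j).2 + q₂.2)) ≤ 0 := by
    refine Finset.sum_nonpos fun j hj => ?_
    have := hq₂ j hj
    simp only [halfspace, Set.mem_ofPred_eq, Finset.mem_filter, hj, true_and] at this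
    by_cases h : e j < 0
    · exact mul_nonpos_of_nonpos_of_nonneg h.le (sub_nonneg.2 (this.2 h).le)
    · exact mul_nonpos_of_nonneg_of_nonpos (not_lt.1 h)
        (sub_nonpos.2 (not_lt.1 fun h' => h (this.1 h')))
  rw [sum_mul_slack_eq y S e he₁ he₂] at h₁ h₂
  exact absurd h₁ (not_lt.2 h₂)

/-- Each `m.choose k` is at most `m ^ k`, hence at most the `k`-th term of the binomial expansion of
`(m + 1) ^ D`. -/
lemma sum_choose_le_pow (m D : ℕ) : ∑ k ∈ Finset.Iic D, m.choose k ≤ (m + 1) ^ D := by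
  rw [add_pow]
  have : Finset.Iic D = Finset.range (D + 1) := Finset.ext fun k => by simp
  rw [this]
  refine Finset.sum_le_sum fun k hk => ?_
  have hk' : 0 < D.choose k := Nat.choose_pos (by simpa [Nat.lt_succ_iff] using hk)
  calc m.choose k ≤ m ^ k := Nat.choose_le_pow m k
    _ ≤ m ^ k * 1 ^ (D - k) * D.choose k := by
      rw [one_pow, mul_one]; exact Nat.le_mul_of_pos_right _ hk'

open Classical in
/-- The number of subsets of `m` points that are cut out by halfspaces is at most
`(m + 1) ^ (d + 1)`. -/
lemma card_traces_halfspace_le {κ : Type*} [Fintype κ] (y : κ → Request d)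
    (F : Finset ((Fin d → ℝ) × ℝ)) :
    (F.image fun q => Finset.univ.filter fun j => y j ∈ halfspace q).card ≤
      (Fintype.card κ + 1) ^ (d + 1) := by
  set 𝒜 := F.image fun q => Finset.univ.filter fun j => y j ∈ halfspace q
  have hvc : 𝒜.vcDim ≤ d + 1 := Finset.sup_le fun S hS =>
    card_le_of_shatters_halfspace y F S (Finset.mem_shatterer.1 hS)
  calc 𝒜.card ≤ 𝒜.shatterer.card := Finset.card_le_card_shatterer 𝒜
    _ ≤ ∑ k ∈ Finset.Iic 𝒜.vcDim, (Fintype.card κ).choose k :=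
      Finset.card_shatterer_le_sum_vcDim
    _ ≤ ∑ k ∈ Finset.Iic (d + 1), (Fintype.card κ).choose k :=
      Finset.sum_le_sum_of_subset (Finset.Iic_subset_Iic.2 hvc)
    _ ≤ _ := sum_choose_le_pow _ _

/-! ### Uniform deviations over halfspaces for independent samples -/

/-- The score `h z` if the reward exceeds the affine bid price given by `q`, and `0` otherwise. -/
def scored (h : Request d → ℝ) (q : (Fin d → ℝ) × ℝ) : Request d → ℝ := (halfspace q).indicator h

section Scored

variable {h : Request d → ℝ} {q : (Fin d → ℝ) × ℝ}

lemma measurable_scored (hm : Measurable h) (q : (Fin d → ℝ) × ℝ) : Measurable (scored h q) :=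
  hm.indicator (measurableSet_halfspace q)

lemma scored_mem_Icc (h01 : ∀ z, h z ∈ Set.Icc (0 : ℝ) 1) (q : (Fin d → ℝ) × ℝ) (z : Request d) :
    scored h q z ∈ Set.Icc (0 : ℝ) 1 := by
  unfold scored
  by_cases hz : z ∈ halfspace q
  · simpa [hz] using h01 z
  · simp [hz]

lemma integrable_scored {D : Measure (Request d)} [IsFiniteMeasure D] (hm : Measurable h)
    (h01 : ∀ z, h z ∈ Set.Icc (0 : ℝ) 1) (q : (Fin d → ℝ) × ℝ) : Integrable (scored h q) D :=
  Integrable.of_bound (measurable_scored hm q).aestronglyMeasurable 1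
    (Filter.Eventually.of_forall fun z => by
      rw [Real.norm_of_nonneg (scored_mem_Icc h01 q z).1]; exact (scored_mem_Icc h01 q z).2)

end Scored

/-- The sign `1` or `-1`. -/
def boolSign (c : Bool) : ℝ := if c then 1 else -1

/-- The sum over sign vectors factors over the positions; a factor in `s` equals `2 * cosh (l * v
j)`, which is at most `2 * exp (l ^ 2 / 2)`. -/
lemma sum_exp_signs_le {ι : Type*} [Fintype ι] [DecidableEq ι] (s : Finset ι) (v : ι → ℝ)
    (hv : ∀ j, |v j| ≤ 1) (l : ℝ) :
    ∑ σ : ι → Bool, Real.exp (l * ∑ j ∈ s, boolSign (σ j) * v j) ≤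
      2 ^ Fintype.card ι * Real.exp (s.card * l ^ 2 / 2) := by
  have h₁ : ∀ σ : ι → Bool, Real.exp (l * ∑ j ∈ s, boolSign (σ j) * v j) =
      ∏ j, if j ∈ s then Real.exp (boolSign (σ j) * (l * v j)) else 1 := by
    intro σ
    rw [Finset.prod_ite_mem, Finset.univ_inter, ← Real.exp_sum, Finset.mul_sum]
    congr 1
    exact Finset.sum_congr rfl fun j _ => by ring
  have h₂ := Finset.prod_univ_sum (fun _ : ι => (Finset.univ : Finset Bool))
    (fun j c => if j ∈ s then Real.exp (boolSign c * (l * v j)) else 1)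
  rw [Fintype.piFinset_univ] at h₂
  simp_rw [h₁]
  rw [← h₂]
  have h₃ : ∀ j, (∑ c : Bool, if j ∈ s then Real.exp (boolSign c * (l * v j)) else 1) ≤
      2 * if j ∈ s then Real.exp (l ^ 2 / 2) else 1 := by
    intro j
    by_cases hj : j ∈ s
    · simp only [hj, if_true, Fintype.sum_bool, boolSign]
      have := Real.cosh_le_exp_half_sq (l * v j)
      rw [Real.cosh_eq] at this
      have hle : Real.exp ((l * v j) ^ 2 / 2) ≤ Real.exp (l ^ 2 / 2) := by
        refine Real.exp_le_exp.2 ?_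
        have : (v j) ^ 2 ≤ 1 := by rw [sq_le_one_iff_abs_le_one]; exact hv j
        nlinarith [sq_nonneg l]
      simp only [one_mul, neg_one_mul, Bool.false_eq_true, if_false]
      linarith
    · simp [hj]
  calc _ ≤ ∏ j : ι, (2 * if j ∈ s then Real.exp (l ^ 2 / 2) else 1) :=
        Finset.prod_le_prod (fun j _ => Finset.sum_nonneg fun c _ => by split_ifs <;> positivity)
          fun j _ => h₃ j
    _ = _ := by
      rw [Finset.prod_mul_distrib, Finset.prod_const, Finset.prod_ite_mem, Finset.univ_inter,
        Finset.prod_const, ← Real.exp_nat_mul, Finset.card_univ]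
      congr 2
      ring

/-! ### Symmetrization with a ghost sample and random signs. -/

section Symmetrization

variable {ι : Type*}

/-- The exponentiated difference of the scores of two samples, with signs. -/
def symExp (h : Request d → ℝ) (s : Finset ι) (l : ℝ) (σ : ι → Bool) (x y : ι → Request d)
    (q : (Fin d → ℝ) × ℝ) : ℝ :=
  Real.exp (l * ∑ j ∈ s, boolSign (σ j) * (scored h q (x j) - scored h q (y j)))

/-- The sample `x` with the entries marked `false` by `σ` replaced by those of `y`. -/
def mixSample (σ : ι → Bool) (x y : ι → Request d) : ι → Request d :=
  fun j => if σ j then x j else y j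

/-- Exchanging the entries of the two samples at a position flips the sign of that term, so signs
can be traded for exchanges. -/
lemma symExp_mixSample (h : Request d → ℝ) (s : Finset ι) (l : ℝ) (σ : ι → Bool)
    (x y : ι → Request d) (q : (Fin d → ℝ) × ℝ) :
    symExp h s l (fun _ => true) (mixSample σ x y) (mixSample σ y x) q = symExp h s l σ x y q := by
  unfold symExp mixSample boolSign
  congr 2
  refine Finset.sum_congr rfl fun j _ => ?_
  cases σ j <;> simp

/-- The pairs `(x j, y j)` are independent with the symmetric law `D.prod D`. Regrouping the two
samples as one sample of pairs reduces the claim to invariance of this law under swapping. -/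
lemma measurePreserving_mixSample [Fintype ι] (D : Measure (Request d)) [IsProbabilityMeasure D]
    (σ : ι → Bool) :
    MeasurePreserving (fun u : (ι → Request d) × (ι → Request d) =>
        (mixSample σ u.1 u.2, mixSample σ u.2 u.1))
      ((Measure.pi fun _ : ι => D).prod (Measure.pi fun _ : ι => D))
      ((Measure.pi fun _ : ι => D).prod (Measure.pi fun _ : ι => D)) := by
  have h₁ := measurePreserving_arrowProdEquivProdArrow (Request d) (Request d) ι
    (fun _ => D) (fun _ => D)
  have h₂ : MeasurePreserving (fun (u : ι → Request d × Request d) j =>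
      (if σ j then id else Prod.swap) (u j)) (Measure.pi fun _ : ι => D.prod D)
      (Measure.pi fun _ : ι => D.prod D) := by
    refine measurePreserving_pi _ _ fun j => ?_
    cases σ j
    · simpa using Measure.measurePreserving_swap
    · simpa using MeasurePreserving.id _
  convert! (h₁.comp h₂).comp h₁.symm using 1
  funext u
  ext j : 2 <;>
    cases hj : σ j <;> simp [mixSample, MeasurableEquiv.arrowProdEquivProdArrow, Equiv.arrowProdEquivProdArrow, hj]

-- For fixed samples the value depends on `q` only through its trace on the combined `2 * card ι`
-- points. The supremum is at most the sum over traces, and their number is bounded by the growth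
-- function whatever the size of `F`.
open Classical in
lemma sum_sup_symExp_le [Fintype ι] {h : Request d → ℝ} (h01 : ∀ z, h z ∈ Set.Icc (0 : ℝ) 1) (s : Finset ι)
    (l : ℝ) {F : Finset ((Fin d → ℝ) × ℝ)} (hF : F.Nonempty) (x y : ι → Request d) :
    ∑ σ : ι → Bool, F.sup' hF (symExp h s l σ x y) ≤
      (2 * Fintype.card ι + 1 : ℝ) ^ (d + 1) *
        (2 ^ Fintype.card ι * Real.exp (s.card * l ^ 2 / 2)) := by
  set tr : (Fin d → ℝ) × ℝ → Finset (ι ⊕ ι) :=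
    fun q => Finset.univ.filter fun j => Sum.elim x y j ∈ halfspace q with htr
  set v : Finset (ι ⊕ ι) → ι → ℝ := fun A j =>
    (if Sum.inl j ∈ A then h (x j) else 0) - if Sum.inr j ∈ A then h (y j) else 0 with hv
  have hval : ∀ σ q, symExp h s l σ x y q =
      Real.exp (l * ∑ j ∈ s, boolSign (σ j) * v (tr q) j) := by
    intro σ q
    simp [symExp, hv, htr, scored, Set.indicator_apply]
  have hv1 : ∀ A j, |v A j| ≤ 1 := by
    intro A j
    have h₁ := h01 (x j)
    have h₂ := h01 (y j)
    simp only [Set.mem_Icc] at h₁ h₂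
    simp only [hv]
    rw [abs_le]
    split_ifs <;> constructor <;> linarith
  calc ∑ σ : ι → Bool, F.sup' hF (symExp h s l σ x y)
      ≤ ∑ σ : ι → Bool, ∑ A ∈ F.image tr, Real.exp (l * ∑ j ∈ s, boolSign (σ j) * v A j) := by
        refine Finset.sum_le_sum fun σ _ => Finset.sup'_le _ _ fun q hq => ?_
        rw [hval]
        exact Finset.single_le_sum
          (f := fun A => Real.exp (l * ∑ j ∈ s, boolSign (σ j) * v A j))
          (fun _ _ => (Real.exp_pos _).le) (Finset.mem_image_of_mem tr hq)
    _ = ∑ A ∈ F.image tr, ∑ σ : ι → Bool, Real.exp (l * ∑ j ∈ s, boolSign (σ j) * v A j) :=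
        Finset.sum_comm
    _ ≤ ∑ A ∈ F.image tr, 2 ^ Fintype.card ι * Real.exp (s.card * l ^ 2 / 2) :=
        Finset.sum_le_sum fun A _ => sum_exp_signs_le s (v A) (hv1 A) l
    _ = (F.image tr).card * (2 ^ Fintype.card ι * Real.exp (s.card * l ^ 2 / 2)) := by
        rw [Finset.sum_const, nsmul_eq_mul]
    _ ≤ _ := by
        gcongr
        have := card_traces_halfspace_le (Sum.elim x y) F
        rw [Fintype.card_sum, ← two_mul] at this
        convert! (Nat.cast_le (α := ℝ)).2 this using 1
        · congr!
        · push_cast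
          rfl

lemma measurable_symExp {h : Request d → ℝ} (hm : Measurable h) (s : Finset ι) (l : ℝ)
    (σ : ι → Bool) (q : (Fin d → ℝ) × ℝ) :
    Measurable fun u : (ι → Request d) × (ι → Request d) => symExp h s l σ u.1 u.2 q := by
  have := measurable_scored hm q
  unfold symExp
  fun_prop

lemma symExp_le {h : Request d → ℝ} (h01 : ∀ z, h z ∈ Set.Icc (0 : ℝ) 1) (s : Finset ι) (l : ℝ)
    (σ : ι → Bool) (x y : ι → Request d) (q : (Fin d → ℝ) × ℝ) :
    symExp h s l σ x y q ≤ Real.exp (|l| * s.card) := by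
  refine Real.exp_le_exp.2 ((le_abs_self _).trans ?_)
  rw [abs_mul]
  gcongr
  refine (Finset.abs_sum_le_sum_abs _ _).trans ?_
  rw [← nsmul_one s.card]
  refine Finset.sum_le_card_nsmul _ _ _ fun j _ => ?_
  have h₁ := scored_mem_Icc h01 q (x j)
  have h₂ := scored_mem_Icc h01 q (y j)
  simp only [Set.mem_Icc] at h₁ h₂
  rw [abs_le]
  unfold boolSign
  split_ifs <;> constructor <;> linarith

lemma measurable_sup_symExp {h : Request d → ℝ} (hm : Measurable h) (s : Finset ι) (l : ℝ)
    (σ : ι → Bool) {F : Finset ((Fin d → ℝ) × ℝ)} (hF : F.Nonempty) :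
    Measurable fun u : (ι → Request d) × (ι → Request d) =>
      F.sup' hF (symExp h s l σ u.1 u.2) := by
  have := Finset.measurable_sup' hF (f := fun q => fun u : (ι → Request d) × (ι → Request d) =>
    symExp h s l σ u.1 u.2 q) fun q _ => measurable_symExp hm s l σ q
  convert! this using 1
  ext u
  simp [Finset.sup'_apply]

lemma norm_sup_symExp_le {h : Request d → ℝ} (h01 : ∀ z, h z ∈ Set.Icc (0 : ℝ) 1) (s : Finset ι)
    (l : ℝ) (σ : ι → Bool) {F : Finset ((Fin d → ℝ) × ℝ)} (hF : F.Nonempty)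
    (x y : ι → Request d) : ‖F.sup' hF (symExp h s l σ x y)‖ ≤ Real.exp (|l| * s.card) := by
  rw [Real.norm_of_nonneg]
  · exact Finset.sup'_le _ _ fun q _ => symExp_le h01 s l σ _ _ q
  · obtain ⟨q, hq⟩ := hF
    exact (Real.exp_pos _).le.trans (Finset.le_sup' (symExp h s l σ x y) hq)

variable [Fintype ι] (D : Measure (Request d)) [IsProbabilityMeasure D]

lemma integrable_sup_symExp {h : Request d → ℝ} (hm : Measurable h)
    (h01 : ∀ z, h z ∈ Set.Icc (0 : ℝ) 1) (s : Finset ι) (l : ℝ)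
    (σ : ι → Bool) {F : Finset ((Fin d → ℝ) × ℝ)} (hF : F.Nonempty) :
    Integrable (fun u : (ι → Request d) × (ι → Request d) => F.sup' hF (symExp h s l σ u.1 u.2))
      ((Measure.pi fun _ : ι => D).prod (Measure.pi fun _ : ι => D)) :=
  Integrable.of_bound (measurable_sup_symExp hm s l σ hF).aestronglyMeasurable _
    (Filter.Eventually.of_forall fun u => norm_sup_symExp_le h01 s l σ hF u.1 u.2)

/-- By exchangeability of the two samples all sign patterns have the same integral. The integral
with positive signs is therefore the average over patterns, to which the bound for fixed samples
applies. -/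
lemma integral_sup_symExp_le {h : Request d → ℝ} (hm : Measurable h)
    (h01 : ∀ z, h z ∈ Set.Icc (0 : ℝ) 1) (s : Finset ι) (l : ℝ)
    {F : Finset ((Fin d → ℝ) × ℝ)} (hF : F.Nonempty) :
    ∫ u : (ι → Request d) × (ι → Request d), F.sup' hF (symExp h s l (fun _ => true) u.1 u.2)
      ∂((Measure.pi fun _ : ι => D).prod (Measure.pi fun _ : ι => D)) ≤
      (2 * Fintype.card ι + 1 : ℝ) ^ (d + 1) * Real.exp (s.card * l ^ 2 / 2) := by
  classical
  set Q := (Measure.pi fun _ : ι => D).prod (Measure.pi fun _ : ι => D)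
  set I := ∫ u, F.sup' hF (symExp h s l (fun _ => true) u.1 u.2) ∂Q with hI
  have hσ : ∀ σ : ι → Bool, ∫ u, F.sup' hF (symExp h s l σ u.1 u.2) ∂Q = I := by
    intro σ
    have hmp := measurePreserving_mixSample D σ
    have hQ : Measure.map _ Q = Q := hmp.map_eq
    rw [hI]
    conv_rhs => rw [← hQ]
    rw [integral_map hmp.measurable.aemeasurable]
    · refine integral_congr_ae (Filter.Eventually.of_forall fun u => ?_)
      refine Finset.sup'_congr hF rfl fun q _ => ?_
      exact (symExp_mixSample h s l σ u.1 u.2 q).symm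
    · rw [hQ]
      exact (integrable_sup_symExp D hm h01 s l _ hF).aestronglyMeasurable
  have hsum : 2 ^ Fintype.card ι * I =
      ∫ u, ∑ σ : ι → Bool, F.sup' hF (symExp h s l σ u.1 u.2) ∂Q := by
    rw [integral_finsetSum _ fun σ _ => integrable_sup_symExp D hm h01 s l σ hF]
    rw [Finset.sum_congr rfl fun σ _ => hσ σ]
    simp
  have hle : ∫ u, ∑ σ : ι → Bool, F.sup' hF (symExp h s l σ u.1 u.2) ∂Q ≤
      (2 * Fintype.card ι + 1 : ℝ) ^ (d + 1) *
        (2 ^ Fintype.card ι * Real.exp (s.card * l ^ 2 / 2)) := by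
    refine (integral_mono (integrable_finsetSum _ fun σ _ =>
      integrable_sup_symExp D hm h01 s l σ hF) (integrable_const _)
      fun u => sum_sup_symExp_le h01 s l hF u.1 u.2).trans ?_
    simp
  rw [← hsum] at hle
  have h2 : (0 : ℝ) < 2 ^ Fintype.card ι := by positivity
  refine le_of_mul_le_mul_left ?_ h2
  linarith

/-- Jensen's inequality for `exp`: the mean score is the average over an independent ghost sample
`y`. Taking the supremum inside the integral makes the bound independent of `q`. -/
lemma exp_deviation_le {h : Request d → ℝ} (hm : Measurable h)
    (h01 : ∀ z, h z ∈ Set.Icc (0 : ℝ) 1) (s : Finset ι) (l : ℝ)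
    {F : Finset ((Fin d → ℝ) × ℝ)} (hF : F.Nonempty) {q : (Fin d → ℝ) × ℝ} (hq : q ∈ F)
    (x : ι → Request d) :
    Real.exp (l * ∑ j ∈ s, (scored h q (x j) - ∫ z, scored h q z ∂D)) ≤
      ∫ y, F.sup' hF (symExp h s l (fun _ => true) x y) ∂(Measure.pi fun _ : ι => D) := by
  set Q := Measure.pi fun _ : ι => D with hQ
  have hmx : Measurable fun y : ι → Request d => (x, y) := measurable_prodMk_left
  have hsc : ∀ j, Integrable (fun y : ι → Request d => scored h q (y j)) Q := fun j =>
    (measurePreserving_eval (fun _ : ι => D) j).integrable_comp_of_integrable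
      (integrable_scored hm h01 q)
  have hsub : ∀ j, Integrable (fun y : ι → Request d => scored h q (x j) - scored h q (y j)) Q :=
    fun j => (integrable_const _).sub (hsc j)
  have hint : Integrable (fun y : ι → Request d => l * ∑ j ∈ s,
      (scored h q (x j) - scored h q (y j))) Q :=
    (integrable_finsetSum _ fun j _ => hsub j).const_mul _
  have hmean : ∫ y, l * ∑ j ∈ s, (scored h q (x j) - scored h q (y j)) ∂Q =
      l * ∑ j ∈ s, (scored h q (x j) - ∫ z, scored h q z ∂D) := by
    rw [integral_const_mul, integral_finsetSum _ fun j _ => hsub j]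
    congr 1
    refine Finset.sum_congr rfl fun j _ => ?_
    have hmp := measurePreserving_eval (fun _ : ι => D) j
    have := integral_map (μ := Q) (f := scored h q) hmp.measurable.aemeasurable
      (measurable_scored hm q).aestronglyMeasurable
    rw [(hmp.map_eq : Measure.map _ Q = D)] at this
    rw [integral_sub (integrable_const _) (hsc j), this]
    simp [hQ]
  have hexp : Integrable (fun y => symExp h s l (fun _ => true) x y q) Q := by
    refine Integrable.of_bound ((measurable_symExp hm s l _ q).comp hmx).aestronglyMeasurable
      (Real.exp (|l| * s.card)) (Filter.Eventually.of_forall fun y => ?_)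
    exact (Real.norm_of_nonneg (Real.exp_pos _).le).trans_le (symExp_le h01 s l _ _ _ q)
  have hsup : Integrable (fun y => F.sup' hF (symExp h s l (fun _ => true) x y)) Q :=
    Integrable.of_bound ((measurable_sup_symExp hm s l _ hF).comp hmx).aestronglyMeasurable _
      (Filter.Eventually.of_forall fun y => norm_sup_symExp_le h01 s l _ hF x y)
  rw [← hmean]
  refine (convexOn_exp.map_integral_le Real.continuous_exp.continuousOn isClosed_univ
    (by simp) hint ?_).trans ?_
  · convert! hexp using 1
    ext y
    simp [symExp, boolSign]
  · refine integral_mono ?_ hsup fun y => ?_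
    · convert! hexp using 1
      ext y
      simp [symExp, boolSign]
    · have := Finset.le_sup' (symExp h s l (fun _ => true) x y) hq
      refine le_trans (le_of_eq ?_) this
      simp [symExp, boolSign]

/-- Uniform deviation bound for finitely many halfspaces, with the growth function of the class
in place of the number of halfspaces. -/
lemma measure_finite_deviation_le {h : Request d → ℝ} (hm : Measurable h)
    (h01 : ∀ z, h z ∈ Set.Icc (0 : ℝ) 1) (s : Finset ι) (hs : s.Nonempty) {U : ℝ}
    (hU : 0 ≤ U) (F : Finset ((Fin d → ℝ) × ℝ)) :
    (Measure.pi fun _ : ι => D).real {x | ∃ q ∈ F, Real.sqrt s.card * U ≤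
      |∑ j ∈ s, (scored h q (x j) - ∫ z, scored h q z ∂D)|} ≤
      2 * ((2 * Fintype.card ι + 1 : ℝ) ^ (d + 1) * Real.exp (-(U ^ 2 / 2))) := by
  set Q := Measure.pi fun _ : ι => D with hQ
  rcases F.eq_empty_or_nonempty with rfl | hF
  · simp only [Finset.notMem_empty, false_and, exists_false, Set.ofPred_false, measureReal_empty]
    positivity
  have hn : (0 : ℝ) < s.card := by exact_mod_cast hs.card_pos
  have hsn : 0 < Real.sqrt s.card := Real.sqrt_pos.2 hn
  set W : ℝ → (ι → Request d) → ℝ := fun l x =>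
    ∫ y, F.sup' hF (symExp h s l (fun _ => true) x y) ∂Q with hW
  -- Markov's inequality at level `exp (U ^ 2)`. The relation `l ^ 2 * s.card = U ^ 2` is the
  -- optimal choice of `l`: the integral contributes `exp (U ^ 2 / 2)`, and `exp (-(U ^ 2 / 2))`
  -- remains.
  have hside : ∀ l : ℝ, l ^ 2 * s.card = U ^ 2 →
      Q.real {x | Real.exp (U ^ 2) ≤ W l x} ≤
        (2 * Fintype.card ι + 1 : ℝ) ^ (d + 1) * Real.exp (-(U ^ 2 / 2)) := by
    intro l hl
    have hint := integrable_sup_symExp D hm h01 s l (fun _ => true) hF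
    have hWint : Integrable (W l) Q := hint.integral_prod_left
    have hWnn : 0 ≤ᵐ[Q] W l := Filter.Eventually.of_forall fun x => by
      refine integral_nonneg fun y => ?_
      obtain ⟨q, hq⟩ := hF
      exact (Real.exp_pos _).le.trans (Finset.le_sup' (symExp h s l (fun _ => true) x y) hq)
    have hmk := mul_meas_ge_le_integral_of_nonneg hWnn hWint (Real.exp (U ^ 2))
    have hI : ∫ x, W l x ∂Q ≤
        (2 * Fintype.card ι + 1 : ℝ) ^ (d + 1) * Real.exp (s.card * l ^ 2 / 2) := by
      rw [hW, ← integral_prod _ hint]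
      exact integral_sup_symExp_le D hm h01 s l hF
    rw [mul_comm (s.card : ℝ), hl] at hI
    have h₃ : Real.exp (U ^ 2 / 2) = Real.exp (U ^ 2) * Real.exp (-(U ^ 2 / 2)) := by
      rw [← Real.exp_add]; congr 1; ring
    rw [h₃] at hI
    refine le_of_mul_le_mul_left ?_ (Real.exp_pos (U ^ 2))
    linarith
  have hl₁ : (U / Real.sqrt s.card) ^ 2 * s.card = U ^ 2 := by
    rw [div_pow, Real.sq_sqrt hn.le]; field_simp
  have hl₂ : (-(U / Real.sqrt s.card)) ^ 2 * s.card = U ^ 2 := by rw [neg_sq, hl₁]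
  have hsub : {x | ∃ q ∈ F, Real.sqrt s.card * U ≤
      |∑ j ∈ s, (scored h q (x j) - ∫ z, scored h q z ∂D)|} ⊆
      {x | Real.exp (U ^ 2) ≤ W (U / Real.sqrt s.card) x} ∪
      {x | Real.exp (U ^ 2) ≤ W (-(U / Real.sqrt s.card)) x} := by
    rintro x ⟨q, hq, hx⟩
    have hdev := fun l => exp_deviation_le D hm h01 s l hF hq x
    have hUn : U / Real.sqrt s.card * (Real.sqrt s.card * U) = U ^ 2 := by field_simp
    have hpos : 0 ≤ U / Real.sqrt s.card := by positivity
    rcases le_abs.1 hx with hx | hx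
    · refine Or.inl (le_trans (Real.exp_le_exp.2 ?_) (hdev _))
      rw [← hUn]
      exact mul_le_mul_of_nonneg_left hx hpos
    · refine Or.inr (le_trans (Real.exp_le_exp.2 ?_) (hdev _))
      rw [← hUn, neg_mul, ← mul_neg]
      exact mul_le_mul_of_nonneg_left hx hpos
  calc _ ≤ _ := measureReal_mono hsub
    _ ≤ _ := measureReal_union_le _ _
    _ ≤ _ := by linarith [hside _ hl₁, hside _ hl₂]

end Symmetrization

/-- The bound for finite families does not involve their size, so continuity from below along an
exhaustion extends it to countable ones. -/
lemma measure_countable_deviation_le {ι : Type*} [Fintype ι] (D : Measure (Request d))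
    [IsProbabilityMeasure D] {h : Request d → ℝ} (hm : Measurable h)
    (h01 : ∀ z, h z ∈ Set.Icc (0 : ℝ) 1) (s : Finset ι) (hs : s.Nonempty) {U : ℝ} (hU : 0 ≤ U)
    (e : ℕ → (Fin d → ℝ) × ℝ) :
    (Measure.pi fun _ : ι => D) {x | ∃ m, Real.sqrt s.card * U ≤
      |∑ j ∈ s, (scored h (e m) (x j) - ∫ z, scored h (e m) z ∂D)|} ≤
      ENNReal.ofReal
        (2 * ((2 * Fintype.card ι + 1 : ℝ) ^ (d + 1) * Real.exp (-(U ^ 2 / 2)))) := by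
  classical
  have hEq : {x : ι → Request d | ∃ m, Real.sqrt s.card * U ≤
      |∑ j ∈ s, (scored h (e m) (x j) - ∫ z, scored h (e m) z ∂D)|} =
      ⋃ M : ℕ, {x | ∃ q ∈ (Finset.range M).image e, Real.sqrt s.card * U ≤
        |∑ j ∈ s, (scored h q (x j) - ∫ z, scored h q z ∂D)|} := by
    ext x
    simp only [Set.mem_ofPred_eq, Set.mem_iUnion, Finset.mem_image, Finset.mem_range]
    constructor
    · rintro ⟨m, hm⟩
      exact ⟨m + 1, e m, ⟨m, by omega, rfl⟩, hm⟩
    · rintro ⟨M, q, ⟨m, -, rfl⟩, hm⟩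
      exact ⟨m, hm⟩
  rw [hEq, Monotone.measure_iUnion]
  · refine iSup_le fun M => ?_
    rw [← ofReal_measureReal]
    exact ENNReal.ofReal_le_ofReal (measure_finite_deviation_le D hm h01 s hs hU _)
  · rintro M M' hM x ⟨q, hq, hx⟩
    exact ⟨q, Finset.image_subset_image (Finset.range_subset_range.2 hM) hq, hx⟩

/-- An enumeration of the halfspaces with rational parameters. -/
def rationalParam (d : ℕ) (m : ℕ) : (Fin d → ℝ) × ℝ :=
  match Encodable.decode (α := (Fin d → ℚ) × ℚ) m with
  | some q => (fun i => q.1 i, q.2)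
  | none => 0

lemma exists_rationalParam_eq (q : (Fin d → ℚ) × ℚ) :
    ∃ m, rationalParam d m = (fun i => (q.1 i : ℝ), (q.2 : ℝ)) :=
  ⟨Encodable.encode q, by simp [rationalParam]⟩

/-- Halfspaces are limits of halfspaces with rational parameters, pointwise on bounded
resource vectors. -/
lemma exists_rationalParam_approx (h : Request d → ℝ) (A : ℝ) (q : (Fin d → ℝ) × ℝ) :
    ∃ r : ℕ → ℕ, ∀ z : Request d, ‖z.2‖ ≤ A →
      ∀ᶠ n in Filter.atTop, scored h (rationalParam d (r n)) z = scored h q z := by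
  -- Replacing the price by a rational one within `1 / (n + 1)` changes the bid price by at most `d
  -- * A / (n + 1)`. Raising the constant by more than this keeps the approximating halfspace inside
  -- the given one; since halfspaces are defined by a strict inequality, approximation from inside
  -- converges pointwise.
  have hex : ∀ n : ℕ, ∃ m, (∀ i, |(rationalParam d m).1 i - q.1 i| ≤ 1 / ((n : ℝ) + 1)) ∧
      q.2 + d * A / ((n : ℝ) + 1) < (rationalParam d m).2 ∧
      (rationalParam d m).2 < q.2 + d * A / ((n : ℝ) + 1) + 1 / ((n : ℝ) + 1) := by
    intro n
    have hn : (0 : ℝ) < 1 / ((n : ℝ) + 1) := by positivity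
    have h₁ : ∀ i, ∃ a : ℚ, q.1 i < a ∧ (a : ℝ) < q.1 i + 1 / ((n : ℝ) + 1) := fun i =>
      exists_rat_btwn (by linarith)
    choose a ha using h₁
    obtain ⟨c, hc⟩ := exists_rat_btwn
      (show q.2 + d * A / ((n : ℝ) + 1) < q.2 + d * A / ((n : ℝ) + 1) + 1 / ((n : ℝ) + 1) by
        linarith)
    obtain ⟨m, hm⟩ := exists_rationalParam_eq (a, c)
    refine ⟨m, fun i => ?_, ?_, ?_⟩ <;> rw [hm]
    · rw [abs_of_pos (by simpa using (ha i).1)]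
      linarith [(ha i).2]
    · exact hc.1
    · exact hc.2
  choose r hr using hex
  refine ⟨r, fun z hz => ?_⟩
  have hA : 0 ≤ A := (norm_nonneg _).trans hz
  have hdot : ∀ n : ℕ, |(rationalParam d (r n)).1 ⬝ᵥ z.2 - q.1 ⬝ᵥ z.2| ≤ d * A / ((n : ℝ) + 1) := by
    intro n
    rw [← sub_dotProduct]
    refine (Finset.abs_sum_le_sum_abs _ _).trans ?_
    calc _ ≤ ∑ _i : Fin d, 1 / ((n : ℝ) + 1) * A := by
          refine Finset.sum_le_sum fun i _ => ?_
          rw [abs_mul]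
          exact mul_le_mul ((hr n).1 i) ((norm_le_pi_norm z.2 i).trans hz) (abs_nonneg _)
            (by positivity)
      _ = _ := by simp; ring
  have hlt : ∀ n, q.1 ⬝ᵥ z.2 + q.2 <
      (rationalParam d (r n)).1 ⬝ᵥ z.2 + (rationalParam d (r n)).2 := by
    intro n
    have := abs_le.1 (hdot n)
    linarith [(hr n).2.1]
  by_cases hzq : z ∈ halfspace q
  · have hgap : 0 < z.1 - (q.1 ⬝ᵥ z.2 + q.2) := sub_pos.2 hzq
    have hlim : Filter.Tendsto (fun n : ℕ => (2 * (d * A) + 1) * (1 / ((n : ℝ) + 1)))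
        Filter.atTop (nhds 0) := by
      simpa using tendsto_one_div_add_atTop_nhds_zero_nat.const_mul (2 * (d * A) + 1)
    filter_upwards [hlim.eventually_lt_const hgap] with n hn
    have hmem : z ∈ halfspace (rationalParam d (r n)) := by
      have h₁ := abs_le.1 (hdot n)
      have h₂ := (hr n).2.2
      have h₃ : (2 * (d * A) + 1) * (1 / ((n : ℝ) + 1)) =
        d * A / ((n : ℝ) + 1) + d * A / ((n : ℝ) + 1) + 1 / ((n : ℝ) + 1) := by ring
      simp only [halfspace, Set.mem_ofPred_eq]
      linarith
    simp [scored, hzq, hmem]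
  · refine Filter.Eventually.of_forall fun n => ?_
    have hmem : z ∉ halfspace (rationalParam d (r n)) := fun hz' =>
      hzq ((hlt n).trans hz')
    simp [scored, hzq, hmem]

/-- A deviation bound for the halfspaces with rational parameters extends to all halfspaces. -/
lemma deviation_le_of_rational {κ : Type*} (D : Measure (Request d)) [IsProbabilityMeasure D]
    {h : Request d → ℝ} (hm : Measurable h) (h01 : ∀ z, h z ∈ Set.Icc (0 : ℝ) 1) {A : ℝ}
    (hD : ∀ᵐ z ∂D, ‖z.2‖ ≤ A) (s : Finset κ) (x : κ → Request d) (hx : ∀ j ∈ s, ‖(x j).2‖ ≤ A)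
    {c : ℝ} (hc : ∀ m, |∑ j ∈ s, (scored h (rationalParam d m) (x j) -
      ∫ z, scored h (rationalParam d m) z ∂D)| ≤ c) (q : (Fin d → ℝ) × ℝ) :
    |∑ j ∈ s, (scored h q (x j) - ∫ z, scored h q z ∂D)| ≤ c := by
  obtain ⟨r, hr⟩ := exists_rationalParam_approx h A q
  have hint : Filter.Tendsto (fun n => ∫ z, scored h (rationalParam d (r n)) z ∂D)
      Filter.atTop (nhds (∫ z, scored h q z ∂D)) := by
    refine tendsto_integral_of_dominated_convergence (fun _ => 1)
      (fun n => (measurable_scored hm _).aestronglyMeasurable) (integrable_const _)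
      (fun n => Filter.Eventually.of_forall fun z => ?_) ?_
    · rw [Real.norm_of_nonneg (scored_mem_Icc h01 _ z).1]
      exact (scored_mem_Icc h01 _ z).2
    · filter_upwards [hD] with z hz
      exact tendsto_const_nhds.congr' ((hr z hz).mono fun n hn => hn.symm)
  have hlim : Filter.Tendsto (fun n => |∑ j ∈ s, (scored h (rationalParam d (r n)) (x j) -
      ∫ z, scored h (rationalParam d (r n)) z ∂D)|) Filter.atTop
      (nhds |∑ j ∈ s, (scored h q (x j) - ∫ z, scored h q z ∂D)|) := by
    refine (tendsto_finsetSum _ fun j hj => ?_).abs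
    exact (tendsto_const_nhds.congr' ((hr _ (hx j hj)).mono fun n hn => hn.symm)).sub hint
  exact le_of_tendsto' hlim fun n => hc _

/-! ### Deviations of all initial segments of an i.i.d. sample. -/

/-- The first `n` positions of a sample of size `T`. -/
def firstPositions (T n : ℕ) : Finset (Fin T) := Finset.univ.filter fun j => (j : ℕ) < n

lemma card_firstPositions {T n : ℕ} (hn : n ≤ T) : (firstPositions T n).card = n := by
  unfold firstPositions
  rw [Fin.card_filter_val_lt]
  omega

/-- The samples for which the scores of some initial segment deviate from their mean for
some halfspace with rational parameters. -/
def deviantSamples (D : Measure (Request d)) (h : Request d → ℝ) (T : ℕ) (U : ℝ) :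
    Set (Fin T → Request d) :=
  {x | ∃ n ∈ Finset.Icc 1 T, ∃ m, Real.sqrt (n : ℝ) * U ≤ |∑ j ∈ firstPositions T n,
    (scored h (rationalParam d m) (x j) - ∫ z, scored h (rationalParam d m) z ∂D)|}

lemma measurableSet_deviantSamples (D : Measure (Request d)) {h : Request d → ℝ}
    (hm : Measurable h) (T : ℕ) (U : ℝ) : MeasurableSet (deviantSamples D h T U) := by
  have : deviantSamples D h T U = ⋃ n ∈ Finset.Icc 1 T, ⋃ m, {x | Real.sqrt (n : ℝ) * U ≤
      |∑ j ∈ firstPositions T n, (scored h (rationalParam d m) (x j) -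
        ∫ z, scored h (rationalParam d m) z ∂D)|} := by
    ext x
    simp only [deviantSamples, Set.mem_ofPred_eq, Set.mem_iUnion, exists_prop]
  rw [this]
  refine Finset.measurableSet_biUnion _ fun n _ => MeasurableSet.iUnion fun m => ?_
  have := measurable_scored hm (rationalParam d m)
  exact measurableSet_le measurable_const (by fun_prop)

/-- A union bound over the `T` lengths of the segment; the growth factor counts traces on `2 * T`
points for all of them. -/
lemma measure_deviantSamples_le (D : Measure (Request d)) [IsProbabilityMeasure D]
    {h : Request d → ℝ} (hm : Measurable h) (h01 : ∀ z, h z ∈ Set.Icc (0 : ℝ) 1) (T : ℕ) {U : ℝ}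
    (hU : 0 ≤ U) : (Measure.pi fun _ : Fin T => D) (deviantSamples D h T U) ≤
      ENNReal.ofReal
        (T * (2 * ((2 * T + 1 : ℝ) ^ (d + 1) * Real.exp (-(U ^ 2 / 2))))) := by
  have hsub : deviantSamples D h T U ⊆ ⋃ n ∈ Finset.Icc 1 T,
      {x | ∃ m, Real.sqrt (firstPositions T n).card * U ≤ |∑ j ∈ firstPositions T n,
        (scored h (rationalParam d m) (x j) - ∫ z, scored h (rationalParam d m) z ∂D)|} := by
    rintro x ⟨n, hn, m, hx⟩
    simp only [Set.mem_iUnion]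
    exact ⟨n, hn, m, by rwa [card_firstPositions (Finset.mem_Icc.1 hn).2]⟩
  refine (measure_mono hsub).trans ((measure_biUnion_finset_le _ _).trans ?_)
  refine (Finset.sum_le_card_nsmul _ _
    (ENNReal.ofReal (2 * ((2 * T + 1 : ℝ) ^ (d + 1) * Real.exp (-(U ^ 2 / 2)))))
    fun n hn => ?_).trans ?_
  · have hne : (firstPositions T n).Nonempty := by
      rw [← Finset.card_pos, card_firstPositions (Finset.mem_Icc.1 hn).2]
      exact (Finset.mem_Icc.1 hn).1
    have := measure_countable_deviation_le D hm h01 (firstPositions T n) hne hU (rationalParam d)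
    rwa [Fintype.card_fin] at this
  · rw [Nat.card_Icc, Nat.add_sub_cancel, nsmul_eq_mul, ENNReal.ofReal_mul (p := (T : ℝ))
      (by positivity), ENNReal.ofReal_natCast]

/-! ### Conditioning on the past -/

section Conditioning

variable {Ω Ω' X : Type*} [MeasurableSpace Ω] [MeasurableSpace Ω'] [MeasurableSpace X]

/-- If `Z` has law `D` independently of `φ`, then `(φ, Z)` has a product law. -/
lemma map_prodMk_eq_prod (ν : Measure Ω) [IsFiniteMeasure ν] {φ : Ω → Ω'} (hφ : Measurable φ)
    {Z : Ω → X} (hZ : Measurable Z) (D : Measure X) [IsProbabilityMeasure D]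
    (h : ∀ E, MeasurableSet E → ∀ S, MeasurableSet S → ν (φ ⁻¹' E ∩ Z ⁻¹' S) = ν (φ ⁻¹' E) * D S) :
    ν.map (fun ω => (φ ω, Z ω)) = (ν.map φ).prod D := by
  refine (Measure.prod_eq fun E S hE hS => ?_).symm
  rw [Measure.map_apply (hφ.prodMk hZ) (hE.prod hS), Measure.map_apply hφ hE, ← h E hE S hS]
  rfl

variable {P : Measure Ω} [IsProbabilityMeasure P] {D : Fin K → Measure X}
  [∀ k, IsProbabilityMeasure (D k)] {φ : Ω → Ω'} {θ : Ω → Fin K} {Z : Ω → X}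

/-- On the event that `k` is selected the request is a fresh draw from `D k`. Restricting the
measure to this event avoids conditional probabilities. -/
lemma map_restrict_prodMk_eq_prod (hφ : Measurable φ) (hZ : Measurable Z)
    (hobs : ∀ E, MeasurableSet E → ∀ k S, MeasurableSet S →
      P (φ ⁻¹' E ∩ {ω | θ ω = k} ∩ {ω | Z ω ∈ S}) = P (φ ⁻¹' E ∩ {ω | θ ω = k}) * D k S)
    (k : Fin K) :
    (P.restrict {ω | θ ω = k}).map (fun ω => (φ ω, Z ω)) =
      ((P.restrict {ω | θ ω = k}).map φ).prod (D k) := by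
  refine map_prodMk_eq_prod _ hφ hZ (D k) fun E hE S hS => ?_
  rw [Measure.restrict_apply ((hφ hE).inter (hZ hS)), Measure.restrict_apply (hφ hE),
    ← hobs E hE k S hS, Set.inter_right_comm]
  rfl

/-- The conditional expectation of a function of the past, the configuration and the request of a
round is obtained by averaging over the mixture and the distributions of the requests. -/
lemma integral_condition (hφ : Measurable φ) (hθ : Measurable θ) (hZ : Measurable Z)
    (hobs : ∀ E, MeasurableSet E → ∀ k S, MeasurableSet S →
      P (φ ⁻¹' E ∩ {ω | θ ω = k} ∩ {ω | Z ω ∈ S}) = P (φ ⁻¹' E ∩ {ω | θ ω = k}) * D k S)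
    {w : Ω → Fin K → ℝ} (hw : Measurable w) (hw0 : ∀ᵐ ω ∂P, ∀ k, 0 ≤ w ω k)
    (hw1 : ∀ᵐ ω ∂P, ∀ k, w ω k ≤ 1)
    (hdraw : ∀ E, MeasurableSet E → ∀ k,
      P (φ ⁻¹' E ∩ {ω | θ ω = k}) = ∫⁻ ω in φ ⁻¹' E, ENNReal.ofReal (w ω k) ∂P)
    {Ψ : Ω' → Fin K → X → ℝ} (hΨ : ∀ k, Measurable fun u : Ω' × X => Ψ u.1 k u.2) {C : ℝ}
    (hC : ∀ u k z, |Ψ u k z| ≤ C) :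
    ∫ ω, Ψ (φ ω) (θ ω) (Z ω) ∂P = ∫ ω, ∑ k, w ω k * ∫ z, Ψ (φ ω) k z ∂(D k) ∂P := by
  have hset : ∀ k, MeasurableSet {ω | θ ω = k} := fun k => hθ (measurableSet_singleton k)
  have hwk : ∀ k, Measurable fun ω => w ω k := fun k => (measurable_pi_apply k).comp hw
  have hΨc : ∀ k, Measurable fun ω => Ψ (φ ω) k (Z ω) := fun k => (hΨ k).comp (hφ.prodMk hZ)
  have hg : ∀ k, Measurable fun u => ∫ z, Ψ u k z ∂(D k) := fun k =>
    ((hΨ k).stronglyMeasurable.integral_prod_right (ν := D k)).measurable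
  have hgC : ∀ u k, ‖∫ z, Ψ u k z ∂(D k)‖ ≤ C := fun u k => by
    refine (norm_integral_le_of_norm_le_const (Filter.Eventually.of_forall fun z => hC u k z)).trans ?_
    simp
  have hsplit : ∀ ω, Ψ (φ ω) (θ ω) (Z ω) =
      ∑ k, {ω | θ ω = k}.indicator (fun ω => Ψ (φ ω) k (Z ω)) ω := by
    intro ω
    rw [Finset.sum_eq_single (θ ω)]
    · simp
    · intro k _ hk
      simp [Ne.symm hk]
    · simp
  -- Restricting to the selection of `k` and weighting by its probability `w ω k` induce the same
  -- law of the past; this is where the draw from the mixture enters.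
  have hdens : ∀ k, (P.restrict {ω | θ ω = k}).map φ =
      (P.withDensity fun ω => ENNReal.ofReal (w ω k)).map φ := by
    intro k
    ext E hE
    rw [Measure.map_apply hφ hE, Measure.map_apply hφ hE, Measure.restrict_apply (hφ hE),
      withDensity_apply _ (hφ hE), hdraw E hE k]
  have hterm : ∀ k, ∫ ω in {ω | θ ω = k}, Ψ (φ ω) k (Z ω) ∂P =
      ∫ ω, w ω k * ∫ z, Ψ (φ ω) k z ∂(D k) ∂P := by
    intro k
    have h₁ : ∫ ω in {ω | θ ω = k}, Ψ (φ ω) k (Z ω) ∂P =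
        ∫ u, Ψ u.1 k u.2 ∂((P.restrict {ω | θ ω = k}).map fun ω => (φ ω, Z ω)) :=
      (integral_map (hφ.prodMk hZ).aemeasurable (hΨ k).aestronglyMeasurable).symm
    rw [h₁, map_restrict_prodMk_eq_prod hφ hZ hobs k, integral_prod]
    · rw [hdens k, integral_map hφ.aemeasurable (hg k).aestronglyMeasurable,
        integral_withDensity_eq_integral_toReal_smul (hwk k).ennreal_ofReal
          (Filter.Eventually.of_forall fun _ => ENNReal.ofReal_lt_top)]
      refine integral_congr_ae ?_
      filter_upwards [hw0] with ω hω
      rw [ENNReal.toReal_ofReal (hω k), smul_eq_mul]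
    · exact Integrable.of_bound (hΨ k).aestronglyMeasurable C
        (Filter.Eventually.of_forall fun u => hC u.1 k u.2)
  simp_rw [hsplit]
  rw [integral_finsetSum, integral_finsetSum]
  · refine Finset.sum_congr rfl fun k _ => ?_
    rw [integral_indicator (hset k), hterm k]
  · intro k _
    refine Integrable.of_bound ((hwk k).mul ((hg k).comp hφ)).aestronglyMeasurable C ?_
    filter_upwards [hw0, hw1] with ω h0 h1
    rw [norm_mul, Real.norm_of_nonneg (h0 k)]
    exact (mul_le_of_le_one_left (norm_nonneg _) (h1 k)).trans (hgC _ k)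
  · intro k _
    exact (Integrable.of_bound (hΨc k).aestronglyMeasurable C
      (Filter.Eventually.of_forall fun ω => hC _ k _)).indicator (hset k)

end Conditioning

/-! ### Coupling the samples of a configuration with an independent sample -/

lemma sampleCount_succ (θ : ℕ → Fin K) (k : Fin K) (t : ℕ) :
    sampleCount θ k (t + 1) = sampleCount θ k t + if θ t = k then 1 else 0 := by
  unfold sampleCount
  rw [Finset.range_add_one, Finset.filter_insert]
  split_ifs
  · rw [Finset.card_insert_of_notMem (by simp)]
  · rfl

lemma sampleCount_le (θ : ℕ → Fin K) (k : Fin K) (t : ℕ) : sampleCount θ k t ≤ t :=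
  (Finset.card_filter_le _ _).trans (by simp)

lemma sampleCount_congr {θ θ' : ℕ → Fin K} (k : Fin K) {t : ℕ} (h : ∀ s < t, θ s = θ' s) :
    sampleCount θ k t = sampleCount θ' k t := by
  unfold sampleCount
  congr 1
  refine Finset.filter_congr fun s hs => ?_
  rw [h s (Finset.mem_range.1 hs)]

/-- The sample `ξ` with the entry at position `n`, if there is one, replaced by `z`. -/
def replaceAt {T : ℕ} (ξ : Fin T → Request d) (n : ℕ) (z : Request d) : Fin T → Request d :=
  fun j => if (j : ℕ) = n then z else ξ j

/-- Overwriting one of several independent coordinates by a fresh draw from the same law preserves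
the product law. For `T ≤ n` nothing is overwritten. -/
lemma map_replaceAt (D : Measure (Request d)) [IsProbabilityMeasure D] (T n : ℕ) :
    (D.prod (Measure.pi fun _ : Fin T => D)).map (fun u => replaceAt u.2 n u.1) =
      Measure.pi fun _ : Fin T => D := by
  classical
  have hmeas : Measurable fun u : Request d × (Fin T → Request d) => replaceAt u.2 n u.1 := by
    refine measurable_pi_iff.2 fun j => ?_
    unfold replaceAt
    split_ifs <;> fun_prop
  refine (Measure.pi_eq fun s hs => ?_).symm
  rw [Measure.map_apply hmeas (MeasurableSet.univ_pi hs)]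
  have hpre : (fun u : Request d × (Fin T → Request d) => replaceAt u.2 n u.1) ⁻¹'
      Set.univ.pi s = (⋂ j : Fin T, if (j : ℕ) = n then s j else Set.univ) ×ˢ
        Set.univ.pi fun j : Fin T => if (j : ℕ) = n then Set.univ else s j := by
    ext u
    simp only [Set.mem_preimage, Set.mem_pi, Set.mem_univ, true_imp_iff, Set.mem_prod,
      Set.mem_iInter, replaceAt, ← forall_and]
    refine forall_congr' fun j => ?_
    split_ifs <;> simp
  rw [hpre, Measure.prod_prod, Measure.pi_pi]
  by_cases hn : n < T
  · have h₁ : (⋂ j : Fin T, if (j : ℕ) = n then s j else Set.univ) = s ⟨n, hn⟩ := by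
      ext z
      simp only [Set.mem_iInter]
      refine ⟨fun h => by simpa using h ⟨n, hn⟩, fun h j => ?_⟩
      split_ifs with hj
      · obtain rfl : j = ⟨n, hn⟩ := Fin.ext hj
        exact h
      · trivial
    rw [h₁, ← Finset.mul_prod_erase Finset.univ (fun j => D (s j)) (Finset.mem_univ ⟨n, hn⟩),
      ← Finset.mul_prod_erase Finset.univ _ (Finset.mem_univ (⟨n, hn⟩ : Fin T))]
    simp only [if_true, measure_univ, one_mul]
    congr 1
    refine Finset.prod_congr rfl fun j hj => ?_
    rw [if_neg fun h => (Finset.mem_erase.1 hj).1 (Fin.ext h)]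
  · have h₁ : ∀ j : Fin T, (j : ℕ) ≠ n := fun j => by omega
    simp [h₁]

/-- The requests observed under configuration `k` in the first `t` rounds of the history `η`,
in order, followed by the remaining entries of the sample `ξ`. -/
def stack {T : ℕ} (k : Fin K) (η : ℕ → Fin K × Request d) (ξ : Fin T → Request d) :
    ℕ → Fin T → Request d
  | 0 => ξ
  | t + 1 => if (η t).1 = k
      then replaceAt (stack k η ξ t) (sampleCount (fun s => (η s).1) k t) (η t).2
      else stack k η ξ t

lemma stack_congr {T : ℕ} (k : Fin K) {η η' : ℕ → Fin K × Request d} (ξ : Fin T → Request d)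
    {t : ℕ} (h : ∀ s < t, η s = η' s) : stack k η ξ t = stack k η' ξ t := by
  induction t with
  | zero => rfl
  | succ t ih =>
    have hlt : ∀ s < t, η s = η' s := fun s hs => h s (by omega)
    rw [stack, stack, ih hlt, h t (by omega), sampleCount_congr k fun s hs => by rw [hlt s hs]]

/-- The history writes only to positions below the current count, so a change of the sample at or
beyond the count survives the stacking. -/
lemma stack_replaceAt {T : ℕ} (k : Fin K) (η : ℕ → Fin K × Request d) (ξ : Fin T → Request d)
    (z : Request d) {t n : ℕ} (hn : sampleCount (fun s => (η s).1) k t ≤ n) :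
    stack k η (replaceAt ξ n z) t = replaceAt (stack k η ξ t) n z := by
  induction t with
  | zero => rfl
  | succ t ih =>
    rw [sampleCount_succ] at hn
    rw [stack, stack, ih (by omega)]
    split_ifs with hk
    · rw [if_pos hk] at hn
      ext1 j
      unfold replaceAt
      split_ifs <;> first | rfl | omega
    · rfl

/-- Each selection of `k` advances the count, so a position, once written, is never overwritten. -/
lemma stack_apply_sampleCount {T : ℕ} (k : Fin K) (η : ℕ → Fin K × Request d)
    (ξ : Fin T → Request d) {s t : ℕ} (hst : s < t) (hk : (η s).1 = k) (j : Fin T)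
    (hj : (j : ℕ) = sampleCount (fun s => (η s).1) k s) : stack k η ξ t j = (η s).2 := by
  induction t, hst using Nat.le_induction with
  | base => simp [stack, hk, replaceAt, hj]
  | succ t hst ih =>
    rw [stack]
    split_ifs with h
    · have hlt : sampleCount (fun s => (η s).1) k s < sampleCount (fun s => (η s).1) k t := by
        have h₁ : sampleCount (fun s => (η s).1) k (s + 1) ≤
            sampleCount (fun s => (η s).1) k t :=
          Finset.card_le_card (Finset.filter_subset_filter _ (Finset.range_subset_range.2 hst))
        rw [sampleCount_succ, if_pos hk] at h₁
        omega
      rw [replaceAt, if_neg (by omega), ih]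
    · exact ih

/-- The observations under `k` fill the initial positions of the stacked sample in order. Stacking
up to the final round `T` lets all times `t` be read off from one sample; `t ≤ T` guarantees enough
positions. -/
lemma sum_filter_eq_sum_stack {T : ℕ} (k : Fin K) (η : ℕ → Fin K × Request d)
    (ξ : Fin T → Request d) (f : Request d → ℝ) {t : ℕ} (ht : t ≤ T) :
    ∑ s ∈ (Finset.range t).filter (fun s => (η s).1 = k), f (η s).2 =
      ∑ j ∈ firstPositions T (sampleCount (fun s => (η s).1) k t), f (stack k η ξ T j) := by
  induction t with
  | zero => simp [sampleCount, firstPositions]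
  | succ t ih =>
    rw [Finset.range_add_one, Finset.filter_insert, sampleCount_succ]
    split_ifs with hk
    · set n := sampleCount (fun s => (η s).1) k t
      have hn : n < T := (sampleCount_le _ k t).trans_lt ht
      have hins : firstPositions T (n + 1) = insert ⟨n, hn⟩ (firstPositions T n) := by
        ext j
        simp only [firstPositions, Finset.mem_filter, Finset.mem_univ, true_and,
          Finset.mem_insert, Fin.ext_iff]
        omega
      rw [Finset.sum_insert (by simp), ih (by omega), hins,
        Finset.sum_insert (by simp [firstPositions]),
        stack_apply_sampleCount k η ξ ht hk ⟨n, hn⟩ rfl]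
    · rw [ih (by omega), add_zero]

lemma measurable_sampleCount {Ω : Type*} [MeasurableSpace Ω] {θ : ℕ → Ω → Fin K} (k : Fin K)
    {t : ℕ} (h : ∀ s < t, Measurable (θ s)) :
    Measurable fun ω => sampleCount (fun s => θ s ω) k t := by
  induction t with
  | zero => simp [sampleCount]
  | succ t ih =>
    simp_rw [sampleCount_succ]
    refine (ih fun s hs => h s (by omega)).add (Measurable.ite ?_ measurable_const measurable_const)
    exact h t (by omega) (measurableSet_singleton k)

lemma measurable_replaceAt {Ω : Type*} [MeasurableSpace Ω] {T : ℕ} {x : Ω → Fin T → Request d}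
    {n : Ω → ℕ} {z : Ω → Request d} (hx : Measurable x) (hn : Measurable n) (hz : Measurable z) :
    Measurable fun ω => replaceAt (x ω) (n ω) (z ω) := by
  refine measurable_pi_iff.2 fun j => ?_
  unfold replaceAt
  exact Measurable.ite (measurableSet_eq_fun measurable_const hn) hz
    ((measurable_pi_apply j).comp hx)

lemma measurable_stack (k : Fin K) (T t : ℕ) :
    Measurable fun u : (ℕ → Fin K × Request d) × (Fin T → Request d) => stack k u.1 u.2 t := by
  induction t with
  | zero => exact measurable_snd
  | succ t ih =>
    simp_rw [stack]
    refine Measurable.ite ?_ (measurable_replaceAt ih ?_ ?_) ih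
    · have : Measurable fun u : (ℕ → Fin K × Request d) × (Fin T → Request d) => (u.1 t).1 := by
        fun_prop
      exact this (measurableSet_singleton k)
    · exact measurable_sampleCount k (θ := fun s (u : (ℕ → Fin K × Request d) ×
        (Fin T → Request d)) => (u.1 s).1) fun s _ => by fun_prop
    · fun_prop

/-! ### The uniform deviation event of a run -/

section Run

variable {Ω : Type*} {mΩ : MeasurableSpace Ω} {P : Measure Ω} [IsProbabilityMeasure P]
  {ℱ : Filtration ℕ mΩ} {D : Fin K → Measure (Request d)} [∀ k, IsProbabilityMeasure (D k)]
  {cg c₀ Rmax Amax : ℝ} {b : Fin d → ℝ} {T : ℕ} {α δ : ℝ} {θ : ℕ → Ω → Fin K}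
  {Z : ℕ → Ω → Request d} {w : ℕ → Ω → Fin K → ℝ} {p : ℕ → Ω → Fin d → ℝ}

/-- The history of the first `t` rounds, continued by a default value. -/
def pastHistory (k₀ : Fin K) (θ : ℕ → Ω → Fin K) (Z : ℕ → Ω → Request d) (t : ℕ) (ω : Ω) :
    ℕ → Fin K × Request d :=
  fun s => if s < t then (θ s ω, Z s ω) else (k₀, 0)

omit [IsProbabilityMeasure P] [∀ k, IsProbabilityMeasure (D k)] in
lemma IsRun.measurable_config_of_lt (hrun : IsRun P ℱ D cg c₀ Rmax Amax b T α δ θ Z w p) {s t : ℕ}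
    (hst : s < t) (ht : t ≤ T) : Measurable[ℱ t] (θ s) :=
  (hrun.measurable_config s (by omega)).mono (ℱ.mono hst) le_rfl

omit [IsProbabilityMeasure P] [∀ k, IsProbabilityMeasure (D k)] in
lemma IsRun.measurable_request_of_lt (hrun : IsRun P ℱ D cg c₀ Rmax Amax b T α δ θ Z w p)
    {s t : ℕ} (hst : s < t) (ht : t ≤ T) : Measurable[ℱ t] (Z s) :=
  (hrun.measurable_request s (by omega)).mono (ℱ.mono hst) le_rfl

omit [IsProbabilityMeasure P] [∀ k, IsProbabilityMeasure (D k)] in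
lemma IsRun.measurable_pastHistory (hrun : IsRun P ℱ D cg c₀ Rmax Amax b T α δ θ Z w p)
    (k₀ : Fin K) {t : ℕ} (ht : t ≤ T) : Measurable[ℱ t] (pastHistory k₀ θ Z t) := by
  refine @measurable_pi_lambda _ _ _ (ℱ t) _ _ fun s => ?_
  unfold pastHistory
  by_cases hs : s < t
  · simp only [hs, if_true]
    exact Measurable.prodMk (hrun.measurable_config_of_lt hs ht)
      (hrun.measurable_request_of_lt hs ht)
  · simp only [hs, if_false]
    exact @measurable_const _ _ _ (ℱ t) _

omit [IsProbabilityMeasure P] [∀ k, IsProbabilityMeasure (D k)] in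
lemma IsRun.observe_preimage (hrun : IsRun P ℱ D cg c₀ Rmax Amax b T α δ θ Z w p) {t : ℕ}
    (ht : t < T) {Ω' : Type*} [MeasurableSpace Ω'] {φ : Ω → Ω'} (hφ : Measurable[ℱ t] φ) (E : Set Ω')
    (hE : MeasurableSet E) (k : Fin K) (S : Set (Request d)) (hS : MeasurableSet S) :
    P (φ ⁻¹' E ∩ {ω | θ t ω = k} ∩ {ω | Z t ω ∈ S}) = P (φ ⁻¹' E ∩ {ω | θ t ω = k}) * D k S :=
  hrun.observe t ht _ (hφ hE) k S hS

lemma pastHistory_succ_of_lt (k₀ : Fin K) (θ : ℕ → Ω → Fin K) (Z : ℕ → Ω → Request d) {s t : ℕ}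
    (hs : s < t) (ω : Ω) : pastHistory k₀ θ Z (t + 1) ω s = pastHistory k₀ θ Z t ω s := by
  simp [pastHistory, hs, hs.trans (Nat.lt_succ_self t)]

lemma stack_pastHistory_succ (k₀ k : Fin K) (θ : ℕ → Ω → Fin K) (Z : ℕ → Ω → Request d) (t : ℕ)
    (ω : Ω) (ξ : Fin T → Request d) :
    stack k (pastHistory k₀ θ Z (t + 1) ω) ξ (t + 1) =
      if θ t ω = k then replaceAt (stack k (pastHistory k₀ θ Z t ω) ξ t)
        (sampleCount (fun s => (pastHistory k₀ θ Z t ω s).1) k t) (Z t ω)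
      else stack k (pastHistory k₀ θ Z t ω) ξ t := by
  have h : pastHistory k₀ θ Z (t + 1) ω t = (θ t ω, Z t ω) := by simp [pastHistory]
  rw [stack, h, stack_congr k ξ fun s hs => pastHistory_succ_of_lt k₀ θ Z hs ω,
    sampleCount_congr k fun s hs => by rw [pastHistory_succ_of_lt k₀ θ Z hs ω]]

/-- Writing a fresh request at the first free position has the same effect as refreshing that entry
of `ξ` before stacking, and refreshing preserves the product law. -/
lemma lintegral_measure_replaceAt_stack (D : Measure (Request d)) [IsProbabilityMeasure D]
    (k : Fin K) (η : ℕ → Fin K × Request d) (t : ℕ) {S : Set (Fin T → Request d)}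
    (hS : MeasurableSet S) :
    ∫⁻ z, (Measure.pi fun _ : Fin T => D) {ξ | replaceAt (stack k η ξ t)
        (sampleCount (fun s => (η s).1) k t) z ∈ S} ∂D =
      (Measure.pi fun _ : Fin T => D) {ξ | stack k η ξ t ∈ S} := by
  set n := sampleCount (fun s => (η s).1) k t
  have hst : Measurable fun ξ : Fin T → Request d => stack k η ξ t :=
    (measurable_stack k T t).comp measurable_prodMk_left
  have hrep : Measurable fun u : Request d × (Fin T → Request d) => replaceAt u.2 n u.1 :=
    measurable_replaceAt measurable_snd measurable_const measurable_fst
  conv_rhs => rw [← map_replaceAt D T n]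
  change _ = Measure.map _ _ ((fun ξ => stack k η ξ t) ⁻¹' S)
  rw [Measure.map_apply hrep (hst hS), Measure.prod_apply (hrep (hst hS))]
  refine lintegral_congr fun z => ?_
  congr 1
  ext ξ
  simp only [Set.mem_ofPred_eq, Set.mem_preimage]
  rw [stack_replaceAt k η ξ z le_rfl]

/-- The coupling: averaged over the run and over an independent `ξ`, the stacked sample is i.i.d.,
although configurations are chosen adaptively. In each round the new entry is fresh if `k` is
selected, and nothing changes otherwise. Only the measure of the sections in `ξ` is used, so the
probability space need not be enlarged. -/
lemma IsRun.lintegral_measure_stack (hrun : IsRun P ℱ D cg c₀ Rmax Amax b T α δ θ Z w p)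
    (k₀ k : Fin K) {t : ℕ} (ht : t ≤ T) {S : Set (Fin T → Request d)} (hS : MeasurableSet S) :
    ∫⁻ ω, (Measure.pi fun _ : Fin T => D k) {ξ | stack k (pastHistory k₀ θ Z t ω) ξ t ∈ S} ∂P =
      (Measure.pi fun _ : Fin T => D k) S := by
  induction t with
  | zero => simp [stack]
  | succ t ih =>
    set Q := Measure.pi fun _ : Fin T => D k with hQ
    have htT : t < T := ht
    have hφℱ := hrun.measurable_pastHistory k₀ htT.le
    have hφ : Measurable (pastHistory k₀ θ Z t) := hφℱ.mono (ℱ.le t) le_rfl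
    have hZ : Measurable (Z t) := (hrun.measurable_request t htT).mono (ℱ.le _) le_rfl
    have hA : MeasurableSet {ω | θ t ω = k} :=
      ((hrun.measurable_config t htT).mono (ℱ.le _) le_rfl) (measurableSet_singleton k)
    set Φ : (ℕ → Fin K × Request d) × Request d → ENNReal := fun u =>
      Q {ξ | replaceAt (stack k u.1 ξ t) (sampleCount (fun s => (u.1 s).1) k t) u.2 ∈ S} with hΦdef
    have hΦ : Measurable Φ := by
      have hm : Measurable fun v : ((ℕ → Fin K × Request d) × Request d) × (Fin T → Request d) =>
          replaceAt (stack k v.1.1 v.2 t) (sampleCount (fun s => (v.1.1 s).1) k t) v.1.2 := by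
        refine measurable_replaceAt ?_ ?_ (by fun_prop)
        · exact (measurable_stack k T t).comp
            ((measurable_fst.comp measurable_fst).prodMk measurable_snd)
        · exact measurable_sampleCount k (θ := fun s
            (v : ((ℕ → Fin K × Request d) × Request d) × (Fin T → Request d)) => (v.1.1 s).1)
            fun s _ => by fun_prop
      exact measurable_measure_prodMk_left (hm hS)
    have hΦint : ∀ η, ∫⁻ z, Φ (η, z) ∂(D k) = Q {ξ | stack k η ξ t ∈ S} := fun η =>
      lintegral_measure_replaceAt_stack (D k) k η t hS
    have hcond : ∫⁻ ω in {ω | θ t ω = k}, Φ (pastHistory k₀ θ Z t ω, Z t ω) ∂P =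
        ∫⁻ ω in {ω | θ t ω = k}, Q {ξ | stack k (pastHistory k₀ θ Z t ω) ξ t ∈ S} ∂P := by
      rw [← lintegral_map (f := Φ) hΦ (hφ.prodMk hZ), map_restrict_prodMk_eq_prod hφ hZ
        (hrun.observe_preimage htT hφℱ) k, lintegral_prod _ hΦ.aemeasurable]
      simp_rw [hΦint]
      refine lintegral_map ?_ hφ
      exact measurable_measure_prodMk_left (measurable_stack k T t hS)
    rw [← ih htT.le, ← lintegral_add_compl _ hA,
      ← lintegral_add_compl (fun ω => Q {ξ | stack k (pastHistory k₀ θ Z t ω) ξ t ∈ S}) hA,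
      ← hcond]
    congr 1
    · refine setLIntegral_congr_fun hA fun ω hω => ?_
      have hω' : θ t ω = k := hω
      simp only [stack_pastHistory_succ, hω', if_true, hΦdef]
    · refine setLIntegral_congr_fun hA.compl fun ω hω => ?_
      have hω' : ¬ θ t ω = k := hω
      simp only [stack_pastHistory_succ, hω', if_false]

/-- The outcomes for which the scores observed under configuration `k` deviate from their mean at
some time for some halfspace with rational parameters. -/
def deviantOutcomes (D : Measure (Request d)) (h : Request d → ℝ) (T : ℕ) (U : ℝ)
    (θ : ℕ → Ω → Fin K) (Z : ℕ → Ω → Request d) (k : Fin K) : Set Ω :=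
  {ω | ∃ t ≤ T, ∃ m, Real.sqrt (sampleCount (fun s => θ s ω) k t) * U <
    |∑ s ∈ (Finset.range t).filter fun s => θ s ω = k,
      (scored h (rationalParam d m) (Z s ω) - ∫ z, scored h (rationalParam d m) z ∂D)|}

/-- A deviation along the run involves only positions filled by the history, so it makes the stacked
sample deviant for every `ξ`. The section then has measure one, and Markov's inequality compares the
two probabilities. -/
lemma IsRun.measure_deviantOutcomes_le (hrun : IsRun P ℱ D cg c₀ Rmax Amax b T α δ θ Z w p)
    (k : Fin K) {h : Request d → ℝ} (hm : Measurable h) (h01 : ∀ z, h z ∈ Set.Icc (0 : ℝ) 1)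
    {U : ℝ} (hU : 0 ≤ U) :
    P (deviantOutcomes (D k) h T U θ Z k) ≤ ENNReal.ofReal
      (T * (2 * ((2 * T + 1 : ℝ) ^ (d + 1) * Real.exp (-(U ^ 2 / 2))))) := by
  refine le_trans ?_ (measure_deviantSamples_le (D k) hm h01 T hU)
  have hS := measurableSet_deviantSamples (D k) hm T U
  set Q := Measure.pi fun _ : Fin T => D k
  rw [← hrun.lintegral_measure_stack k k le_rfl hS]
  have hφ : Measurable (pastHistory k θ Z T) :=
    (hrun.measurable_pastHistory k le_rfl).mono (ℱ.le T) le_rfl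
  have hmeas : Measurable fun ω =>
      Q {ξ | stack k (pastHistory k θ Z T ω) ξ T ∈ deviantSamples (D k) h T U} :=
    (measurable_measure_prodMk_left (measurable_stack k T T hS)).comp hφ
  have hsub : deviantOutcomes (D k) h T U θ Z k ⊆ {ω | 1 ≤
      Q {ξ | stack k (pastHistory k θ Z T ω) ξ T ∈ deviantSamples (D k) h T U}} := by
    rintro ω ⟨t, ht, m, hdev⟩
    have hη : ∀ s < T, pastHistory k θ Z T ω s = (θ s ω, Z s ω) := fun s hs => by
      simp [pastHistory, hs]
    have hcount : sampleCount (fun s => (pastHistory k θ Z T ω s).1) k t =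
        sampleCount (fun s => θ s ω) k t :=
      sampleCount_congr k fun s hs => by rw [hη s (by omega)]
    have hall : {ξ | stack k (pastHistory k θ Z T ω) ξ T ∈ deviantSamples (D k) h T U} =
        Set.univ := by
      refine Set.eq_univ_of_forall fun ξ => ?_
      have hsum := sum_filter_eq_sum_stack k (pastHistory k θ Z T ω) ξ
        (fun z => scored h (rationalParam d m) z - ∫ z, scored h (rationalParam d m) z ∂(D k)) ht
      have hsum' : ∑ s ∈ (Finset.range t).filter (fun s => θ s ω = k),
          (scored h (rationalParam d m) (Z s ω) - ∫ z, scored h (rationalParam d m) z ∂(D k)) =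
          ∑ s ∈ (Finset.range t).filter (fun s => (pastHistory k θ Z T ω s).1 = k),
          (scored h (rationalParam d m) (pastHistory k θ Z T ω s).2 -
            ∫ z, scored h (rationalParam d m) z ∂(D k)) := by
        have hfil : (Finset.range t).filter (fun s => (pastHistory k θ Z T ω s).1 = k) =
            (Finset.range t).filter fun s => θ s ω = k := Finset.filter_congr fun s hs => by
          rw [hη s ((Finset.mem_range.1 hs).trans_le ht)]
        rw [hfil]
        refine Finset.sum_congr rfl fun s hs => ?_
        rw [hη s ((Finset.mem_range.1 (Finset.mem_filter.1 hs).1).trans_le ht)]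
      refine ⟨sampleCount (fun s => θ s ω) k t, Finset.mem_Icc.2
        ⟨Nat.one_le_iff_ne_zero.2 fun h0 => ?_, (sampleCount_le _ k t).trans ht⟩, m, ?_⟩
      -- Without observations both sides vanish, which the strict inequality in `deviantOutcomes`
      -- excludes.
      · rw [h0] at hdev
        rw [sampleCount, Finset.card_eq_zero] at h0
        rw [h0] at hdev
        simp at hdev
      · rw [← hcount, ← hsum, ← hsum', hcount]
        exact hdev.le
    simp [hall, Q]
  calc P (deviantOutcomes (D k) h T U θ Z k) ≤ _ := measure_mono hsub
    _ ≤ _ := by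
      have := mul_meas_ge_le_lintegral hmeas (μ := P) 1
      rwa [one_mul] at this

end Run

/-! ### Bounded requests and continuous valuations -/

section Environment

variable {D : Measure (Request d)} [IsProbabilityMeasure D] {Rmax Amax : ℝ}

/-- A request that satisfies the boundedness assumption. -/
def BoundedRequest (Rmax Amax : ℝ) (z : Request d) : Prop :=
  0 ≤ z.1 ∧ z.1 ≤ Rmax ∧ 0 ≤ z.2 ∧ ‖z.2‖ ≤ Amax

lemma BoundedRequest.apply_nonneg {z : Request d} (hz : BoundedRequest Rmax Amax z) (i : Fin d) :
    0 ≤ z.2 i := hz.2.2.1 i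

lemma BoundedRequest.apply_le {z : Request d} (hz : BoundedRequest Rmax Amax z) (i : Fin d) :
    z.2 i ≤ Amax := (le_abs_self _).trans ((norm_le_pi_norm z.2 i).trans hz.2.2.2)

/-- Disintegrate over the resource vector: the hyperplane of ties meets the fibre over `a` in the
single reward `p ⬝ᵥ a`, which the conditional law does not charge. -/
lemma measure_fst_eq_dotProduct (hD : ContinuousValuation D) (p : Fin d → ℝ) :
    D {z | z.1 = p ⬝ᵥ z.2} = 0 := by
  have hset : MeasurableSet {u : (Fin d → ℝ) × ℝ | u.2 = p ⬝ᵥ u.1} := by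
    refine measurableSet_eq_fun measurable_snd ?_
    unfold dotProduct
    fun_prop
  have h := compProd_map_condDistrib (mβ := inferInstance) (μ := D) (X := Prod.snd) (Y := Prod.fst)
    measurable_fst.aemeasurable
  have h₁ : D {z | z.1 = p ⬝ᵥ z.2} =
      D.map (fun z => (z.2, z.1)) {u : (Fin d → ℝ) × ℝ | u.2 = p ⬝ᵥ u.1} := by
    rw [Measure.map_apply (measurable_snd.prodMk measurable_fst) hset]
    rfl
  rw [h₁, ← h, Measure.compProd_apply hset]
  rw [lintegral_eq_zero_iff]
  · filter_upwards [hD] with a ha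
    exact ha (p ⬝ᵥ a)
  · exact Kernel.measurable_kernel_prodMk_left hset

lemma integrable_of_bounded (hD : BoundedRequests Rmax Amax D) {f : Request d → ℝ}
    (hf : Measurable f) {C : ℝ} (hC : ∀ z, BoundedRequest Rmax Amax z → |f z| ≤ C) :
    Integrable f D :=
  Integrable.of_bound hf.aestronglyMeasurable C (by filter_upwards [hD] with z hz using hC z hz)

lemma abs_scored_le (f : Request d → ℝ) (q : (Fin d → ℝ) × ℝ) (z : Request d) :
    |scored f q z| ≤ |f z| := by
  unfold scored
  by_cases hz : z ∈ halfspace q <;> simp [hz]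

/-- Expected scores are continuous in the price when valuations are continuous. -/
lemma tendsto_integral_scored (hD : ContinuousValuation D) {f : Request d → ℝ}
    (hf : Measurable f) (hfi : Integrable f D) {pn : ℕ → Fin d → ℝ} {p : Fin d → ℝ}
    (hp : Filter.Tendsto pn Filter.atTop (nhds p)) :
    Filter.Tendsto (fun n => ∫ z, scored f (pn n, 0) z ∂D) Filter.atTop
      (nhds (∫ z, scored f (p, 0) z ∂D)) := by
  refine tendsto_integral_of_dominated_convergence (fun z => |f z|)
    (fun n => (measurable_scored hf _).aestronglyMeasurable) hfi.abs
    (fun n => Filter.Eventually.of_forall fun z => abs_scored_le f _ z) ?_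
  have hne : ∀ᵐ z ∂D, z.1 ≠ p ⬝ᵥ z.2 := by
    rw [ae_iff]
    simpa using measure_fst_eq_dotProduct hD p
  filter_upwards [hne] with z hz
  have hlim : Filter.Tendsto (fun n => pn n ⬝ᵥ z.2) Filter.atTop (nhds (p ⬝ᵥ z.2)) := by
    have hc : Continuous fun q : Fin d → ℝ => q ⬝ᵥ z.2 := by unfold dotProduct; fun_prop
    exact (hc.tendsto p).comp hp
  refine tendsto_const_nhds.congr' ?_
  rcases lt_or_gt_of_ne hz with h | h
  · filter_upwards [hlim.eventually_const_lt h] with n hn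
    simp [scored, halfspace, not_lt.2 h.le, not_lt.2 hn.le]
  · filter_upwards [hlim.eventually_lt_const h] with n hn
    simp [scored, halfspace, h, hn]

end Environment

/-! ### Normalized scores -/

/-- Truncation to the unit interval. -/
def unitClip (x : ℝ) : ℝ := max 0 (min x 1)

lemma unitClip_mem_Icc (x : ℝ) : unitClip x ∈ Set.Icc (0 : ℝ) 1 := by
  unfold unitClip
  constructor
  · exact le_max_left _ _
  · exact max_le zero_le_one (min_le_right _ _)

lemma mul_unitClip_div {x c : ℝ} (hc : 0 < c) (h0 : 0 ≤ x) (hx : x ≤ c) :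
    c * unitClip (x / c) = x := by
  unfold unitClip
  rw [min_eq_left ((div_le_one hc).2 hx), max_eq_right (by positivity)]
  field_simp

/-- The scores that are controlled along a run: a constant, the normalized reward and the
normalized resource consumptions. -/
def normScore (Rmax Amax : ℝ) : Option (Option (Fin d)) → Request d → ℝ
  | none => fun _ => 1
  | some none => fun z => unitClip (z.1 / Rmax)
  | some (some i) => fun z => unitClip (z.2 i / Amax)

lemma measurable_normScore (Rmax Amax : ℝ) (c : Option (Option (Fin d))) :
    Measurable (normScore Rmax Amax c) := by
  rcases c with _ | _ | i <;> simp only [normScore, unitClip] <;> fun_prop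

lemma normScore_mem_Icc (Rmax Amax : ℝ) (c : Option (Option (Fin d))) (z : Request d) :
    normScore Rmax Amax c z ∈ Set.Icc (0 : ℝ) 1 := by
  rcases c with _ | _ | i <;> simp only [normScore]
  · simp
  · exact unitClip_mem_Icc _
  · exact unitClip_mem_Icc _

lemma scored_fst_eq {Rmax Amax : ℝ} (hR : 0 < Rmax) {z : Request d}
    (hz : BoundedRequest Rmax Amax z) (q : (Fin d → ℝ) × ℝ) :
    scored Prod.fst q z = Rmax * scored (normScore Rmax Amax (some none)) q z := by
  unfold scored
  by_cases h : z ∈ halfspace q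
  · simp [h, normScore, mul_unitClip_div hR hz.1 hz.2.1]
  · simp [h]

lemma scored_resource_eq {Rmax Amax : ℝ} (hA : 0 < Amax) {z : Request d}
    (hz : BoundedRequest Rmax Amax z) (i : Fin d) (q : (Fin d → ℝ) × ℝ) :
    scored (fun z => z.2 i) q z = Amax * scored (normScore Rmax Amax (some (some i))) q z := by
  unfold scored
  by_cases h : z ∈ halfspace q
  · simp [h, normScore, mul_unitClip_div hA (hz.apply_nonneg i) (hz.apply_le i)]
  · simp [h]

/-! ### Sample means along a history -/

/-- The mean of `f` over the requests observed under configuration `k` before round `t`. -/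
def sampleMean (θ : ℕ → Fin K) (z : ℕ → Request d) (k : Fin K) (t : ℕ) (f : Request d → ℝ) : ℝ :=
  (1 / max (sampleCount θ k t : ℝ) 1) *
    ∑ s ∈ (Finset.range t).filter (fun s => θ s = k), f (z s)

section SampleMean

variable (θ : ℕ → Fin K) (z : ℕ → Request d) (k : Fin K) (t : ℕ)

lemma empSurplus_eq_sampleMean (p : Fin d → ℝ) : empSurplus θ z k t p =
    sampleMean θ z k t fun z => max (z.1 - p ⬝ᵥ z.2) 0 := rfl

lemma sampleMean_add (f g : Request d → ℝ) : sampleMean θ z k t (fun z => f z + g z) =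
    sampleMean θ z k t f + sampleMean θ z k t g := by
  unfold sampleMean
  rw [Finset.sum_add_distrib, mul_add]

lemma sampleMean_mul_left (c : ℝ) (f : Request d → ℝ) : sampleMean θ z k t (fun z => c * f z) =
    c * sampleMean θ z k t f := by
  unfold sampleMean
  rw [← Finset.mul_sum]
  ring

variable {θ z k t}

lemma sampleMean_mono {f g : Request d → ℝ} (h : ∀ s < t, f (z s) ≤ g (z s)) :
    sampleMean θ z k t f ≤ sampleMean θ z k t g := by
  unfold sampleMean
  gcongr with s hs
  exact h s (Finset.mem_range.1 (Finset.mem_filter.1 hs).1)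

lemma sampleMean_congr {f g : Request d → ℝ} (h : ∀ s < t, f (z s) = g (z s)) :
    sampleMean θ z k t f = sampleMean θ z k t g :=
  le_antisymm (sampleMean_mono fun s hs => (h s hs).le) (sampleMean_mono fun s hs => (h s hs).ge)

end SampleMean

/-- The deviation scale of a configuration that was observed `n` times. -/
def devRadius (U : ℝ) (n : ℕ) : ℝ := U / Real.sqrt (max (n : ℝ) 1)

/-- A history of bounded requests whose normalized scores deviate little from their means,
uniformly over all halfspaces. -/
structure IsTypical (D : Fin K → Measure (Request d)) (Rmax Amax U : ℝ) (T : ℕ)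
    (θ : ℕ → Fin K) (z : ℕ → Request d) : Prop where
  bounded : ∀ t < T, BoundedRequest Rmax Amax (z t)
  deviation : ∀ t ≤ T, ∀ k c q, |∑ s ∈ (Finset.range t).filter fun s => θ s = k,
    (scored (normScore Rmax Amax c) q (z s) - ∫ z, scored (normScore Rmax Amax c) q z ∂(D k))| ≤
      Real.sqrt (sampleCount θ k t) * U

section Typical

variable {D : Fin K → Measure (Request d)} [∀ k, IsProbabilityMeasure (D k)] {Rmax Amax U : ℝ}
  {T : ℕ} {θ : ℕ → Fin K} {z : ℕ → Request d}

lemma IsTypical.abs_sampleMean_sub_le (h : IsTypical D Rmax Amax U T θ z) (hU : 1 ≤ U) {t : ℕ}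
    (ht : t ≤ T) (k : Fin K) (c : Option (Option (Fin d))) (q : (Fin d → ℝ) × ℝ) :
    |sampleMean θ z k t (scored (normScore Rmax Amax c) q) -
      ∫ z, scored (normScore Rmax Amax c) q z ∂(D k)| ≤ devRadius U (sampleCount θ k t) := by
  set f := scored (normScore Rmax Amax c) q
  set N := sampleCount θ k t with hN
  -- Without observations the sample mean is zero and the true mean lies in `[0, 1]`; the hypothesis
  -- `1 ≤ U` makes the radius cover the difference.
  rcases Nat.eq_zero_or_pos N with h0 | hpos
  · have hempty : (Finset.range t).filter (fun s => θ s = k) = ∅ := by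
      rwa [← Finset.card_eq_zero]
    have h01 := fun z => scored_mem_Icc (normScore_mem_Icc Rmax Amax c) q z
    have hle : |∫ z, f z ∂(D k)| ≤ 1 := by
      have := norm_integral_le_of_norm_le_const (μ := D k) (f := f) (C := 1)
        (Filter.Eventually.of_forall fun z => by
          rw [Real.norm_of_nonneg (h01 z).1]
          exact (h01 z).2)
      simpa using this
    simp only [sampleMean, hempty, Finset.sum_empty, mul_zero, zero_sub, abs_neg, devRadius, h0]
    simpa using hle.trans hU
  · have hN1 : (1 : ℝ) ≤ N := by exact_mod_cast hpos
    have hN0 : (0 : ℝ) < N := by linarith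
    have hdev := h.deviation t ht k c q
    rw [Finset.sum_sub_distrib, Finset.sum_const, nsmul_eq_mul] at hdev
    have hcard : (((Finset.range t).filter fun s => θ s = k).card : ℝ) = N := rfl
    rw [hcard, ← hN] at hdev
    have hmean : sampleMean θ z k t f - ∫ z, f z ∂(D k) =
        (∑ s ∈ (Finset.range t).filter (fun s => θ s = k), f (z s) - N * ∫ z, f z ∂(D k)) / N := by
      rw [sampleMean, ← hN, max_eq_left hN1]
      field_simp
    rw [hmean, abs_div, abs_of_pos hN0, devRadius, max_eq_left hN1, div_le_div_iff₀ hN0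
      (Real.sqrt_pos.2 hN0)]
    calc _ ≤ Real.sqrt N * U * Real.sqrt N :=
          mul_le_mul_of_nonneg_right hdev (Real.sqrt_nonneg _)
      _ = U * N := by rw [mul_right_comm, Real.mul_self_sqrt hN0.le, mul_comm]

lemma IsTypical.sampleMean_reward_le (h : IsTypical D Rmax Amax U T θ z) (hU : 1 ≤ U) (hR : 0 < Rmax)
    (hD : ∀ k, BoundedRequests Rmax Amax (D k)) {t : ℕ} (ht : t ≤ T) (k : Fin K)
    (q : (Fin d → ℝ) × ℝ) :
    sampleMean θ z k t (scored Prod.fst q) ≤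
      ∫ z, scored Prod.fst q z ∂(D k) + Rmax * devRadius U (sampleCount θ k t) := by
  have h₁ : sampleMean θ z k t (scored Prod.fst q) =
      Rmax * sampleMean θ z k t (scored (normScore Rmax Amax (some none)) q) := by
    rw [← sampleMean_mul_left]
    exact sampleMean_congr fun s hs => scored_fst_eq hR (h.bounded s (by omega)) q
  have h₂ : ∫ z, scored Prod.fst q z ∂(D k) =
      Rmax * ∫ z, scored (normScore Rmax Amax (some none)) q z ∂(D k) := by
    rw [← integral_const_mul]
    refine integral_congr_ae ?_
    filter_upwards [hD k] with z hz using scored_fst_eq hR hz q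
  have h₃ := (abs_le.1 (h.abs_sampleMean_sub_le hU ht k (some none) q)).2
  rw [h₁, h₂, ← mul_add]
  exact mul_le_mul_of_nonneg_left (by linarith) hR.le

lemma IsTypical.integral_resource_le (h : IsTypical D Rmax Amax U T θ z) (hU : 1 ≤ U) (hA : 0 < Amax)
    (hD : ∀ k, BoundedRequests Rmax Amax (D k)) {t : ℕ} (ht : t ≤ T) (k : Fin K) (i : Fin d)
    (q : (Fin d → ℝ) × ℝ) :
    ∫ z, scored (fun z => z.2 i) q z ∂(D k) ≤ sampleMean θ z k t (scored (fun z => z.2 i) q) +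
      Amax * devRadius U (sampleCount θ k t) := by
  have h₁ : sampleMean θ z k t (scored (fun z => z.2 i) q) =
      Amax * sampleMean θ z k t (scored (normScore Rmax Amax (some (some i))) q) := by
    rw [← sampleMean_mul_left]
    exact sampleMean_congr fun s hs => scored_resource_eq hA (h.bounded s (by omega)) i q
  have h₂ : ∫ z, scored (fun z => z.2 i) q z ∂(D k) =
      Amax * ∫ z, scored (normScore Rmax Amax (some (some i))) q z ∂(D k) := by
    rw [← integral_const_mul]
    refine integral_congr_ae ?_
    filter_upwards [hD k] with z hz using scored_resource_eq hA hz i q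
  have h₃ := (abs_le.1 (h.abs_sampleMean_sub_le hU ht k (some (some i)) q)).1
  rw [h₁, h₂, ← mul_add]
  exact mul_le_mul_of_nonneg_left (by linarith) hA.le

/-- Layer cake formula for the surplus of a request. -/
lemma surplus_eq_integral {Rmax Amax : ℝ} {z : Request d} (hz : BoundedRequest Rmax Amax z)
    {p : Fin d → ℝ} (hp : 0 ≤ p) :
    max (z.1 - p ⬝ᵥ z.2) 0 = ∫ s in Set.Ioc 0 Rmax, scored (fun _ => 1) (p, s) z := by
  have hpa : 0 ≤ p ⬝ᵥ z.2 := dotProduct_nonneg_of_nonneg hp hz.2.2.1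
  have h₁ : (fun s => scored (fun _ => (1 : ℝ)) (p, s) z) =
      (Set.Iio (z.1 - p ⬝ᵥ z.2)).indicator 1 := by
    ext s
    simp only [scored, halfspace, Set.indicator_apply, Set.mem_ofPred_eq, Set.mem_Iio,
      Pi.one_apply, lt_sub_iff_add_lt, add_comm s]
  rw [h₁, integral_indicator_one measurableSet_Iio, measureReal_restrict_apply measurableSet_Iio]
  have h₂ : Set.Iio (z.1 - p ⬝ᵥ z.2) ∩ Set.Ioc 0 Rmax = Set.Ioo 0 (z.1 - p ⬝ᵥ z.2) := by
    ext s
    simp only [Set.mem_inter_iff, Set.mem_Iio, Set.mem_Ioc, Set.mem_Ioo]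
    have := hz.2.1
    constructor
    · rintro ⟨h₁, h₂, -⟩; exact ⟨h₂, h₁⟩
    · rintro ⟨h₁, h₂⟩; exact ⟨h₂, h₁, by linarith⟩
  rw [h₂, Real.volume_real_Ioo, sub_zero]

/-- The expected surplus of a configuration at price `p`. -/
def surplus (D : Measure (Request d)) (p : Fin d → ℝ) : ℝ := ∫ z, max (z.1 - p ⬝ᵥ z.2) 0 ∂D

lemma measurable_scored_one (p : Fin d → ℝ) :
    Measurable fun u : Request d × ℝ => scored (fun _ => (1 : ℝ)) (p, u.2) u.1 := by
  have hset : MeasurableSet {u : Request d × ℝ | p ⬝ᵥ u.1.2 + u.2 < u.1.1} := by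
    refine measurableSet_lt (((measurable_dotProduct_snd p).comp measurable_fst).add
      measurable_snd) (by fun_prop)
  exact (measurable_const (a := (1 : ℝ))).indicator hset

lemma scored_one_mem_Icc (q : (Fin d → ℝ) × ℝ) (z : Request d) :
    scored (fun _ => (1 : ℝ)) q z ∈ Set.Icc (0 : ℝ) 1 :=
  scored_mem_Icc (fun _ => by simp) q z

/-- The surplus is the integral over `s` in `(0, Rmax]` of the acceptance indicator at the bid price
shifted by `s`. The deviation bound for the constant score is uniform in `s` and integrates to `Rmax
* devRadius`, for arbitrarily large prices. -/
lemma IsTypical.surplus_le (h : IsTypical D Rmax Amax U T θ z) (hU : 1 ≤ U) (hR : 0 < Rmax)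
    (hD : ∀ k, BoundedRequests Rmax Amax (D k)) {t : ℕ} (ht : t ≤ T) (k : Fin K)
    {p : Fin d → ℝ} (hp : 0 ≤ p) :
    surplus (D k) p ≤ empSurplus θ z k t p + Rmax * devRadius U (sampleCount θ k t) := by
  set μ := (volume : Measure ℝ).restrict (Set.Ioc 0 Rmax) with hμ
  set f : Request d → ℝ → ℝ := fun z s => scored (fun _ => (1 : ℝ)) (p, s) z with hf
  have hfm := measurable_scored_one p
  have hfb : ∀ z s, ‖f z s‖ ≤ 1 := fun z s => by
    rw [Real.norm_of_nonneg (scored_one_mem_Icc _ z).1]; exact (scored_one_mem_Icc _ z).2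
  have hint2 : Integrable (Function.uncurry f) ((D k).prod μ) :=
    Integrable.of_bound hfm.aestronglyMeasurable 1
      (Filter.Eventually.of_forall fun u => hfb u.1 u.2)
  have hfs : ∀ z, Integrable (f z) μ := fun z =>
    Integrable.of_bound (hfm.comp measurable_prodMk_left).aestronglyMeasurable 1
      (Filter.Eventually.of_forall fun s => hfb z s)
  have h₁ : surplus (D k) p = ∫ s, ∫ z, f z s ∂(D k) ∂μ := by
    rw [surplus, ← integral_integral_swap hint2]
    refine integral_congr_ae ?_
    filter_upwards [hD k] with z hz using surplus_eq_integral hz hp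
  have h₂ : empSurplus θ z k t p = ∫ s, sampleMean θ z k t (fun z => f z s) ∂μ := by
    unfold sampleMean
    rw [integral_const_mul, integral_finsetSum _ fun s _ => hfs _, empSurplus]
    congr 1
    refine Finset.sum_congr rfl fun s hs => ?_
    have := Finset.mem_range.1 (Finset.mem_filter.1 hs).1
    exact surplus_eq_integral (h.bounded s (by omega)) hp
  have hI₁ : Integrable (fun s => ∫ z, f z s ∂(D k)) μ := hint2.integral_prod_right
  have hI₂ : Integrable (fun s => sampleMean θ z k t (fun z => f z s)) μ :=
    (integrable_finsetSum _ fun s _ => hfs _).const_mul _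
  have h₃ : ∫ s, (∫ z, f z s ∂(D k)) ∂μ ≤
      ∫ s, (sampleMean θ z k t (fun z => f z s) + devRadius U (sampleCount θ k t)) ∂μ := by
    refine integral_mono hI₁ (hI₂.add (integrable_const _)) fun s => ?_
    have := (abs_le.1 (h.abs_sampleMean_sub_le hU ht k none (p, s))).1
    have h' : sampleMean θ z k t (scored (normScore Rmax Amax none) (p, s)) =
      sampleMean θ z k t (fun z => f z s) := rfl
    have h'' : ∫ z, scored (normScore Rmax Amax none) (p, s) z ∂(D k) = ∫ z, f z s ∂(D k) := rfl
    rw [h', h''] at this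
    simp only
    linarith
  rw [integral_add hI₂ (integrable_const _), integral_const] at h₃
  rw [h₁, h₂]
  refine h₃.trans_eq ?_
  congr 1
  simp [hμ, hR.le]

end Typical

/-! ### Duality and the saddle point problem -/

lemma slack_nonneg (T : ℕ) : 0 ≤ slack T := Real.sqrt_nonneg _

lemma slack_le_one {T : ℕ} : slack T ≤ 1 := by
  unfold slack
  rw [Real.sqrt_le_iff, one_pow]
  refine ⟨zero_le_one, ?_⟩
  rcases Nat.eq_zero_or_pos T with rfl | hT
  · simp
  · have : (0 : ℝ) < T := by exact_mod_cast hT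
    rw [div_le_one this]
    exact (Real.log_le_sub_one_of_pos this).trans (by linarith)

/-- The values attained by feasible points of the mixed fluid relaxation. -/
def mixFluidValues (D : Fin K → Measure (Request d)) (b : Fin d → ℝ) : Set ℝ :=
  {v : ℝ | ∃ w ∈ stdSimplex ℝ (Fin K), ∃ x : Fin K → Request d → ℝ,
    (∀ k, Measurable (x k)) ∧ (∀ k z, x k z ∈ Set.Icc (0 : ℝ) 1) ∧
    (∀ i, ∑ k, w k * ∫ z, z.2 i * x k z ∂(D k) ≤ b i) ∧
    v = ∑ k, w k * ∫ z, z.1 * x k z ∂(D k)}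

section Duality

variable {D : Fin K → Measure (Request d)} [∀ k, IsProbabilityMeasure (D k)] {Rmax Amax : ℝ}
  {b : Fin d → ℝ}

omit [∀ k, IsProbabilityMeasure (D k)] in
lemma surplus_nonneg (D : Measure (Request d)) (p : Fin d → ℝ) : 0 ≤ surplus D p :=
  integral_nonneg fun _ => le_max_right _ _

/-- Pointwise, `(r - p ⬝ᵥ a) * x` is at most the positive part of `r - p ⬝ᵥ a` for any acceptance
level `x` in `[0, 1]`. -/
lemma integral_mul_sub_le_surplus (hD : ∀ k, BoundedRequests Rmax Amax (D k)) (k : Fin K)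
    {x : Request d → ℝ} (hx : Measurable x) (hx01 : ∀ z, x z ∈ Set.Icc (0 : ℝ) 1)
    {p : Fin d → ℝ} (hp : 0 ≤ p) :
    ∫ z, z.1 * x z ∂(D k) ≤ ∑ i, p i * ∫ z, z.2 i * x z ∂(D k) + surplus (D k) p := by
  have hxb : ∀ z, |x z| ≤ 1 := fun z => abs_le.2 ⟨by linarith [(hx01 z).1], (hx01 z).2⟩
  have hr : Integrable (fun z : Request d => z.1 * x z) (D k) :=
    integrable_of_bounded (hD k) (by fun_prop) (C := Rmax) fun z hz => by
      rw [abs_mul, abs_of_nonneg hz.1]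
      exact (mul_le_of_le_one_right hz.1 (hxb z)).trans hz.2.1
  have ha : ∀ i, Integrable (fun z : Request d => z.2 i * x z) (D k) := fun i =>
    integrable_of_bounded (hD k) (by fun_prop) (C := Amax) fun z hz => by
      rw [abs_mul, abs_of_nonneg (hz.apply_nonneg i)]
      exact (mul_le_of_le_one_right (hz.apply_nonneg i) (hxb z)).trans (hz.apply_le i)
  have hs : Integrable (fun z : Request d => max (z.1 - p ⬝ᵥ z.2) 0) (D k) :=
    integrable_of_bounded (hD k)
      ((measurable_fst.sub (measurable_dotProduct_snd p)).max measurable_const) (C := Rmax)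
      fun z hz => by
        have hpa : 0 ≤ p ⬝ᵥ z.2 := dotProduct_nonneg_of_nonneg hp hz.2.2.1
        rw [abs_of_nonneg (le_max_right _ _)]
        exact max_le (by linarith [hz.2.1]) (hz.1.trans hz.2.1)
  have h₁ : ∑ i, p i * ∫ z, z.2 i * x z ∂(D k) + surplus (D k) p =
      ∫ z, (∑ i, p i * (z.2 i * x z) + max (z.1 - p ⬝ᵥ z.2) 0) ∂(D k) := by
    rw [integral_add (integrable_finsetSum _ fun i _ => (ha i).const_mul _) hs,
      integral_finsetSum _ fun i _ => (ha i).const_mul _]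
    simp_rw [integral_const_mul]
    rfl
  rw [h₁]
  refine integral_mono hr
    ((integrable_finsetSum _ fun i _ => (ha i).const_mul _).add hs) fun z => ?_
  have h₂ : ∑ i, p i * (z.2 i * x z) = (p ⬝ᵥ z.2) * x z := by
    rw [dotProduct, Finset.sum_mul]
    exact Finset.sum_congr rfl fun i _ => by ring
  simp only [h₂]
  have h₃ : (z.1 - p ⬝ᵥ z.2) * x z ≤ max (z.1 - p ⬝ᵥ z.2) 0 :=
    (mul_le_mul_of_nonneg_right (le_max_left _ _) (hx01 z).1).trans
      (mul_le_of_le_one_right (le_max_right _ _) (hx01 z).2)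
  linarith

/-- Weak duality. -/
lemma mixFluidValues_le_dual (hD : ∀ k, BoundedRequests Rmax Amax (D k)) {v : ℝ}
    (hv : v ∈ mixFluidValues D b) :
    ∃ w ∈ stdSimplex ℝ (Fin K), ∀ p : Fin d → ℝ, 0 ≤ p →
      v ≤ p ⬝ᵥ b + ∑ k, w k * surplus (D k) p := by
  obtain ⟨w, hw, x, hxm, hx01, hbud, rfl⟩ := hv
  refine ⟨w, hw, fun p hp => ?_⟩
  calc ∑ k, w k * ∫ z, z.1 * x k z ∂(D k)
      ≤ ∑ k, w k * (∑ i, p i * ∫ z, z.2 i * x k z ∂(D k) + surplus (D k) p) :=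
        Finset.sum_le_sum fun k _ => mul_le_mul_of_nonneg_left
          (integral_mul_sub_le_surplus hD k (hxm k) (hx01 k) hp) (hw.1 k)
    _ = ∑ i, p i * ∑ k, w k * ∫ z, z.2 i * x k z ∂(D k) + ∑ k, w k * surplus (D k) p := by
        simp_rw [mul_add, Finset.sum_add_distrib, Finset.mul_sum]
        rw [Finset.sum_comm]
        congr 1
        exact Finset.sum_congr rfl fun i _ => Finset.sum_congr rfl fun k _ => by ring
    _ ≤ _ := by
        gcongr
        exact Finset.sum_le_sum fun i _ => mul_le_mul_of_nonneg_left (hbud i) (hp i)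

lemma mixFluidValues_le (hD : ∀ k, BoundedRequests Rmax Amax (D k)) {v : ℝ}
    (hv : v ∈ mixFluidValues D b) : v ≤ Rmax := by
  obtain ⟨w, hw, x, hxm, hx01, -, rfl⟩ := hv
  have h : ∀ k, ∫ z, z.1 * x k z ∂(D k) ≤ Rmax := fun k => by
    have := norm_integral_le_of_norm_le_const (μ := D k) (f := fun z => z.1 * x k z) (C := Rmax) (by
      filter_upwards [hD k] with z hz
      rw [norm_mul, Real.norm_of_nonneg hz.1, Real.norm_of_nonneg (hx01 k z).1]
      exact (mul_le_of_le_one_right hz.1 (hx01 k z).2).trans hz.2.1)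
    exact (le_abs_self _).trans (by simpa using this)
  calc _ ≤ ∑ k, w k * Rmax := Finset.sum_le_sum fun k _ =>
        mul_le_mul_of_nonneg_left (h k) (hw.1 k)
    _ = Rmax := by rw [← Finset.sum_mul, hw.2, one_mul]

end Duality

/-! ### Optimism and first-order conditions at the saddle point. -/

section Saddle

variable {D : Fin K → Measure (Request d)} [∀ k, IsProbabilityMeasure (D k)]
  {cg c₀ Rmax Amax U : ℝ} {b : Fin d → ℝ} {T : ℕ} {α δ : ℝ} {θ : ℕ → Fin K} {z : ℕ → Request d}
  {t : ℕ} {w : Fin K → ℝ} {p : Fin d → ℝ}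

/-- Optimism: the value of the optimistic saddle point problem is at least the value of the
relaxation with the safe budget. -/
lemma IsTypical.le_optLagrangian (h : IsTypical D Rmax Amax U T θ z) (hU : 1 ≤ U) (hR : 0 < Rmax)
    (hD : ∀ k, BoundedRequests Rmax Amax (D k)) (ht : t ≤ T)
    (hβ : ∀ n, Rmax * devRadius U n ≤ confRadius cg c₀ Rmax Amax b K T α δ n)
    (hwp : IsMaxMin (optLagrangian cg c₀ Rmax Amax b T α δ θ z t) w p)
    {v : ℝ} (hv : v ∈ mixFluidValues D b) :
    (1 - slack T) * v ≤ optLagrangian cg c₀ Rmax Amax b T α δ θ z t w p := by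
  obtain ⟨w', hw', hdual⟩ := mixFluidValues_le_dual hD hv
  obtain ⟨-, hp, hmax, hmin⟩ := hwp
  have hne : Nonempty {q : Fin d → ℝ // 0 ≤ q} := ⟨⟨0, le_rfl⟩⟩
  have h₁ : (1 - slack T) * v ≤ ⨅ q : {q : Fin d → ℝ // 0 ≤ q},
      optLagrangian cg c₀ Rmax Amax b T α δ θ z t w' q := by
    refine le_ciInf fun q => ?_
    have hdual := mul_le_mul_of_nonneg_left (hdual q q.2) (sub_nonneg.2 (slack_le_one (T := T)))
    -- Only the budget term should carry the factor `1 - slack T`; the surplus is nonnegative, so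
    -- there the factor can be dropped.
    have hs : (1 - slack T) * ∑ k, w' k * surplus (D k) q ≤ ∑ k, w' k * surplus (D k) q :=
      mul_le_of_le_one_left (Finset.sum_nonneg fun k _ => mul_nonneg (hw'.1 k)
        (surplus_nonneg _ _)) (by linarith [slack_nonneg T])
    have he : ∑ k, w' k * surplus (D k) q ≤ ∑ k, w' k * (empSurplus θ z k t q +
        confRadius cg c₀ Rmax Amax b K T α δ (sampleCount θ k t)) :=
      Finset.sum_le_sum fun k _ => mul_le_mul_of_nonneg_left
        ((h.surplus_le hU hR hD ht k q.2).trans (by linarith [hβ (sampleCount θ k t)])) (hw'.1 k)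
    rw [optLagrangian, safeBudget, dotProduct_smul, smul_eq_mul]
    linarith
  have h₂ := hmax hw'
  have h₃ : ⨅ q : {q : Fin d → ℝ // 0 ≤ q}, optLagrangian cg c₀ Rmax Amax b T α δ θ z t w q ≤
      optLagrangian cg c₀ Rmax Amax b T α δ θ z t w p := by
    -- The minimizer `p` itself supplies the lower bound that the infimum over prices requires.
    refine ciInf_le ⟨optLagrangian cg c₀ Rmax Amax b T α δ θ z t w p, ?_⟩
      (⟨p, hp⟩ : {q : Fin d → ℝ // 0 ≤ q})
    rintro _ ⟨q, rfl⟩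
    exact hmin q.2
  exact h₁.trans (h₂.trans h₃)

/-- Raising the price of a resource cannot decrease the Lagrangian, so the empirical consumption
just above the optimal price fits into the safe budget. -/
lemma IsMaxMin.sampleMean_resource_le
    (hwp : IsMaxMin (optLagrangian cg c₀ Rmax Amax b T α δ θ z t) w p) (i : Fin d) {h : ℝ}
    (hh : 0 < h) :
    ∑ k, w k * sampleMean θ z k t (scored (fun z => z.2 i) (p + Pi.single i h, 0)) ≤
      safeBudget T b i := by
  obtain ⟨hw, hp, -, hmin⟩ := hwp
  have hq : 0 ≤ p + Pi.single i h := add_nonneg hp (by simpa using hh.le)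
  have hle := hmin hq
  simp only [Set.mem_ofPred_eq, optLagrangian, add_dotProduct, single_dotProduct] at hle
  -- Convexity in the `i`-th price: raising it by `h` lowers the surplus of a request by at least
  -- `h` times the consumption still accepted at the raised price.
  have hpt : ∀ k, empSurplus θ z k t (p + Pi.single i h) + h *
      sampleMean θ z k t (scored (fun z => z.2 i) (p + Pi.single i h, 0)) ≤
      empSurplus θ z k t p := by
    intro k
    rw [empSurplus_eq_sampleMean, empSurplus_eq_sampleMean, ← sampleMean_mul_left,
      ← sampleMean_add]
    refine sampleMean_mono fun s _ => ?_
    simp only [scored, halfspace, Set.indicator_apply, Set.mem_ofPred_eq, add_dotProduct,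
      single_dotProduct, add_zero]
    split_ifs with hc
    · rw [max_eq_left (by linarith)]
      exact le_trans (by linarith) (le_max_left _ _)
    · rw [max_eq_right (by linarith)]
      simp
  have hsum : ∑ k, w k * (empSurplus θ z k t (p + Pi.single i h) +
        confRadius cg c₀ Rmax Amax b K T α δ (sampleCount θ k t)) +
      h * ∑ k, w k * sampleMean θ z k t (scored (fun z => z.2 i) (p + Pi.single i h, 0)) ≤
      ∑ k, w k * (empSurplus θ z k t p +
        confRadius cg c₀ Rmax Amax b K T α δ (sampleCount θ k t)) := by
    rw [Finset.mul_sum, ← Finset.sum_add_distrib]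
    refine Finset.sum_le_sum fun k _ => ?_
    have := mul_le_mul_of_nonneg_left (hpt k) (hw.1 k)
    linarith
  have : h * ∑ k, w k * sampleMean θ z k t (scored (fun z => z.2 i) (p + Pi.single i h, 0)) ≤
      h * safeBudget T b i := by linarith
  exact le_of_mul_le_mul_left this hh

/-- Shrinking the prices cannot decrease the Lagrangian, so its minimum is at most the empirical
reward collected just below the optimal price, plus the confidence radii. -/
lemma IsMaxMin.optLagrangian_le
    (hwp : IsMaxMin (optLagrangian cg c₀ Rmax Amax b T α δ θ z t) w p)
    (hz : ∀ s < t, 0 ≤ (z s).1) {h : ℝ} (hh : 0 < h) (hh1 : h < 1) :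
    optLagrangian cg c₀ Rmax Amax b T α δ θ z t w p ≤
      (1 - h)⁻¹ * ∑ k, w k * sampleMean θ z k t (scored Prod.fst ((1 - h) • p, 0)) +
        ∑ k, w k * confRadius cg c₀ Rmax Amax b K T α δ (sampleCount θ k t) := by
  obtain ⟨hw, hp, -, hmin⟩ := hwp
  have hq : 0 ≤ (1 - h) • p := smul_nonneg (by linarith) hp
  have hle := hmin hq
  simp only [Set.mem_ofPred_eq, optLagrangian, smul_dotProduct, smul_eq_mul] at hle
  have h1h : 0 < 1 - h := by linarith
  set c : Fin K → ℝ := fun k => sampleMean θ z k t (scored (fun z => p ⬝ᵥ z.2) ((1 - h) • p, 0))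
    with hc
  -- Shrinking the price raises the surplus by at most `h * (p ⬝ᵥ a)`, and only for requests
  -- accepted at the shrunken price.
  have hpt₁ : ∀ k, empSurplus θ z k t ((1 - h) • p) ≤ empSurplus θ z k t p + h * c k := by
    intro k
    rw [empSurplus_eq_sampleMean, empSurplus_eq_sampleMean, hc, ← sampleMean_mul_left,
      ← sampleMean_add]
    refine sampleMean_mono fun s _ => ?_
    simp only [scored, halfspace, Set.indicator_apply, Set.mem_ofPred_eq, smul_dotProduct,
      smul_eq_mul, add_zero]
    split_ifs with hc
    · rw [max_eq_left (by linarith)]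
      have := le_max_left ((z s).1 - p ⬝ᵥ (z s).2) 0
      linarith
    · rw [max_eq_right (by linarith)]
      simp
  -- For requests accepted at `(1 - h) • p`, payment plus surplus is the maximum of `p ⬝ᵥ a` and
  -- `r`, at most `r / (1 - h)` because `r` is nonnegative. For the others the surplus vanishes.
  have hpt₂ : ∀ k, c k + empSurplus θ z k t p ≤
      (1 - h)⁻¹ * sampleMean θ z k t (scored Prod.fst ((1 - h) • p, 0)) := by
    intro k
    rw [empSurplus_eq_sampleMean, hc, ← sampleMean_mul_left, ← sampleMean_add]
    refine sampleMean_mono fun s hs => ?_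
    have hr := hz s hs
    simp only [scored, halfspace, Set.indicator_apply, Set.mem_ofPred_eq, smul_dotProduct,
      smul_eq_mul, add_zero]
    rw [inv_mul_eq_div, le_div_iff₀ h1h]
    split_ifs with hc
    · rcases le_total ((z s).1 - p ⬝ᵥ (z s).2) 0 with h' | h'
      · rw [max_eq_right h']; linarith
      · rw [max_eq_left h']; nlinarith
    · have hpa : (z s).1 - p ⬝ᵥ (z s).2 ≤ 0 := by nlinarith
      rw [max_eq_right hpa]
      simp
  have hs₁ : ∑ k, w k * (empSurplus θ z k t ((1 - h) • p) +
        confRadius cg c₀ Rmax Amax b K T α δ (sampleCount θ k t)) ≤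
      ∑ k, w k * (empSurplus θ z k t p +
        confRadius cg c₀ Rmax Amax b K T α δ (sampleCount θ k t)) + h * ∑ k, w k * c k := by
    rw [Finset.mul_sum, ← Finset.sum_add_distrib]
    refine Finset.sum_le_sum fun k _ => ?_
    have := mul_le_mul_of_nonneg_left (hpt₁ k) (hw.1 k)
    linarith
  -- One half of complementary slackness: at the optimal price the budget is worth no more than the
  -- payments collected.
  have hs₂ : p ⬝ᵥ safeBudget T b ≤ ∑ k, w k * c k := by
    refine le_of_mul_le_mul_left ?_ hh
    linarith
  have hs₃ : ∑ k, w k * c k + ∑ k, w k * empSurplus θ z k t p ≤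
      (1 - h)⁻¹ * ∑ k, w k * sampleMean θ z k t (scored Prod.fst ((1 - h) • p, 0)) := by
    rw [Finset.mul_sum, ← Finset.sum_add_distrib]
    refine Finset.sum_le_sum fun k _ => ?_
    have := mul_le_mul_of_nonneg_left (hpt₂ k) (hw.1 k)
    linarith
  rw [optLagrangian]
  simp_rw [mul_add, Finset.sum_add_distrib]
  linarith

lemma tendsto_add_single (p : Fin d → ℝ) (i : Fin d) :
    Filter.Tendsto (fun n : ℕ => p + Pi.single i (1 / ((n : ℝ) + 1))) Filter.atTop (nhds p) := by
  have h : Continuous fun c : ℝ => p + Pi.single i c :=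
    continuous_const.add (continuous_single (A := fun _ : Fin d => ℝ) i)
  have := (h.tendsto 0).comp tendsto_one_div_add_atTop_nhds_zero_nat
  simpa [Function.comp_def] using this

/-- The expected consumption of the round fits into the safe budget, up to the deviations. -/
lemma IsTypical.consumption_le (h : IsTypical D Rmax Amax U T θ z) (hU : 1 ≤ U) (hA : 0 < Amax)
    (hD : ∀ k, BoundedRequests Rmax Amax (D k)) (hc : ∀ k, ContinuousValuation (D k)) (ht : t ≤ T)
    (hwp : IsMaxMin (optLagrangian cg c₀ Rmax Amax b T α δ θ z t) w p) (i : Fin d) :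
    ∑ k, w k * ∫ z, scored (fun z => z.2 i) (p, 0) z ∂(D k) ≤
      safeBudget T b i + Amax * ∑ k, w k * devRadius U (sampleCount θ k t) := by
  have hlim : Filter.Tendsto (fun n : ℕ => ∑ k, w k *
      ∫ z, scored (fun z => z.2 i) (p + Pi.single i (1 / ((n : ℝ) + 1)), 0) z ∂(D k))
      Filter.atTop (nhds (∑ k, w k * ∫ z, scored (fun z => z.2 i) (p, 0) z ∂(D k))) := by
    refine tendsto_finsetSum _ fun k _ => Filter.Tendsto.const_mul _ ?_
    refine tendsto_integral_scored (hc k) (by fun_prop) ?_ (tendsto_add_single p i)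
    exact integrable_of_bounded (hD k) (by fun_prop) (C := Amax) fun z hz => by
      rw [abs_of_nonneg (hz.apply_nonneg i)]
      exact hz.apply_le i
  refine le_of_tendsto' hlim fun n => ?_
  have hn : (0 : ℝ) < 1 / ((n : ℝ) + 1) := by positivity
  have h₁ := hwp.sampleMean_resource_le i hn
  refine le_trans ?_ (add_le_add_left h₁ _)
  rw [Finset.mul_sum, ← Finset.sum_add_distrib]
  refine Finset.sum_le_sum fun k _ => ?_
  have := mul_le_mul_of_nonneg_left (h.integral_resource_le hU hA hD ht k i
    (p + Pi.single i (1 / ((n : ℝ) + 1)), 0)) (hwp.1.1 k)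
  linarith

/-- The expected reward of the round is at least the value of the relaxation with the safe budget,
up to the deviations and the confidence radii. -/
lemma IsTypical.le_reward (h : IsTypical D Rmax Amax U T θ z) (hU : 1 ≤ U) (hR : 0 < Rmax)
    (hD : ∀ k, BoundedRequests Rmax Amax (D k)) (hc : ∀ k, ContinuousValuation (D k)) (ht : t ≤ T)
    (hβ : ∀ n, Rmax * devRadius U n ≤ confRadius cg c₀ Rmax Amax b K T α δ n)
    (hwp : IsMaxMin (optLagrangian cg c₀ Rmax Amax b T α δ θ z t) w p)
    {v : ℝ} (hv : v ∈ mixFluidValues D b) :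
    (1 - slack T) * v ≤ ∑ k, w k * ∫ z, scored Prod.fst (p, 0) z ∂(D k) +
      2 * ∑ k, w k * confRadius cg c₀ Rmax Amax b K T α δ (sampleCount θ k t) := by
  set B := ∑ k, w k * confRadius cg c₀ Rmax Amax b K T α δ (sampleCount θ k t) with hB
  -- The second `+ 1` keeps `hn n < 1` already at `n = 0`, so that the shrinking factor stays
  -- positive.
  set hn : ℕ → ℝ := fun n => 1 / ((n : ℝ) + 1 + 1) with hhn
  have hn0 : Filter.Tendsto hn Filter.atTop (nhds 0) := by
    have := (tendsto_one_div_add_atTop_nhds_zero_nat (𝕜 := ℝ)).comp (Filter.tendsto_add_atTop_nat 1)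
    refine this.congr fun n => ?_
    simp [hhn]
  have hn1 : Filter.Tendsto (fun n => 1 - hn n) Filter.atTop (nhds 1) := by
    simpa using hn0.const_sub 1
  have hpn : Filter.Tendsto (fun n => (1 - hn n) • p) Filter.atTop (nhds p) := by
    simpa using hn1.smul_const p
  have hlim : Filter.Tendsto (fun n => (1 - hn n)⁻¹ * (∑ k, w k *
      ∫ z, scored Prod.fst ((1 - hn n) • p, 0) z ∂(D k) + B) + B) Filter.atTop
      (nhds ((1 : ℝ)⁻¹ * (∑ k, w k * ∫ z, scored Prod.fst (p, 0) z ∂(D k) + B) + B)) := by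
    refine ((hn1.inv₀ one_ne_zero).mul (Filter.Tendsto.add_const _ ?_)).add_const _
    refine tendsto_finsetSum _ fun k _ => Filter.Tendsto.const_mul _ ?_
    refine tendsto_integral_scored (hc k) (by fun_prop) ?_ hpn
    exact integrable_of_bounded (hD k) (by fun_prop) (C := Rmax) fun z hz => by
      rw [abs_of_nonneg hz.1]
      exact hz.2.1
  refine (ge_of_tendsto' hlim fun n => ?_).trans_eq (by ring)
  have hpos : 0 < hn n := by positivity
  have hlt : hn n < 1 := by
    rw [hhn, div_lt_one (by positivity)]
    linarith [(Nat.cast_nonneg n : (0 : ℝ) ≤ n)]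
  refine (h.le_optLagrangian hU hR hD ht hβ hwp hv).trans ((hwp.optLagrangian_le
    (fun s hs => (h.bounded s (by omega)).1) hpos hlt).trans ?_)
  have hinv : 0 ≤ (1 - hn n)⁻¹ := inv_nonneg.2 (by linarith)
  refine add_le_add_left (mul_le_mul_of_nonneg_left ?_ hinv) _
  -- The deviations of the empirical rewards are absorbed by a second copy of the radii, whence the
  -- factor 2 in the statement.
  rw [hB, ← Finset.sum_add_distrib]
  refine Finset.sum_le_sum fun k _ => ?_
  rw [← mul_add]
  exact mul_le_mul_of_nonneg_left ((h.sampleMean_reward_le hU hR hD ht k _).trans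
    (by linarith [hβ (sampleCount θ k t)])) (hwp.1.1 k)

end Saddle

/-! ### Budget accounting along a path -/

/-- The total demand of the requests that exceed their bid price before round `t`, whether or not
they fit into the budget. -/
def cumDemand (K : ℕ) (z : ℕ → Request d) (p : ℕ → Fin d → ℝ) (t : ℕ) : Fin d → ℝ :=
  fun i => ∑ s ∈ Finset.Ico K t, scored (fun z => z.2 i) (p s, 0) (z s)

open Classical in
/-- The indicator that the total demand before round `t` fits into the budget. -/
def inBudget (K : ℕ) (B : Fin d → ℝ) (z : ℕ → Request d) (p : ℕ → Fin d → ℝ) (t : ℕ) : ℝ :=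
  if cumDemand K z p t ≤ B then 1 else 0

section Accounting

variable {B : Fin d → ℝ} {z : ℕ → Request d} {p : ℕ → Fin d → ℝ} {T t : ℕ} {Rmax Amax : ℝ}

lemma inBudget_mem_Icc (K : ℕ) (B : Fin d → ℝ) (z : ℕ → Request d) (p : ℕ → Fin d → ℝ) (t : ℕ) :
    inBudget K B z p t ∈ Set.Icc (0 : ℝ) 1 := by
  unfold inBudget
  split_ifs <;> simp

lemma cumDemand_succ (h : K ≤ t) (i : Fin d) : cumDemand K z p (t + 1) i =
    cumDemand K z p t i + scored (fun z => z.2 i) (p t, 0) (z t) := by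
  unfold cumDemand
  rw [Finset.sum_Ico_succ_top h]

lemma cumDemand_of_le (h : t ≤ K) : cumDemand K z p t = 0 := by
  unfold cumDemand
  rw [Finset.Ico_eq_empty_of_le h]
  rfl

lemma scored_resource_nonneg {z : Request d} (hz : BoundedRequest Rmax Amax z) (i : Fin d)
    (q : (Fin d → ℝ) × ℝ) : 0 ≤ scored (fun z => z.2 i) q z := by
  unfold scored
  by_cases h : z ∈ halfspace q
  · simpa [h] using hz.apply_nonneg i
  · simp [h]

lemma scored_fst_mem_Icc {z : Request d} (hz : BoundedRequest Rmax Amax z)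
    (q : (Fin d → ℝ) × ℝ) : scored Prod.fst q z ∈ Set.Icc 0 Rmax := by
  unfold scored
  by_cases h : z ∈ halfspace q
  · simpa [h] using ⟨hz.1, hz.2.1⟩
  · simpa [h] using hz.1.trans hz.2.1

lemma cumDemand_le_succ (hz : BoundedRequest Rmax Amax (z t)) :
    cumDemand K z p t ≤ cumDemand K z p (t + 1) := by
  intro i
  rcases le_or_gt K t with h | h
  · rw [cumDemand_succ h]
    linarith [scored_resource_nonneg hz i (p t, 0)]
  · rw [cumDemand_of_le h, cumDemand_of_le h.le]

lemma cumDemand_mono (hz : ∀ t < T, BoundedRequest Rmax Amax (z t)) {s t : ℕ} (hst : s ≤ t)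
    (ht : t ≤ T) : cumDemand K z p s ≤ cumDemand K z p t := by
  induction t, hst using Nat.le_induction with
  | base => exact le_rfl
  | succ t _ ih => exact (ih (by omega)).trans (cumDemand_le_succ (hz t ht))

lemma inBudget_succ_le (hz : BoundedRequest Rmax Amax (z t)) :
    inBudget K B z p (t + 1) ≤ inBudget K B z p t := by
  unfold inBudget
  split_ifs with h₁ h₂
  · exact le_rfl
  · exact absurd ((cumDemand_le_succ hz).trans h₁) h₂
  · exact zero_le_one
  · exact le_rfl

-- While the demand fits, each request above its bid price also fits into what remains, so the real
-- run has served the entire demand.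
open Classical in
lemma remBudget_eq (hz : ∀ t < T, BoundedRequest Rmax Amax (z t)) (ht : t ≤ T)
    (hB : cumDemand K z p t ≤ B) : remBudget K B z p t = B - cumDemand K z p t := by
  induction t with
  | zero => rw [cumDemand_of_le (Nat.zero_le K), sub_zero, remBudget]
  | succ t ih =>
    have hle := cumDemand_le_succ (K := K) (p := p) (hz t ht)
    rw [remBudget, ih (by omega) (hle.trans hB)]
    rcases le_or_gt K t with h | h
    · by_cases hacc : p t ⬝ᵥ (z t).2 < (z t).1
      · have hs : cumDemand K z p (t + 1) = cumDemand K z p t + (z t).2 := by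
          ext i
          rw [cumDemand_succ h]
          simp [scored, halfspace, hacc]
        rw [if_pos ⟨h, by rw [hs] at hB; exact le_sub_iff_add_le'.2 hB, hacc⟩, hs, sub_sub]
      · have hs : cumDemand K z p (t + 1) = cumDemand K z p t := by
          ext i
          rw [cumDemand_succ h]
          simp [scored, halfspace, hacc]
        rw [if_neg fun h' => hacc h'.2.2, hs]
    · rw [if_neg fun h' => absurd h'.1 (by omega), cumDemand_of_le h, cumDemand_of_le h.le]

/-- As long as the total demand fits into the budget, every request above its bid price is
admitted. At most one request is lost in the round in which the demand exceeds the budget. -/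
lemma sum_inBudget_reward_le (hR : 0 ≤ Rmax) (hz : ∀ t < T, BoundedRequest Rmax Amax (z t)) :
    ∑ t ∈ Finset.Ico K T, inBudget K B z p t * scored Prod.fst (p t, 0) (z t) ≤
      totalReward K T B z p + Rmax := by
  classical
  have h₁ : ∑ t ∈ Finset.Ico K T, inBudget K B z p (t + 1) * scored Prod.fst (p t, 0) (z t) ≤
      totalReward K T B z p := by
    unfold totalReward
    refine le_trans (Finset.sum_le_sum fun t ht => ?_) (Finset.sum_le_sum_of_subset_of_nonneg
      (f := fun t => if Admits K t (remBudget K B z p t) (p t) (z t) then (z t).1 else 0)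
      (s := Finset.Ico K T) (fun t ht => ?_) fun t ht _ => ?_)
    · obtain ⟨hKt, htT⟩ := Finset.mem_Ico.1 ht
      have hb := hz t htT
      unfold inBudget
      by_cases hS : cumDemand K z p (t + 1) ≤ B
      · have hle := cumDemand_le_succ (K := K) (p := p) hb
        rw [if_pos hS, one_mul, remBudget_eq hz htT.le (hle.trans hS)]
        by_cases hacc : p t ⬝ᵥ (z t).2 < (z t).1
        · have hs : cumDemand K z p (t + 1) = cumDemand K z p t + (z t).2 := by
            ext i
            rw [cumDemand_succ hKt]
            simp [scored, halfspace, hacc]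
          rw [if_pos ⟨hKt, by rw [hs] at hS; exact le_sub_iff_add_le'.2 hS, hacc⟩]
          simp [scored, halfspace, hacc]
        · rw [if_neg fun h' => hacc h'.2.2]
          simp [scored, halfspace, hacc]
      · rw [if_neg hS, zero_mul]
        split_ifs
        · exact hb.1
        · exact le_rfl
    · exact Finset.mem_range.2 (Finset.mem_Ico.1 ht).2
    · split_ifs
      · exact (hz t (Finset.mem_range.1 ht)).1
      · exact le_rfl
  -- The differences of consecutive indicators are nonnegative and telescope to at most one; they
  -- account for the single request lost at the crossing.
  have h₂ : ∑ t ∈ Finset.Ico K T, (inBudget K B z p t - inBudget K B z p (t + 1)) *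
      scored Prod.fst (p t, 0) (z t) ≤ Rmax := by
    rcases le_or_gt T K with hTK | hKT
    · simpa [Finset.Ico_eq_empty_of_le hTK] using hR
    calc _ ≤ ∑ t ∈ Finset.Ico K T, (inBudget K B z p t - inBudget K B z p (t + 1)) * Rmax := by
          refine Finset.sum_le_sum fun t ht => ?_
          have hb := hz t (Finset.mem_Ico.1 ht).2
          exact mul_le_mul_of_nonneg_left (scored_fst_mem_Icc hb _).2
            (sub_nonneg.2 (inBudget_succ_le hb))
      _ = (inBudget K B z p K - inBudget K B z p T) * Rmax := by
          rw [← Finset.sum_mul]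
          congr 1
          have := Finset.sum_Ico_sub (inBudget K B z p) hKT.le
          rw [← neg_sub (inBudget K B z p T), ← this, ← Finset.sum_neg_distrib]
          simp
      _ ≤ 1 * Rmax := by
          gcongr
          linarith [(inBudget_mem_Icc K B z p K).2, (inBudget_mem_Icc K B z p T).1]
      _ = Rmax := one_mul _
  have h₃ : ∑ t ∈ Finset.Ico K T, inBudget K B z p t * scored Prod.fst (p t, 0) (z t) =
      ∑ t ∈ Finset.Ico K T, inBudget K B z p (t + 1) * scored Prod.fst (p t, 0) (z t) +
      ∑ t ∈ Finset.Ico K T, (inBudget K B z p t - inBudget K B z p (t + 1)) *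
        scored Prod.fst (p t, 0) (z t) := by
    rw [← Finset.sum_add_distrib]
    exact Finset.sum_congr rfl fun t _ => by ring
  linarith

/-- If the total demand exceeds the budget, then so does, for some resource, the demand up to and
including the first round in which this happens. -/
lemma exists_lt_sum_inBudget (hz : ∀ t < T, BoundedRequest Rmax Amax (z t)) (hB0 : 0 ≤ B)
    (hB : ¬ cumDemand K z p T ≤ B) :
    ∃ i, B i < ∑ t ∈ Finset.Ico K T, inBudget K B z p t * scored (fun z => z.2 i) (p t, 0) (z t) := by
  have key : ∀ t ≤ T, (cumDemand K z p t ≤ B → ∀ i, ∑ s ∈ Finset.Ico K t, inBudget K B z p s *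
        scored (fun z => z.2 i) (p s, 0) (z s) = cumDemand K z p t i) ∧
      (¬ cumDemand K z p t ≤ B → ∃ i, B i < ∑ s ∈ Finset.Ico K t, inBudget K B z p s *
        scored (fun z => z.2 i) (p s, 0) (z s)) := by
    intro t
    induction t with
    | zero => simp [cumDemand_of_le, hB0]
    | succ t ih =>
      intro ht
      have ih := ih (by omega)
      have hb := hz t ht
      rcases le_or_gt K t with h | h
      · have hsum : ∀ i, ∑ s ∈ Finset.Ico K (t + 1), inBudget K B z p s *
            scored (fun z => z.2 i) (p s, 0) (z s) = ∑ s ∈ Finset.Ico K t, inBudget K B z p s *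
            scored (fun z => z.2 i) (p s, 0) (z s) +
            inBudget K B z p t * scored (fun z => z.2 i) (p t, 0) (z t) := fun i =>
          Finset.sum_Ico_succ_top h _
        by_cases hS : cumDemand K z p t ≤ B
        · have hJ : inBudget K B z p t = 1 := if_pos hS
          have heq : ∀ i, ∑ s ∈ Finset.Ico K (t + 1), inBudget K B z p s *
              scored (fun z => z.2 i) (p s, 0) (z s) = cumDemand K z p (t + 1) i := fun i => by
            rw [hsum i, ih.1 hS i, hJ, one_mul, cumDemand_succ h]
          refine ⟨fun _ => heq, fun hS' => ?_⟩
          simp only [heq]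
          simpa [Pi.le_def] using hS'
        · refine ⟨fun hS' => absurd ((cumDemand_le_succ hb).trans hS') hS, fun _ => ?_⟩
          obtain ⟨i, hi⟩ := ih.2 hS
          exact ⟨i, by rw [hsum i, inBudget, if_neg hS]; simpa using hi⟩
      · rw [cumDemand_of_le h, Finset.Ico_eq_empty_of_le h]
        exact ⟨fun _ i => by simp, fun h' => absurd hB0 h'⟩
  exact (key T le_rfl).2 hB

/-- The number of rounds that are lost after the demand exceeded the budget is controlled by the
fluctuations `M` of the demand and the excess `e` of the expected demand. -/
lemma sum_one_sub_inBudget_le {b : Fin d → ℝ} (hb : ∀ i, 0 < b i) {bmin : ℝ}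
    (hbmin : ∀ i, bmin ≤ b i) (hz : ∀ t < T, BoundedRequest Rmax Amax (z t))
    (hB : B = (T : ℝ) • b) {c : ℕ → Fin d → ℝ} {e : ℕ → ℝ}
    (he : ∀ t ∈ Finset.Ico K T, 0 ≤ e t) (hc : ∀ t ∈ Finset.Ico K T, ∀ i, c t i ≤ b i + e t) :
    bmin * ∑ t ∈ Finset.Ico K T, (1 - inBudget K B z p t) ≤
      ∑ i, |∑ t ∈ Finset.Ico K T, inBudget K B z p t *
        (scored (fun z => z.2 i) (p t, 0) (z t) - c t i)| + ∑ t ∈ Finset.Ico K T, e t := by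
  have hB0 : 0 ≤ B := by
    rw [hB]
    exact smul_nonneg (Nat.cast_nonneg _) fun i => (hb i).le
  have hJ := inBudget_mem_Icc K B z p
  set M : Fin d → ℝ := fun i => ∑ t ∈ Finset.Ico K T, inBudget K B z p t *
        (scored (fun z => z.2 i) (p t, 0) (z t) - c t i) with hM
  have hE : 0 ≤ ∑ t ∈ Finset.Ico K T, e t := Finset.sum_nonneg he
  have hMn : 0 ≤ ∑ i, |M i| := Finset.sum_nonneg fun i _ => abs_nonneg _
  by_cases hS : cumDemand K z p T ≤ B
  · have hmono : ∀ s ≤ T, cumDemand K z p s ≤ B := fun s hs =>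
      (cumDemand_mono hz hs le_rfl).trans hS
    have h0 : ∑ t ∈ Finset.Ico K T, (1 - inBudget K B z p t) = 0 :=
      Finset.sum_eq_zero fun t ht => by
        rw [inBudget, if_pos (hmono t (Finset.mem_Ico.1 ht).2.le), sub_self]
    rw [h0, mul_zero]
    exact add_nonneg hMn hE
  · obtain ⟨i, hi⟩ := exists_lt_sum_inBudget hz hB0 hS
    have hKT : K ≤ T := by
      by_contra hlt
      rw [cumDemand_of_le (by omega)] at hS
      exact hS hB0
    have hsplit : ∑ t ∈ Finset.Ico K T, inBudget K B z p t *
        scored (fun z => z.2 i) (p t, 0) (z t) =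
        M i + ∑ t ∈ Finset.Ico K T, inBudget K B z p t * c t i := by
      rw [hM, ← Finset.sum_add_distrib]
      exact Finset.sum_congr rfl fun t _ => by ring
    -- Rounds with indicator zero contribute nothing, so each lost round saves `b i`. As the total
    -- nevertheless exceeds `T * b i`, the savings are paid for by the fluctuation and the excess.
    have hcle : ∑ t ∈ Finset.Ico K T, inBudget K B z p t * c t i ≤
        ∑ t ∈ Finset.Ico K T, (b i - b i * (1 - inBudget K B z p t) + e t) := by
      refine Finset.sum_le_sum fun t ht => ?_
      have h₁ := mul_le_mul_of_nonneg_left (hc t ht i) (hJ t).1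
      have h₂ := mul_le_of_le_one_left (he t ht) (hJ t).2
      linarith
    rw [Finset.sum_add_distrib, Finset.sum_sub_distrib, Finset.sum_const, Nat.card_Ico,
      nsmul_eq_mul, ← Finset.mul_sum, Nat.cast_sub hKT] at hcle
    have hBi : B i = T * b i := by rw [hB]; simp
    have hMi : M i ≤ ∑ i, |M i| := (le_abs_self _).trans
      (Finset.single_le_sum (f := fun i => |M i|) (fun _ _ => abs_nonneg _) (Finset.mem_univ i))
    have hlost : 0 ≤ ∑ t ∈ Finset.Ico K T, (1 - inBudget K B z p t) :=
      Finset.sum_nonneg fun t _ => sub_nonneg.2 (hJ t).2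
    have h₁ := mul_le_mul_of_nonneg_right (hbmin i) hlost
    have h₂ : 0 ≤ (K : ℝ) * b i := mul_nonneg (Nat.cast_nonneg _) (hb i).le
    linarith

end Accounting

/-- The number of observations of the selected configurations, along a path. -/
lemma sum_inv_sqrt_sampleCount_le (θ : ℕ → Fin K) (T : ℕ) :
    ∑ t ∈ Finset.range T, 1 / Real.sqrt (max (sampleCount θ (θ t) t : ℝ) 1) ≤
      3 * Real.sqrt (K * T) := by
  -- The increment `√(n + 1) - √n` is the inverse of `√(n + 1) + √n`, and `√(n + 1) ≤ 2 * √n` for `n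
  -- ≥ 1`; hence the constant 3.
  have hstep : ∀ n : ℕ, 1 / Real.sqrt (max (n : ℝ) 1) ≤
      3 * (Real.sqrt ((n + 1 : ℕ) : ℝ) - Real.sqrt n) := by
    intro n
    rcases Nat.eq_zero_or_pos n with rfl | hn
    · simp
    · have hn1 : (1 : ℝ) ≤ n := by exact_mod_cast hn
      rw [max_eq_left hn1]
      set x := Real.sqrt n
      set y := Real.sqrt ((n + 1 : ℕ) : ℝ)
      have hx : x ^ 2 = n := Real.sq_sqrt (by linarith)
      have hy : y ^ 2 = n + 1 := by rw [Real.sq_sqrt (by positivity)]; push_cast; ring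
      have hx0 : 0 < x := Real.sqrt_pos.2 (by linarith)
      have hy0 : 0 ≤ y := Real.sqrt_nonneg _
      have hyx : y ≤ 2 * x := by nlinarith
      rw [div_le_iff₀ hx0]
      have h₁ : (y - x) * (y + x) = 1 := by nlinarith
      have h₂ : 0 ≤ y - x := by
        by_contra hneg
        nlinarith
      nlinarith
  -- The sum of the roots of all counts is a potential: in each round only the term of the selected
  -- configuration grows.
  have hpath : ∀ t, ∑ s ∈ Finset.range t, 1 / Real.sqrt (max (sampleCount θ (θ s) s : ℝ) 1) ≤
      3 * ∑ k, Real.sqrt (sampleCount θ k t) := by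
    intro t
    induction t with
    | zero => simp [sampleCount]
    | succ t ih =>
      have hsum : ∑ k, Real.sqrt (sampleCount θ k (t + 1)) = ∑ k, Real.sqrt (sampleCount θ k t) +
          (Real.sqrt ((sampleCount θ (θ t) t + 1 : ℕ) : ℝ) -
            Real.sqrt (sampleCount θ (θ t) t)) := by
        have h₁ : ∀ k, Real.sqrt (sampleCount θ k (t + 1)) = Real.sqrt (sampleCount θ k t) +
            if k = θ t then Real.sqrt ((sampleCount θ (θ t) t + 1 : ℕ) : ℝ) -
              Real.sqrt (sampleCount θ (θ t) t) else 0 := by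
          intro k
          rw [sampleCount_succ]
          by_cases hk : k = θ t
          · subst hk; simp
          · simp [hk, Ne.symm hk]
        simp_rw [h₁, Finset.sum_add_distrib, Finset.sum_ite_eq' Finset.univ (θ t),
          Finset.mem_univ, if_true]
      rw [Finset.sum_range_succ, hsum, mul_add]
      exact add_le_add ih (hstep _)
  have htotal : ∀ t, ∑ k, (sampleCount θ k t : ℝ) = t := by
    intro t
    induction t with
    | zero => simp [sampleCount]
    | succ t ih =>
      simp_rw [sampleCount_succ]
      push_cast
      rw [Finset.sum_add_distrib, ih]
      simp
  have hcs : ∑ k : Fin K, Real.sqrt (sampleCount θ k T) ≤ Real.sqrt (K * T) := by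
    refine Real.le_sqrt_of_sq_le ?_
    have := sq_sum_le_card_mul_sum_sq (s := (Finset.univ : Finset (Fin K)))
      (f := fun k => Real.sqrt (sampleCount θ k T : ℝ))
    simp only [Finset.card_univ, Fintype.card_fin] at this
    refine this.trans_eq ?_
    rw [← htotal T]
    congr 1
    exact Finset.sum_congr rfl fun k _ => Real.sq_sqrt (Nat.cast_nonneg _)
  exact (hpath T).trans (mul_le_mul_of_nonneg_left hcs (by norm_num))

/-! ### The regret along a typical path -/

/-- The mean over the mixture `w` of the expected scores at price `p`. -/
def mixMean (D : Fin K → Measure (Request d)) (f : Request d → ℝ) (w : Fin K → ℝ)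
    (p : Fin d → ℝ) : ℝ :=
  ∑ k, w k * ∫ z, scored f (p, 0) z ∂(D k)

/-- The mean over the mixture `w` of the inverse square roots of the sample counts. -/
def mixInvSqrt (θ : ℕ → Fin K) (w : Fin K → ℝ) (t : ℕ) : ℝ :=
  ∑ k, w k * (1 / Real.sqrt (max (sampleCount θ k t : ℝ) 1))

lemma mixInvSqrt_nonneg (θ : ℕ → Fin K) {w : Fin K → ℝ} (hw : w ∈ stdSimplex ℝ (Fin K)) (t : ℕ) :
    0 ≤ mixInvSqrt θ w t :=
  Finset.sum_nonneg fun k _ => mul_nonneg (hw.1 k) (by positivity)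

section Mean

variable {D : Fin K → Measure (Request d)} [∀ k, IsProbabilityMeasure (D k)] {Rmax Amax : ℝ}

omit [∀ k, IsProbabilityMeasure (D k)] in
lemma mixMean_fst_eq (hR : 0 < Rmax) (hD : ∀ k, BoundedRequests Rmax Amax (D k))
    (w : Fin K → ℝ) (p : Fin d → ℝ) :
    mixMean D Prod.fst w p = Rmax * mixMean D (normScore Rmax Amax (some none)) w p := by
  unfold mixMean
  rw [Finset.mul_sum]
  refine Finset.sum_congr rfl fun k _ => ?_
  have h : ∫ z, scored Prod.fst (p, 0) z ∂(D k) =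
      Rmax * ∫ z, scored (normScore Rmax Amax (some none)) (p, 0) z ∂(D k) := by
    rw [← integral_const_mul]
    refine integral_congr_ae ?_
    filter_upwards [hD k] with z hz using scored_fst_eq hR hz _
  rw [h]
  ring

omit [∀ k, IsProbabilityMeasure (D k)] in
lemma mixMean_resource_eq (hA : 0 < Amax) (hD : ∀ k, BoundedRequests Rmax Amax (D k))
    (i : Fin d) (w : Fin K → ℝ) (p : Fin d → ℝ) :
    mixMean D (fun z => z.2 i) w p =
      Amax * mixMean D (normScore Rmax Amax (some (some i))) w p := by
  unfold mixMean
  rw [Finset.mul_sum]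
  refine Finset.sum_congr rfl fun k _ => ?_
  have h : ∫ z, scored (fun z => z.2 i) (p, 0) z ∂(D k) =
      Amax * ∫ z, scored (normScore Rmax Amax (some (some i))) (p, 0) z ∂(D k) := by
    rw [← integral_const_mul]
    refine integral_congr_ae ?_
    filter_upwards [hD k] with z hz using scored_resource_eq hA hz i _
  rw [h]
  ring

lemma integral_scored_mem_Icc (D : Measure (Request d)) [IsProbabilityMeasure D]
    {f : Request d → ℝ} (hf : Measurable f) (h01 : ∀ z, f z ∈ Set.Icc (0 : ℝ) 1)
    (q : (Fin d → ℝ) × ℝ) : ∫ z, scored f q z ∂D ∈ Set.Icc (0 : ℝ) 1 := by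
  refine ⟨integral_nonneg fun z => (scored_mem_Icc h01 q z).1, ?_⟩
  have := integral_mono (μ := D) (integrable_scored hf h01 q) (integrable_const (1 : ℝ))
    fun z => (scored_mem_Icc h01 q z).2
  simpa using this

lemma mixMean_mem_Icc {f : Request d → ℝ} (hf : Measurable f)
    (h01 : ∀ z, f z ∈ Set.Icc (0 : ℝ) 1) {w : Fin K → ℝ} (hw : w ∈ stdSimplex ℝ (Fin K))
    (p : Fin d → ℝ) : mixMean D f w p ∈ Set.Icc (0 : ℝ) 1 := by
  have h := fun k => integral_scored_mem_Icc (D k) hf h01 (p, 0)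
  refine ⟨Finset.sum_nonneg fun k _ => mul_nonneg (hw.1 k) (h k).1, ?_⟩
  rw [← hw.2]
  exact Finset.sum_le_sum fun k _ => mul_le_of_le_one_right (hw.1 k) (h k).2

end Mean

lemma mixFluidValues_nonneg {D : Fin K → Measure (Request d)} {Rmax Amax : ℝ} {b : Fin d → ℝ}
    (hD : ∀ k, BoundedRequests Rmax Amax (D k)) {v : ℝ} (hv : v ∈ mixFluidValues D b) : 0 ≤ v := by
  obtain ⟨w, hw, x, -, hx01, -, rfl⟩ := hv
  refine Finset.sum_nonneg fun k _ => mul_nonneg (hw.1 k) (integral_nonneg_of_ae ?_)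
  filter_upwards [hD k] with z hz using mul_nonneg hz.1 (hx01 k z).1

/-- The value of the relaxation is bounded by the expected reward of the rounds before the budget
is exhausted, up to the slack, the initialization, the fluctuations of the demand and the
confidence radii. -/
lemma IsTypical.mul_value_le {D : Fin K → Measure (Request d)} [∀ k, IsProbabilityMeasure (D k)]
    {cg c₀ Rmax Amax U Bc bmin : ℝ} {b : Fin d → ℝ} {T : ℕ} {α δ : ℝ} {θ : ℕ → Fin K}
    {z : ℕ → Request d} {w : ℕ → Fin K → ℝ} {p : ℕ → Fin d → ℝ}
    (h : IsTypical D Rmax Amax U T θ z) (hU : 1 ≤ U) (hR : 0 < Rmax) (hA : 0 < Amax)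
    (hb : ∀ i, 0 < b i) (hbmin : ∀ i, bmin ≤ b i) (hbpos : 0 < bmin)
    (hD : ∀ k, BoundedRequests Rmax Amax (D k)) (hc : ∀ k, ContinuousValuation (D k))
    (hβ : ∀ n : ℕ, confRadius cg c₀ Rmax Amax b K T α δ n = Bc * (1 / Real.sqrt (max (n : ℝ) 1)))
    (hBc : Rmax * U ≤ Bc) (hKT : K ≤ T)
    (hwp : ∀ t ∈ Finset.Ico K T,
      IsMaxMin (optLagrangian cg c₀ Rmax Amax b T α δ θ z t) (w t) (p t))
    {v : ℝ} (hv : v ∈ mixFluidValues D b) :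
    T * v ≤ Rmax * ∑ t ∈ Finset.Ico K T, inBudget K ((T : ℝ) • b) z p t *
        mixMean D (normScore Rmax Amax (some none)) (w t) (p t) +
      slack T * T * Rmax + K * Rmax +
      Rmax / bmin * (∑ i, Amax * |∑ t ∈ Finset.Ico K T, inBudget K ((T : ℝ) • b) z p t *
        (scored (normScore Rmax Amax (some (some i))) (p t, 0) (z t) -
          mixMean D (normScore Rmax Amax (some (some i))) (w t) (p t))| +
        Amax * U * ∑ t ∈ Finset.Ico K T, mixInvSqrt θ (w t) t) +
      2 * Bc * ∑ t ∈ Finset.Ico K T, mixInvSqrt θ (w t) t := by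
  set J := inBudget K ((T : ℝ) • b) z p with hJdef
  have hJ := inBudget_mem_Icc K ((T : ℝ) • b) z p
  have hv0 := mixFluidValues_nonneg hD hv
  have hvR := mixFluidValues_le hD hv
  have hε0 := slack_nonneg T
  have hε1 := slack_le_one (T := T)
  have hBc0 : 0 ≤ Bc := le_trans (by positivity) hBc
  have hw : ∀ t ∈ Finset.Ico K T, w t ∈ stdSimplex ℝ (Fin K) := fun t ht => (hwp t ht).1
  have hdev : ∀ t, ∑ k, w t k * devRadius U (sampleCount θ k t) = U * mixInvSqrt θ (w t) t := by
    intro t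
    rw [mixInvSqrt, Finset.mul_sum]
    exact Finset.sum_congr rfl fun k _ => by rw [devRadius]; ring
  have hconf : ∀ t, ∑ k, w t k * confRadius cg c₀ Rmax Amax b K T α δ (sampleCount θ k t) =
      Bc * mixInvSqrt θ (w t) t := by
    intro t
    rw [mixInvSqrt, Finset.mul_sum]
    exact Finset.sum_congr rfl fun k _ => by rw [hβ]; ring
  have hβ' : ∀ n, Rmax * devRadius U n ≤ confRadius cg c₀ Rmax Amax b K T α δ n := by
    intro n
    rw [hβ, devRadius, div_eq_mul_one_div, ← mul_assoc]
    exact mul_le_mul_of_nonneg_right hBc (by positivity)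
  have hlost := sum_one_sub_inBudget_le (z := z) (p := p) (K := K) hb hbmin h.bounded rfl
    (c := fun t i => mixMean D (fun z => z.2 i) (w t) (p t))
    (e := fun t => Amax * U * mixInvSqrt θ (w t) t)
    (fun t ht => mul_nonneg (by positivity) (mixInvSqrt_nonneg θ (hw t ht) t)) fun t ht i => by
      have h₁ := h.consumption_le hU hA hD hc (Finset.mem_Ico.1 ht).2.le (hwp t ht) i
      rw [hdev, ← mul_assoc] at h₁
      -- The slack is given away here: consumption up to the full `b i` suffices, since early
      -- exhaustion is charged to the fluctuations.
      refine h₁.trans (add_le_add_left ?_ _)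
      rw [safeBudget, Pi.smul_apply, smul_eq_mul]
      exact mul_le_of_le_one_left (hb i).le (by linarith)
  have hfluct : ∀ i, |∑ t ∈ Finset.Ico K T, J t * (scored (fun z => z.2 i) (p t, 0) (z t) -
      mixMean D (fun z => z.2 i) (w t) (p t))| = Amax * |∑ t ∈ Finset.Ico K T, J t *
        (scored (normScore Rmax Amax (some (some i))) (p t, 0) (z t) -
          mixMean D (normScore Rmax Amax (some (some i))) (w t) (p t))| := by
    intro i
    conv_rhs => rw [← abs_of_pos hA, ← abs_mul, Finset.mul_sum, abs_of_pos hA]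
    congr 1
    refine Finset.sum_congr rfl fun t ht => ?_
    rw [scored_resource_eq hA (h.bounded t (Finset.mem_Ico.1 ht).2), mixMean_resource_eq hA hD]
    ring
  simp only [← hJdef, hfluct, ← Finset.mul_sum] at hlost
  rw [← Finset.mul_sum]
  set L := ∑ t ∈ Finset.Ico K T, (1 - J t) with hL
  set F := Amax * ∑ i, |∑ t ∈ Finset.Ico K T, J t *
        (scored (normScore Rmax Amax (some (some i))) (p t, 0) (z t) -
          mixMean D (normScore Rmax Amax (some (some i))) (w t) (p t))| +
        Amax * U * ∑ t ∈ Finset.Ico K T, mixInvSqrt θ (w t) t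
  have hL0 : 0 ≤ L := Finset.sum_nonneg fun t _ => sub_nonneg.2 (hJ t).2
  have hLF : Rmax * L ≤ Rmax / bmin * F := by
    rw [div_mul_eq_mul_div, le_div_iff₀ hbpos, mul_assoc]
    exact mul_le_mul_of_nonneg_left (by linarith) hR.le
  have hrew : ∑ t ∈ Finset.Ico K T, J t * ((1 - slack T) * v) ≤
      Rmax * ∑ t ∈ Finset.Ico K T, J t *
        mixMean D (normScore Rmax Amax (some none)) (w t) (p t) +
      2 * Bc * ∑ t ∈ Finset.Ico K T, mixInvSqrt θ (w t) t := by
    rw [Finset.mul_sum, Finset.mul_sum, ← Finset.sum_add_distrib]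
    refine Finset.sum_le_sum fun t ht => ?_
    have h₁ := h.le_reward hU hR hD hc (Finset.mem_Ico.1 ht).2.le hβ' (hwp t ht) hv
    rw [hconf] at h₁
    have h₂ := mixMean_fst_eq hR hD (w t) (p t)
    rw [mixMean] at h₂
    rw [h₂] at h₁
    have h₃ := mul_le_mul_of_nonneg_left h₁ (hJ t).1
    have h₄ := mul_le_of_le_one_left (mul_nonneg (mul_nonneg zero_le_two hBc0)
      (mixInvSqrt_nonneg θ (hw t ht) t)) (hJ t).2
    linarith
  -- Neither the `K` initial rounds nor the `L` lost ones earn the value; each of them costs at most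
  -- `Rmax`.
  have hJsum : ∑ t ∈ Finset.Ico K T, J t = T - K - L := by
    rw [hL, Finset.sum_sub_distrib, Finset.sum_const, Nat.card_Ico, nsmul_eq_mul, mul_one,
      Nat.cast_sub hKT]
    ring
  rw [← Finset.sum_mul, hJsum] at hrew
  have hs : (1 - slack T) * v ≤ Rmax := (mul_le_of_le_one_left hv0 (by linarith)).trans hvR
  have h₁ : (1 - slack T) * v * (K + L) ≤ Rmax * (K + L) :=
    mul_le_mul_of_nonneg_right hs (add_nonneg (Nat.cast_nonneg _) hL0)
  have h₂ : slack T * T * v ≤ slack T * T * Rmax :=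
    mul_le_mul_of_nonneg_left hvR (by positivity)
  linarith

/-! ### Expectations along a run -/

lemma measurable_scored_pair {f : Request d → ℝ} (hf : Measurable f) :
    Measurable fun u : (Fin d → ℝ) × Request d => scored f (u.1, 0) u.2 := by
  have hset : MeasurableSet {u : (Fin d → ℝ) × Request d | u.1 ⬝ᵥ u.2.2 + 0 < u.2.1} := by
    refine measurableSet_lt ?_ (by fun_prop)
    unfold dotProduct
    fun_prop
  exact (hf.comp measurable_snd).indicator hset

lemma measurable_scored_comp {Ω : Type*} {m : MeasurableSpace Ω} {f : Request d → ℝ}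
    (hf : Measurable f) {p : Ω → Fin d → ℝ} (hp : Measurable p) {Z : Ω → Request d}
    (hZ : Measurable Z) : Measurable fun ω => scored f (p ω, 0) (Z ω) := by
  have h := (measurable_scored_pair hf).comp (hp.prodMk hZ)
  exact h

lemma measurable_cumDemand {Ω : Type*} {m : MeasurableSpace Ω} {Z : ℕ → Ω → Request d}
    {p : ℕ → Ω → Fin d → ℝ} {K t : ℕ} (hZ : ∀ s < t, Measurable (Z s))
    (hp : ∀ s < t, Measurable (p s)) :
    Measurable fun ω => cumDemand K (fun s => Z s ω) (fun s => p s ω) t := by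
  refine measurable_pi_iff.2 fun i => ?_
  unfold cumDemand
  refine Finset.measurable_sum _ fun s hs => ?_
  have hs := (Finset.mem_Ico.1 hs).2
  have hf : Measurable fun z : Request d => z.2 i := by fun_prop
  exact measurable_scored_comp hf (hp s hs) (hZ s hs)

lemma measurable_inBudget {Ω : Type*} {m : MeasurableSpace Ω} {Z : ℕ → Ω → Request d}
    {p : ℕ → Ω → Fin d → ℝ} {K t : ℕ} (B : Fin d → ℝ) (hZ : ∀ s < t, Measurable (Z s))
    (hp : ∀ s < t, Measurable (p s)) :
    Measurable fun ω => inBudget K B (fun s => Z s ω) (fun s => p s ω) t :=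
  Measurable.ite (measurableSet_le (measurable_cumDemand hZ hp) measurable_const)
    measurable_const measurable_const

lemma measurable_mixMean (D : Fin K → Measure (Request d)) [∀ k, IsProbabilityMeasure (D k)]
    {f : Request d → ℝ} (hf : Measurable f) :
    Measurable fun u : (Fin K → ℝ) × (Fin d → ℝ) => mixMean D f u.1 u.2 := by
  unfold mixMean
  refine Finset.measurable_sum _ fun k _ => Measurable.mul (by fun_prop) ?_
  have := ((measurable_scored_pair hf).stronglyMeasurable.integral_prod_right' (ν := D k)).measurable
  exact this.comp measurable_snd

/-! ### Conditional expectations in a round of a run. -/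

section Run

variable {Ω : Type*} {mΩ : MeasurableSpace Ω} {P : Measure Ω} [IsProbabilityMeasure P]
  {ℱ : Filtration ℕ mΩ} {D : Fin K → Measure (Request d)} [∀ k, IsProbabilityMeasure (D k)]
  {cg c₀ Rmax Amax : ℝ} {b : Fin d → ℝ} {T : ℕ} {α δ : ℝ} {θ : ℕ → Ω → Fin K}
  {Z : ℕ → Ω → Request d} {w : ℕ → Ω → Fin K → ℝ} {p : ℕ → Ω → Fin d → ℝ}

omit [IsProbabilityMeasure P] [∀ k, IsProbabilityMeasure (D k)] in
lemma IsRun.mixture_mem_stdSimplex (hrun : IsRun P ℱ D cg c₀ Rmax Amax b T α δ θ Z w p) {t : ℕ}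
    (hKt : K ≤ t) (ht : t < T) : ∀ᵐ ω ∂P, w t ω ∈ stdSimplex ℝ (Fin K) := by
  filter_upwards [hrun.saddle t ht hKt] with ω hω using hω.1

lemma IsRun.integral_condition (hrun : IsRun P ℱ D cg c₀ Rmax Amax b T α δ θ Z w p) {t : ℕ}
    (hKt : K ≤ t) (ht : t < T) {Ω' : Type*} [MeasurableSpace Ω'] {φ : Ω → Ω'}
    (hφ : Measurable[ℱ t] φ) {Ψ : Ω' → Fin K → Request d → ℝ}
    (hΨ : ∀ k, Measurable fun u : Ω' × Request d => Ψ u.1 k u.2) {C : ℝ}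
    (hC : ∀ u k z, |Ψ u k z| ≤ C) :
    ∫ ω, Ψ (φ ω) (θ t ω) (Z t ω) ∂P = ∫ ω, ∑ k, w t ω k * ∫ z, Ψ (φ ω) k z ∂(D k) ∂P := by
  refine SPUCB.integral_condition (hφ.mono (ℱ.le t) le_rfl)
    ((hrun.measurable_config t ht).mono (ℱ.le _) le_rfl)
    ((hrun.measurable_request t ht).mono (ℱ.le _) le_rfl) (hrun.observe_preimage ht hφ)
    ((hrun.measurable_mixture t ht).mono (ℱ.le t) le_rfl) ?_ ?_
    (fun E hE k => hrun.draw t ht hKt _ (hφ hE) k) hΨ hC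
  · filter_upwards [hrun.mixture_mem_stdSimplex hKt ht] with ω hω using hω.1
  · filter_upwards [hrun.mixture_mem_stdSimplex hKt ht] with ω hω k
    rw [← hω.2]
    exact Finset.single_le_sum (fun j _ => hω.1 j) (Finset.mem_univ k)

/-- The weight `c` and the price are known before the round, so conditionally the score averages to
the mixture mean. -/
lemma IsRun.integral_mul_scored (hrun : IsRun P ℱ D cg c₀ Rmax Amax b T α δ θ Z w p) {t : ℕ}
    (hKt : K ≤ t) (ht : t < T) {f : Request d → ℝ} (hf : Measurable f)
    (h01 : ∀ z, f z ∈ Set.Icc (0 : ℝ) 1) {c : Ω → ℝ} (hc : Measurable[ℱ t] c) {C : ℝ}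
    (hC : ∀ᵐ ω ∂P, |c ω| ≤ C) :
    ∫ ω, c ω * scored f (p t ω, 0) (Z t ω) ∂P = ∫ ω, c ω * mixMean D f (w t ω) (p t ω) ∂P := by
  have hφ : Measurable[ℱ t] fun ω => (c ω, p t ω) := Measurable.prodMk hc (hrun.measurable_price t ht)
  -- The weight is bounded only almost surely, while the conditioning formula asks for a bound
  -- everywhere; truncation at level `C` supplies it.
  have hclip : ∀ᵐ ω ∂P, max (-C) (min (c ω) C) = c ω := by
    filter_upwards [hC] with ω hω
    rw [min_eq_left (abs_le.1 hω).2, max_eq_right (abs_le.1 hω).1]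
  set Ψ : ℝ × (Fin d → ℝ) → Fin K → Request d → ℝ :=
    fun u _ z => max (-C) (min u.1 C) * scored f (u.2, 0) z with hΨdef
  have hΨ : ∀ k, Measurable fun u : (ℝ × (Fin d → ℝ)) × Request d => Ψ u.1 k u.2 := fun k => by
    have h₁ : Measurable fun u : (ℝ × (Fin d → ℝ)) × Request d => max (-C) (min u.1.1 C) := by
      fun_prop
    exact h₁.mul (measurable_scored_comp hf (by fun_prop) (by fun_prop))
  have hΨC : ∀ u k z, |Ψ u k z| ≤ |C| := fun u k z => by
    have h₁ := scored_mem_Icc h01 (u.2, 0) z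
    rw [hΨdef, abs_mul, abs_of_nonneg h₁.1]
    refine (mul_le_of_le_one_right (abs_nonneg _) h₁.2).trans (abs_le.2 ⟨?_, ?_⟩)
    · exact (neg_le_neg (le_abs_self C)).trans (le_max_left _ _)
    · exact max_le (neg_le_abs C) ((min_le_right _ _).trans (le_abs_self C))
  have hcond := hrun.integral_condition hKt ht hφ hΨ hΨC
  have h₁ : ∫ ω, c ω * scored f (p t ω, 0) (Z t ω) ∂P =
      ∫ ω, max (-C) (min (c ω) C) * scored f (p t ω, 0) (Z t ω) ∂P := by
    refine integral_congr_ae ?_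
    filter_upwards [hclip] with ω hω
    rw [hω]
  rw [h₁, hcond]
  refine integral_congr_ae ?_
  filter_upwards [hclip] with ω hω
  simp only [hΨdef, hω, integral_const_mul, mixMean, Finset.mul_sum]
  exact Finset.sum_congr rfl fun k _ => by ring

omit [IsProbabilityMeasure P] [∀ k, IsProbabilityMeasure (D k)] in
lemma IsRun.measurable_sampleCount (hrun : IsRun P ℱ D cg c₀ Rmax Amax b T α δ θ Z w p) {t : ℕ}
    (ht : t ≤ T) (k : Fin K) : Measurable[ℱ t] fun ω => sampleCount (fun s => θ s ω) k t :=
  @SPUCB.measurable_sampleCount K Ω (ℱ t) θ k t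
    fun _ hs => hrun.measurable_config_of_lt hs ht

end Run

/-! ### Martingale fluctuations, exploration cost and the typical event. -/

section Run

variable {Ω : Type*} {mΩ : MeasurableSpace Ω} {P : Measure Ω} [IsProbabilityMeasure P]
  {ℱ : Filtration ℕ mΩ} {D : Fin K → Measure (Request d)} [∀ k, IsProbabilityMeasure (D k)]
  {cg c₀ Rmax Amax : ℝ} {b : Fin d → ℝ} {T : ℕ} {α δ : ℝ} {θ : ℕ → Ω → Fin K}
  {Z : ℕ → Ω → Request d} {w : ℕ → Ω → Fin K → ℝ} {p : ℕ → Ω → Fin d → ℝ}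

/-- The indicator that the demand before round `t` of a run fits into the budget `B`. -/
def runInBudget (B : Fin d → ℝ) (Z : ℕ → Ω → Request d) (p : ℕ → Ω → Fin d → ℝ) (K t : ℕ)
    (ω : Ω) : ℝ :=
  inBudget K B (fun s => Z s ω) (fun s => p s ω) t

/-- The sum before round `t` of the differences between the scores and their conditional means,
over the rounds in which the previous demand fits into the budget. -/
def fluctuation (D : Fin K → Measure (Request d)) (f : Request d → ℝ) (B : Fin d → ℝ)
    (Z : ℕ → Ω → Request d) (w : ℕ → Ω → Fin K → ℝ) (p : ℕ → Ω → Fin d → ℝ) (t : ℕ) (ω : Ω) : ℝ :=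
  ∑ s ∈ Finset.Ico K t, runInBudget B Z p K s ω *
    (scored f (p s ω, 0) (Z s ω) - mixMean D f (w s ω) (p s ω))

omit [IsProbabilityMeasure P] [∀ k, IsProbabilityMeasure (D k)] in
lemma IsRun.measurable_runInBudget (hrun : IsRun P ℱ D cg c₀ Rmax Amax b T α δ θ Z w p)
    (B : Fin d → ℝ) {t : ℕ} (ht : t ≤ T) : Measurable[ℱ t] (runInBudget B Z p K t) :=
  @measurable_inBudget d Ω (ℱ t) Z p K t B
    (fun _ hs => hrun.measurable_request_of_lt hs ht)
    fun s hs => (hrun.measurable_price s (by omega)).mono (ℱ.mono hs.le) le_rfl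

omit [IsProbabilityMeasure P] in
lemma IsRun.measurable_mixMean (hrun : IsRun P ℱ D cg c₀ Rmax Amax b T α δ θ Z w p)
    {f : Request d → ℝ} (hf : Measurable f) {t : ℕ} (ht : t < T) :
    Measurable[ℱ t] fun ω => mixMean D f (w t ω) (p t ω) := by
  have h := (SPUCB.measurable_mixMean D hf).comp
    (Measurable.prodMk (hrun.measurable_mixture t ht) (hrun.measurable_price t ht))
  exact h

omit [IsProbabilityMeasure P] [∀ k, IsProbabilityMeasure (D k)] in
lemma IsRun.measurable_scored (hrun : IsRun P ℱ D cg c₀ Rmax Amax b T α δ θ Z w p)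
    {f : Request d → ℝ} (hf : Measurable f) {t : ℕ} (ht : t < T) :
    Measurable[ℱ (t + 1)] fun ω => scored f (p t ω, 0) (Z t ω) :=
  measurable_scored_comp hf ((hrun.measurable_price t ht).mono (ℱ.mono (Nat.le_succ t)) le_rfl)
    (hrun.measurable_request t ht)

omit [IsProbabilityMeasure P] in
lemma IsRun.measurable_fluctuation (hrun : IsRun P ℱ D cg c₀ Rmax Amax b T α δ θ Z w p)
    {f : Request d → ℝ} (hf : Measurable f) (B : Fin d → ℝ) {t : ℕ} (ht : t ≤ T) :
    Measurable[ℱ t] (fluctuation D f B Z w p t) := by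
  unfold fluctuation
  refine Finset.measurable_sum _ fun s hs => ?_
  have hs := (Finset.mem_Ico.1 hs).2
  refine Measurable.mul ?_ (Measurable.sub ?_ ?_)
  · exact (hrun.measurable_runInBudget B (by omega)).mono (ℱ.mono hs.le) le_rfl
  · exact (hrun.measurable_scored hf (by omega)).mono (ℱ.mono hs) le_rfl
  · exact (hrun.measurable_mixMean hf (by omega)).mono (ℱ.mono hs.le) le_rfl

omit [IsProbabilityMeasure P] in
lemma IsRun.abs_increment_le (hrun : IsRun P ℱ D cg c₀ Rmax Amax b T α δ θ Z w p)
    {f : Request d → ℝ} (hf : Measurable f) (h01 : ∀ z, f z ∈ Set.Icc (0 : ℝ) 1) (B : Fin d → ℝ)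
    {t : ℕ} (hKt : K ≤ t) (ht : t < T) : ∀ᵐ ω ∂P, |runInBudget B Z p K t ω *
      (scored f (p t ω, 0) (Z t ω) - mixMean D f (w t ω) (p t ω))| ≤ 1 := by
  filter_upwards [hrun.mixture_mem_stdSimplex hKt ht] with ω hω
  have h₁ := inBudget_mem_Icc K B (fun s => Z s ω) (fun s => p s ω) t
  have h₂ := scored_mem_Icc h01 (p t ω, 0) (Z t ω)
  have h₃ := mixMean_mem_Icc (D := D) hf h01 hω (p t ω)
  rw [abs_mul, runInBudget, abs_of_nonneg h₁.1]
  refine mul_le_one₀ h₁.2 (abs_nonneg _) (abs_le.2 ⟨?_, ?_⟩)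
  · linarith [h₂.1, h₃.2]
  · linarith [h₂.2, h₃.1]

omit [IsProbabilityMeasure P] in
lemma IsRun.abs_fluctuation_le (hrun : IsRun P ℱ D cg c₀ Rmax Amax b T α δ θ Z w p)
    {f : Request d → ℝ} (hf : Measurable f) (h01 : ∀ z, f z ∈ Set.Icc (0 : ℝ) 1) (B : Fin d → ℝ)
    {t : ℕ} (ht : t ≤ T) : ∀ᵐ ω ∂P, |fluctuation D f B Z w p t ω| ≤ T := by
  have h : ∀ᵐ ω ∂P, ∀ s, K ≤ s → s < T → |runInBudget B Z p K s ω *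
      (scored f (p s ω, 0) (Z s ω) - mixMean D f (w s ω) (p s ω))| ≤ 1 := by
    rw [ae_all_iff]
    intro s
    by_cases hs : K ≤ s ∧ s < T
    · filter_upwards [hrun.abs_increment_le hf h01 B hs.1 hs.2] with ω hω _ _ using hω
    · exact Filter.Eventually.of_forall fun ω h₁ h₂ => absurd ⟨h₁, h₂⟩ hs
  filter_upwards [h] with ω hω
  refine (Finset.abs_sum_le_sum_abs _ _).trans ((Finset.sum_le_card_nsmul _ _ 1 fun s hs => ?_).trans ?_)
  · obtain ⟨h₁, h₂⟩ := Finset.mem_Ico.1 hs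
    exact hω s h₁ (h₂.trans_le ht)
  · rw [Nat.card_Ico, nsmul_eq_mul, mul_one]
    exact_mod_cast (Nat.sub_le t K).trans ht

/-- Martingale increments are orthogonal: the past fluctuation and the indicator are known before
the round, so the cross term integrates to zero, and each squared increment is at most one. -/
lemma IsRun.integral_sq_fluctuation_le (hrun : IsRun P ℱ D cg c₀ Rmax Amax b T α δ θ Z w p)
    {f : Request d → ℝ} (hf : Measurable f) (h01 : ∀ z, f z ∈ Set.Icc (0 : ℝ) 1) (B : Fin d → ℝ)
    {t : ℕ} (hKt : K ≤ t) (ht : t ≤ T) :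
    ∫ ω, fluctuation D f B Z w p t ω ^ 2 ∂P ≤ ((t - K : ℕ) : ℝ) := by
  induction t, hKt using Nat.le_induction with
  | base => simp [fluctuation]
  | succ t hKt ih =>
    have htT : t < T := ht
    set M := fluctuation D f B Z w p t with hM
    set J := runInBudget B Z p K t with hJ
    set ψ : Ω → ℝ := fun ω => scored f (p t ω, 0) (Z t ω) with hψ
    set μ : Ω → ℝ := fun ω => mixMean D f (w t ω) (p t ω) with hμ
    have hMm := hrun.measurable_fluctuation hf B htT.le
    have hJm := hrun.measurable_runInBudget B htT.le
    have hMΩ : Measurable M := hMm.mono (ℱ.le t) le_rfl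
    have hJΩ : Measurable J := hJm.mono (ℱ.le t) le_rfl
    have hψΩ : Measurable ψ := (hrun.measurable_scored hf htT).mono (ℱ.le _) le_rfl
    have hμΩ : Measurable μ := (hrun.measurable_mixMean hf htT).mono (ℱ.le t) le_rfl
    have hMb := hrun.abs_fluctuation_le hf h01 B htT.le
    have hinc := hrun.abs_increment_le hf h01 B hKt htT
    have hMJb : ∀ᵐ ω ∂P, |M ω * J ω| ≤ T := by
      filter_upwards [hMb] with ω hω
      have h₁ := inBudget_mem_Icc K B (fun s => Z s ω) (fun s => p s ω) t
      rw [abs_mul, hJ, runInBudget, abs_of_nonneg h₁.1]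
      exact (mul_le_of_le_one_right (abs_nonneg _) h₁.2).trans hω
    have hsimp := hrun.mixture_mem_stdSimplex hKt htT
    have hMJψ : Integrable (fun ω => M ω * J ω * ψ ω) P := by
      refine Integrable.of_bound ((hMΩ.mul hJΩ).mul hψΩ).aestronglyMeasurable (T : ℝ) ?_
      filter_upwards [hMJb] with ω hω
      have h₂ := scored_mem_Icc h01 (p t ω, 0) (Z t ω)
      rw [norm_mul, Real.norm_eq_abs, Real.norm_of_nonneg h₂.1]
      exact (mul_le_of_le_one_right (abs_nonneg _) h₂.2).trans hω
    have hMJμ : Integrable (fun ω => M ω * J ω * μ ω) P := by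
      refine Integrable.of_bound ((hMΩ.mul hJΩ).mul hμΩ).aestronglyMeasurable (T : ℝ) ?_
      filter_upwards [hMJb, hsimp] with ω hω hw
      have h₂ := mixMean_mem_Icc (D := D) hf h01 hw (p t ω)
      rw [norm_mul, Real.norm_eq_abs, Real.norm_of_nonneg h₂.1]
      exact (mul_le_of_le_one_right (abs_nonneg _) h₂.2).trans hω
    have hcross : ∫ ω, M ω * J ω * ψ ω - M ω * J ω * μ ω ∂P = 0 := by
      rw [integral_sub hMJψ hMJμ, hrun.integral_mul_scored hKt htT hf h01
        (c := fun ω => M ω * J ω) (Measurable.mul hMm hJm) hMJb, sub_self]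
    have hsq : Integrable (fun ω => M ω ^ 2) P := by
      refine Integrable.of_bound (hMΩ.pow_const 2).aestronglyMeasurable ((T : ℝ) ^ 2) ?_
      filter_upwards [hMb] with ω hω
      rw [Real.norm_eq_abs, abs_pow]
      exact pow_le_pow_left₀ (abs_nonneg _) hω 2
    have hincsq : Integrable (fun ω => (J ω * (ψ ω - μ ω)) ^ 2) P := by
      refine Integrable.of_bound ((hJΩ.mul (hψΩ.sub hμΩ)).pow_const 2).aestronglyMeasurable 1 ?_
      filter_upwards [hinc] with ω hω
      rw [Real.norm_eq_abs, abs_pow]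
      exact pow_le_one₀ (abs_nonneg _) hω
    have hincle : ∫ ω, (J ω * (ψ ω - μ ω)) ^ 2 ∂P ≤ 1 := by
      have : ∫ ω, (J ω * (ψ ω - μ ω)) ^ 2 ∂P ≤ ∫ _, (1 : ℝ) ∂P := by
        refine integral_mono_ae hincsq (integrable_const _) ?_
        filter_upwards [hinc] with ω hω
        rw [← sq_abs]
        exact pow_le_one₀ (abs_nonneg _) hω
      simpa using this
    have hexp : ∀ ω, fluctuation D f B Z w p (t + 1) ω ^ 2 = M ω ^ 2 +
        2 * (M ω * J ω * ψ ω - M ω * J ω * μ ω) + (J ω * (ψ ω - μ ω)) ^ 2 := by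
      intro ω
      have : fluctuation D f B Z w p (t + 1) ω = M ω + J ω * (ψ ω - μ ω) := by
        rw [fluctuation, Finset.sum_Ico_succ_top hKt]
        rfl
      rw [this]
      ring
    simp_rw [hexp]
    have hsub : Integrable (fun ω => M ω * J ω * ψ ω - M ω * J ω * μ ω) P := hMJψ.sub hMJμ
    have hadd : Integrable (fun ω => M ω ^ 2 + 2 * (M ω * J ω * ψ ω - M ω * J ω * μ ω)) P :=
      hsq.add (hsub.const_mul 2)
    rw [integral_add hadd hincsq, integral_add hsq (hsub.const_mul 2),
      integral_const_mul, hcross, Nat.sub_add_comm hKt]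
    have := ih htT.le
    push_cast
    linarith

/-- Integrate `2 * √T * |M| ≤ M ^ 2 + T` and insert the second moment bound. -/
lemma IsRun.integral_abs_fluctuation_le (hrun : IsRun P ℱ D cg c₀ Rmax Amax b T α δ θ Z w p)
    {f : Request d → ℝ} (hf : Measurable f) (h01 : ∀ z, f z ∈ Set.Icc (0 : ℝ) 1) (B : Fin d → ℝ)
    (hKT : K ≤ T) (hT : 0 < T) :
    Integrable (fun ω => |fluctuation D f B Z w p T ω|) P ∧
      ∫ ω, |fluctuation D f B Z w p T ω| ∂P ≤ Real.sqrt T := by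
  set M := fluctuation D f B Z w p T with hM
  have hMΩ : Measurable M := (hrun.measurable_fluctuation hf B le_rfl).mono (ℱ.le T) le_rfl
  have hMb := hrun.abs_fluctuation_le hf h01 B le_rfl
  have hMi : Integrable (fun ω => |M ω|) P := by
    refine (Integrable.of_bound hMΩ.aestronglyMeasurable (T : ℝ) ?_).abs
    filter_upwards [hMb] with ω hω using hω
  have hsq : Integrable (fun ω => M ω ^ 2) P := by
    refine Integrable.of_bound (hMΩ.pow_const 2).aestronglyMeasurable ((T : ℝ) ^ 2) ?_
    filter_upwards [hMb] with ω hω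
    rw [Real.norm_eq_abs, abs_pow]
    exact pow_le_pow_left₀ (abs_nonneg _) hω 2
  refine ⟨hMi, ?_⟩
  have hT0 : (0 : ℝ) < T := by exact_mod_cast hT
  have hr := Real.sqrt_pos.2 hT0
  have hrr : Real.sqrt T * Real.sqrt T = T := Real.mul_self_sqrt hT0.le
  have h₁ : ∫ ω, 2 * Real.sqrt T * |M ω| ∂P ≤ ∫ ω, (M ω ^ 2 + T) ∂P := by
    refine integral_mono (hMi.const_mul _) (hsq.add (integrable_const _)) fun ω => ?_
    have := sq_nonneg (|M ω| - Real.sqrt T)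
    have h := sq_abs (M ω)
    simp only
    nlinarith
  rw [integral_const_mul, integral_add hsq (integrable_const _)] at h₁
  have h₂ := hrun.integral_sq_fluctuation_le hf h01 B hKT le_rfl
  have h₃ : ((T - K : ℕ) : ℝ) ≤ T := by exact_mod_cast Nat.sub_le T K
  simp only [integral_const, probReal_univ, smul_eq_mul, one_mul] at h₁
  refine le_of_mul_le_mul_left ?_ (mul_pos two_pos hr)
  linarith

/-- Because the indicator is predictable, conditional means can be exchanged for observed scores
round by round. This converts the mean rewards of the path bound into rewards that the run collects.
-/
lemma IsRun.integral_sum_inBudget_mixMean (hrun : IsRun P ℱ D cg c₀ Rmax Amax b T α δ θ Z w p)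
    {f : Request d → ℝ} (hf : Measurable f) (h01 : ∀ z, f z ∈ Set.Icc (0 : ℝ) 1) (B : Fin d → ℝ) :
    Integrable (fun ω => ∑ t ∈ Finset.Ico K T,
        runInBudget B Z p K t ω * mixMean D f (w t ω) (p t ω)) P ∧
      Integrable (fun ω => ∑ t ∈ Finset.Ico K T,
        runInBudget B Z p K t ω * scored f (p t ω, 0) (Z t ω)) P ∧
      ∫ ω, ∑ t ∈ Finset.Ico K T, runInBudget B Z p K t ω * mixMean D f (w t ω) (p t ω) ∂P =
      ∫ ω, ∑ t ∈ Finset.Ico K T, runInBudget B Z p K t ω * scored f (p t ω, 0) (Z t ω) ∂P := by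
  have hJb : ∀ t ω, runInBudget B Z p K t ω ∈ Set.Icc (0 : ℝ) 1 := fun t ω =>
    inBudget_mem_Icc K B _ _ t
  have h₁ : ∀ t ∈ Finset.Ico K T, Integrable (fun ω => runInBudget B Z p K t ω *
      mixMean D f (w t ω) (p t ω)) P := by
    intro t ht
    obtain ⟨hKt, htT⟩ := Finset.mem_Ico.1 ht
    refine Integrable.of_bound (Measurable.aestronglyMeasurable (Measurable.mul
      ((hrun.measurable_runInBudget B htT.le).mono (ℱ.le t) le_rfl)
      ((hrun.measurable_mixMean hf htT).mono (ℱ.le t) le_rfl))) 1 ?_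
    filter_upwards [hrun.mixture_mem_stdSimplex hKt htT] with ω hω
    have h := mixMean_mem_Icc (D := D) hf h01 hω (p t ω)
    rw [Real.norm_of_nonneg (mul_nonneg (hJb t ω).1 h.1)]
    exact mul_le_one₀ (hJb t ω).2 h.1 h.2
  have h₂ : ∀ t ∈ Finset.Ico K T, Integrable (fun ω => runInBudget B Z p K t ω *
      scored f (p t ω, 0) (Z t ω)) P := by
    intro t ht
    obtain ⟨hKt, htT⟩ := Finset.mem_Ico.1 ht
    refine Integrable.of_bound (Measurable.aestronglyMeasurable (Measurable.mul
      ((hrun.measurable_runInBudget B htT.le).mono (ℱ.le t) le_rfl)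
      ((hrun.measurable_scored hf htT).mono (ℱ.le _) le_rfl))) 1
      (Filter.Eventually.of_forall fun ω => ?_)
    have h := scored_mem_Icc h01 (p t ω, 0) (Z t ω)
    rw [Real.norm_of_nonneg (mul_nonneg (hJb t ω).1 h.1)]
    exact mul_le_one₀ (hJb t ω).2 h.1 h.2
  refine ⟨integrable_finsetSum _ h₁, integrable_finsetSum _ h₂, ?_⟩
  rw [integral_finsetSum _ h₁, integral_finsetSum _ h₂]
  refine Finset.sum_congr rfl fun t ht => ?_
  obtain ⟨hKt, htT⟩ := Finset.mem_Ico.1 ht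
  refine (hrun.integral_mul_scored hKt htT hf h01 (hrun.measurable_runInBudget B htT.le)
    (C := 1) (Filter.Eventually.of_forall fun ω => ?_)).symm
  rw [abs_of_nonneg (hJb t ω).1]
  exact (hJb t ω).2

/-- The counts are known before the round, so averaging over the mixture amounts in expectation to
evaluating at the drawn configuration; the pathwise potential bound then applies. -/
lemma IsRun.integral_sum_mixInvSqrt_le (hrun : IsRun P ℱ D cg c₀ Rmax Amax b T α δ θ Z w p) :
    Integrable (fun ω => ∑ t ∈ Finset.Ico K T, mixInvSqrt (fun s => θ s ω) (w t ω) t) P ∧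
      ∫ ω, ∑ t ∈ Finset.Ico K T, mixInvSqrt (fun s => θ s ω) (w t ω) t ∂P ≤
        3 * Real.sqrt (K * T) := by
  have hx01 : ∀ n : ℕ, 0 ≤ 1 / Real.sqrt (max (n : ℝ) 1) ∧ 1 / Real.sqrt (max (n : ℝ) 1) ≤ 1 := by
    intro n
    refine ⟨by positivity, ?_⟩
    rw [div_le_one (Real.sqrt_pos.2 (lt_of_lt_of_le one_pos (le_max_right _ _)))]
    exact Real.one_le_sqrt.2 (le_max_right _ _)
  have hxm : Measurable fun n : ℕ => 1 / Real.sqrt (max (n : ℝ) 1) := measurable_from_top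
  have hNΩ : ∀ t ∈ Finset.Ico K T, ∀ k, Measurable fun ω =>
      1 / Real.sqrt (max (sampleCount (fun s => θ s ω) k t : ℝ) 1) := fun t ht k =>
    hxm.comp ((hrun.measurable_sampleCount (Finset.mem_Ico.1 ht).2.le k).mono (ℱ.le t) le_rfl)
  have hθΩ : ∀ t ∈ Finset.Ico K T, Measurable (θ t) := fun t ht =>
    (hrun.measurable_config t (Finset.mem_Ico.1 ht).2).mono (ℱ.le _) le_rfl
  have hint₁ : ∀ t ∈ Finset.Ico K T,
      Integrable (fun ω => mixInvSqrt (fun s => θ s ω) (w t ω) t) P := by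
    intro t ht
    obtain ⟨hKt, htT⟩ := Finset.mem_Ico.1 ht
    have hw : Measurable (w t) := (hrun.measurable_mixture t htT).mono (ℱ.le t) le_rfl
    refine Integrable.of_bound (C := 1) (Measurable.aestronglyMeasurable ?_) ?_
    · unfold mixInvSqrt
      refine Finset.measurable_sum _ fun k _ => Measurable.mul ?_ (hNΩ t ht k)
      exact (measurable_pi_apply k).comp hw
    · filter_upwards [hrun.mixture_mem_stdSimplex hKt htT] with ω hω
      rw [Real.norm_of_nonneg (mixInvSqrt_nonneg _ hω t), ← hω.2]
      exact Finset.sum_le_sum fun k _ => mul_le_of_le_one_right (hω.1 k) (hx01 _).2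
  have hint₂ : ∀ t ∈ Finset.Ico K T, Integrable (fun ω =>
      1 / Real.sqrt (max (sampleCount (fun s => θ s ω) (θ t ω) t : ℝ) 1)) P := by
    intro t ht
    refine Integrable.of_bound (C := 1) (Measurable.aestronglyMeasurable ?_)
      (Filter.Eventually.of_forall fun ω => ?_)
    · have h : ∀ ω, 1 / Real.sqrt (max (sampleCount (fun s => θ s ω) (θ t ω) t : ℝ) 1) =
          ∑ k, {ω | θ t ω = k}.indicator (fun ω =>
            1 / Real.sqrt (max (sampleCount (fun s => θ s ω) k t : ℝ) 1)) ω := by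
        intro ω
        rw [Finset.sum_eq_single (θ t ω)]
        · simp
        · intro k _ hk
          simp [Ne.symm hk]
        · simp
      simp_rw [h]
      exact Finset.measurable_sum _ fun k _ =>
        (hNΩ t ht k).indicator (hθΩ t ht (measurableSet_singleton k))
    · rw [Real.norm_of_nonneg (hx01 _).1]
      exact (hx01 _).2
  refine ⟨integrable_finsetSum _ hint₁, ?_⟩
  have heq : ∀ t ∈ Finset.Ico K T, ∫ ω, mixInvSqrt (fun s => θ s ω) (w t ω) t ∂P =
      ∫ ω, 1 / Real.sqrt (max (sampleCount (fun s => θ s ω) (θ t ω) t : ℝ) 1) ∂P := by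
    intro t ht
    obtain ⟨hKt, htT⟩ := Finset.mem_Ico.1 ht
    have hφ : Measurable[ℱ t] fun ω k =>
        1 / Real.sqrt (max (sampleCount (fun s => θ s ω) k t : ℝ) 1) := by
      refine @measurable_pi_lambda _ _ _ (ℱ t) _ _ fun k => ?_
      exact hxm.comp (hrun.measurable_sampleCount htT.le k)
    have hclip : ∀ n : ℕ, unitClip (1 / Real.sqrt (max (n : ℝ) 1)) =
        1 / Real.sqrt (max (n : ℝ) 1) := fun n => by
      have := mul_unitClip_div one_pos (hx01 n).1 (hx01 n).2
      rwa [div_one, one_mul] at this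
    have hcond := hrun.integral_condition hKt htT hφ (Ψ := fun u k _ => unitClip (u k)) (C := 1)
      (fun k => by unfold unitClip; fun_prop) fun u k _ => by
        have := unitClip_mem_Icc (u k)
        rw [abs_of_nonneg this.1]
        exact this.2
    simp only [hclip, integral_const, probReal_univ, smul_eq_mul, one_mul] at hcond
    rw [hcond]
    rfl
  rw [integral_finsetSum _ hint₁, Finset.sum_congr rfl heq, ← integral_finsetSum _ hint₂]
  have hle : ∫ ω, ∑ t ∈ Finset.Ico K T,
      1 / Real.sqrt (max (sampleCount (fun s => θ s ω) (θ t ω) t : ℝ) 1) ∂P ≤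
      ∫ _, 3 * Real.sqrt (K * T) ∂P := by
    refine integral_mono (integrable_finsetSum _ hint₂) (integrable_const _) fun ω => ?_
    refine le_trans (Finset.sum_le_sum_of_subset_of_nonneg (fun t ht => ?_) fun t _ _ => (hx01 _).1)
      (sum_inv_sqrt_sampleCount_le (fun s => θ s ω) T)
    exact Finset.mem_range.2 (Finset.mem_Ico.1 ht).2
  simpa using hle

omit [IsProbabilityMeasure P] [∀ k, IsProbabilityMeasure (D k)] in
lemma IsRun.ae_boundedRequest (hrun : IsRun P ℱ D cg c₀ Rmax Amax b T α δ θ Z w p)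
    (hD : ∀ k, BoundedRequests Rmax Amax (D k)) :
    ∀ᵐ ω ∂P, ∀ t < T, BoundedRequest Rmax Amax (Z t ω) := by
  rw [ae_all_iff]
  intro t
  by_cases ht : t < T
  · have hset : MeasurableSet {z : Request d | ¬ BoundedRequest Rmax Amax z} := by
      refine MeasurableSet.compl (MeasurableSet.inter (measurableSet_le measurable_const
        measurable_fst) (MeasurableSet.inter (measurableSet_le measurable_fst measurable_const)
        (MeasurableSet.inter (measurableSet_le measurable_const measurable_snd)
        (measurableSet_le measurable_snd.norm measurable_const))))
    have h : ∀ k, P ({ω | θ t ω = k} ∩ {ω | ¬ BoundedRequest Rmax Amax (Z t ω)}) = 0 := by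
      intro k
      have h₁ := hrun.observe t ht Set.univ MeasurableSet.univ k _ hset
      have h₂ : D k {z : Request d | ¬ BoundedRequest Rmax Amax z} = 0 := ae_iff.1 (hD k)
      rw [h₂, mul_zero, Set.univ_inter] at h₁
      exact h₁
    have hu : P {ω | ¬ BoundedRequest Rmax Amax (Z t ω)} = 0 := by
      refine measure_mono_null (fun ω hω => ?_) (measure_iUnion_null h)
      exact Set.mem_iUnion.2 ⟨θ t ω, rfl, hω⟩
    filter_upwards [ae_iff.2 hu] with ω hω _ using hω
  · exact Filter.Eventually.of_forall fun ω h => absurd h ht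

/-- The history of a run is typical with high probability. -/
lemma IsRun.exists_measure_le_isTypical (hrun : IsRun P ℱ D cg c₀ Rmax Amax b T α δ θ Z w p)
    (hD : ∀ k, BoundedRequests Rmax Amax (D k)) {U : ℝ} (hU : 0 ≤ U) :
    ∃ N : Set Ω, MeasurableSet N ∧ P.real N ≤ K * ((d + 2) *
        (T * (2 * ((2 * T + 1 : ℝ) ^ (d + 1) * Real.exp (-(U ^ 2 / 2)))))) ∧
      ∀ᵐ ω ∂P, ω ∉ N → IsTypical D Rmax Amax U T (fun s => θ s ω) fun s => Z s ω := by
  set X : ℝ := T * (2 * ((2 * T + 1 : ℝ) ^ (d + 1) * Real.exp (-(U ^ 2 / 2)))) with hX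
  have hX0 : 0 ≤ X := by positivity
  -- A union over the configurations and their `d + 2` scores: the constant, the reward and the `d`
  -- resources.
  set N₀ : Set Ω := ⋃ k, ⋃ c : Option (Option (Fin d)),
    deviantOutcomes (D k) (normScore Rmax Amax c) T U θ Z k with hN₀
  have hN₀le : P N₀ ≤ ENNReal.ofReal (K * ((d + 2) * X)) := by
    have h₁ : ∀ k, P (⋃ c : Option (Option (Fin d)),
        deviantOutcomes (D k) (normScore Rmax Amax c) T U θ Z k) ≤
        ENNReal.ofReal ((d + 2) * X) := by
      intro k
      refine (measure_iUnion_fintype_le _ _).trans ((Finset.sum_le_card_nsmul _ _ _ fun c _ =>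
        hrun.measure_deviantOutcomes_le k (measurable_normScore Rmax Amax c)
          (normScore_mem_Icc Rmax Amax c) hU).trans_eq ?_)
      rw [← hX, ENNReal.ofReal_mul (p := (d + 2 : ℝ)) (by positivity), nsmul_eq_mul]
      congr 1
      simp only [Finset.card_univ, Fintype.card_option, Fintype.card_fin]
      rw [← ENNReal.ofReal_natCast]
      congr 1
      push_cast
      ring
    refine (measure_iUnion_fintype_le _ _).trans ((Finset.sum_le_card_nsmul _ _ _ fun k _ =>
      h₁ k).trans_eq ?_)
    rw [ENNReal.ofReal_mul (p := (K : ℝ)) (by positivity), nsmul_eq_mul]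
    simp
  -- The measurable hull has the same measure, and its indicator can be integrated later.
  refine ⟨toMeasurable P N₀, measurableSet_toMeasurable _ _, ?_, ?_⟩
  · rw [measureReal_def, measure_toMeasurable]
    refine ENNReal.toReal_le_of_le_ofReal (by positivity) hN₀le
  · filter_upwards [hrun.ae_boundedRequest hD] with ω hω hN
    refine ⟨hω, fun t ht k c q => ?_⟩
    have hnot : ω ∉ deviantOutcomes (D k) (normScore Rmax Amax c) T U θ Z k := fun h =>
      hN (subset_toMeasurable _ _ (Set.mem_iUnion.2 ⟨k, Set.mem_iUnion.2 ⟨c, h⟩⟩))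
    refine deviation_le_of_rational (D k) (measurable_normScore Rmax Amax c)
      (normScore_mem_Icc Rmax Amax c) (A := Amax) ?_ _ (fun s => Z s ω) (fun s hs => ?_)
      (fun m => ?_) q
    · filter_upwards [hD k] with z hz using hz.2.2.2
    · exact (hω s ((Finset.mem_range.1 (Finset.mem_filter.1 hs).1).trans_le ht)).2.2.2
    · by_contra hlt
      exact hnot ⟨t, ht, m, not_le.1 hlt⟩

end Run

/-! ### The expected regret -/

lemma measurableSet_admits {Ω : Type*} {m : MeasurableSpace Ω} {rem p : Ω → Fin d → ℝ}
    {Z : Ω → Request d} (hrem : Measurable rem) (hp : Measurable p) (hZ : Measurable Z)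
    (K t : ℕ) : MeasurableSet {ω | Admits K t (rem ω) (p ω) (Z ω)} := by
  have hdot : Measurable fun ω => p ω ⬝ᵥ (Z ω).2 := by
    unfold dotProduct
    fun_prop
  exact (MeasurableSet.const _).inter ((measurableSet_le hZ.snd hrem).inter
    (measurableSet_lt hdot hZ.fst))

lemma measurable_remBudget {Ω : Type*} {m : MeasurableSpace Ω} {Z : ℕ → Ω → Request d}
    {p : ℕ → Ω → Fin d → ℝ} {t : ℕ} (K : ℕ) (B : Fin d → ℝ) (hZ : ∀ s < t, Measurable (Z s))
    (hp : ∀ s < t, Measurable (p s)) :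
    Measurable fun ω => remBudget K B (fun s => Z s ω) (fun s => p s ω) t := by
  induction t with
  | zero => exact measurable_const
  | succ t ih =>
    have hrem := ih (fun s hs => hZ s (hs.trans (Nat.lt_succ_self t)))
      fun s hs => hp s (hs.trans (Nat.lt_succ_self t))
    exact Measurable.ite (measurableSet_admits hrem (hp t (Nat.lt_succ_self t))
      (hZ t (Nat.lt_succ_self t)) K t) (hrem.sub (hZ t (Nat.lt_succ_self t)).snd) hrem

lemma measurable_totalReward {Ω : Type*} {m : MeasurableSpace Ω} {Z : ℕ → Ω → Request d}
    {p : ℕ → Ω → Fin d → ℝ} {T : ℕ} (K : ℕ) (B : Fin d → ℝ) (hZ : ∀ s < T, Measurable (Z s))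
    (hp : ∀ s < T, Measurable (p s)) :
    Measurable fun ω => totalReward K T B (fun s => Z s ω) fun s => p s ω := by
  unfold totalReward
  refine Finset.measurable_sum _ fun t ht => ?_
  have ht := Finset.mem_range.1 ht
  exact Measurable.ite (measurableSet_admits (measurable_remBudget K B
    (fun s hs => hZ s (hs.trans ht)) fun s hs => hp s (hs.trans ht)) (hp t ht) (hZ t ht) K t)
    (hZ t ht).fst measurable_const

lemma totalReward_nonneg {Rmax Amax : ℝ} {T : ℕ} {z : ℕ → Request d} (B : Fin d → ℝ)
    (p : ℕ → Fin d → ℝ) (hz : ∀ t < T, BoundedRequest Rmax Amax (z t)) :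
    0 ≤ totalReward K T B z p := by
  refine Finset.sum_nonneg fun t ht => ?_
  split_ifs
  · exact (hz t (Finset.mem_range.1 ht)).1
  · exact le_rfl

lemma totalReward_le {Rmax Amax : ℝ} (hR : 0 ≤ Rmax) {T : ℕ} {z : ℕ → Request d} (B : Fin d → ℝ)
    (p : ℕ → Fin d → ℝ) (hz : ∀ t < T, BoundedRequest Rmax Amax (z t)) :
    totalReward K T B z p ≤ T * Rmax := by
  unfold totalReward
  refine (Finset.sum_le_card_nsmul _ _ Rmax fun t ht => ?_).trans_eq ?_
  · split_ifs
    · exact (hz t (Finset.mem_range.1 ht)).2.1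
    · exact hR
  · rw [Finset.card_range, nsmul_eq_mul]

lemma mixFluidValues_nonempty (hK : 0 < K) (D : Fin K → Measure (Request d)) {b : Fin d → ℝ}
    (hb : ∀ i, 0 < b i) : (mixFluidValues D b).Nonempty := by
  refine ⟨0, Pi.single ⟨0, hK⟩ 1, single_mem_stdSimplex ℝ _, fun _ _ => 0,
    fun _ => measurable_const, fun _ _ => by simp, fun i => ?_, by simp⟩
  simpa using (hb i).le

section Run

variable {Ω : Type*} {mΩ : MeasurableSpace Ω} {P : Measure Ω} [IsProbabilityMeasure P]
  {ℱ : Filtration ℕ mΩ} {D : Fin K → Measure (Request d)} [∀ k, IsProbabilityMeasure (D k)]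
  {cg c₀ Rmax Amax : ℝ} {b : Fin d → ℝ} {T : ℕ} {α δ : ℝ} {θ : ℕ → Ω → Fin K}
  {Z : ℕ → Ω → Request d} {w : ℕ → Ω → Fin K → ℝ} {p : ℕ → Ω → Fin d → ℝ}

omit [∀ k, IsProbabilityMeasure (D k)] in
lemma IsRun.integrable_totalReward (hrun : IsRun P ℱ D cg c₀ Rmax Amax b T α δ θ Z w p)
    (hR : 0 ≤ Rmax) (hD : ∀ k, BoundedRequests Rmax Amax (D k)) (B : Fin d → ℝ) :
    Integrable (fun ω => totalReward K T B (fun t => Z t ω) fun t => p t ω) P := by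
  have hZ : ∀ s < T, Measurable (Z s) := fun s hs =>
    (hrun.measurable_request s hs).mono (ℱ.le _) le_rfl
  have hp : ∀ s < T, Measurable (p s) := fun s hs =>
    (hrun.measurable_price s hs).mono (ℱ.le _) le_rfl
  refine Integrable.of_bound (measurable_totalReward K B hZ hp).aestronglyMeasurable (T * Rmax) ?_
  filter_upwards [hrun.ae_boundedRequest hD] with ω hω
  rw [Real.norm_of_nonneg (totalReward_nonneg B _ hω)]
  exact totalReward_le hR B _ hω

omit [IsProbabilityMeasure P] [∀ k, IsProbabilityMeasure (D k)] in
/-- If every value of the relaxation satisfies a bound, so does the regret. -/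
lemma mixRegret_le_of_forall (hK : 0 < K) (hT : 0 < T) (hb : ∀ i, 0 < b i) {C : ℝ}
    (h : ∀ v ∈ mixFluidValues D b,
      T * v ≤ ∫ ω, totalReward K T ((T : ℝ) • b) (fun t => Z t ω) (fun t => p t ω) ∂P + C) :
    mixRegret P D b T Z p ≤ C := by
  have hT0 : (0 : ℝ) < T := by exact_mod_cast hT
  have h₁ : mixFluidValue D b ≤
      (∫ ω, totalReward K T ((T : ℝ) • b) (fun t => Z t ω) (fun t => p t ω) ∂P + C) / T :=
    csSup_le (mixFluidValues_nonempty hK D hb) fun v hv => by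
      rw [le_div_iff₀' hT0]
      exact h v hv
  rw [le_div_iff₀' hT0] at h₁
  unfold mixRegret
  linarith

-- Collected rewards are nonnegative and the relaxation earns at most `Rmax` per round. This serves
-- the horizons that are too short for the main estimate.
omit [IsProbabilityMeasure P] in
lemma IsRun.mixRegret_le_mul (hrun : IsRun P ℱ D cg c₀ Rmax Amax b T α δ θ Z w p)
    (hD : ∀ k, BoundedRequests Rmax Amax (D k)) (hK : 0 < K)
    (hT : 0 < T) (hb : ∀ i, 0 < b i) : mixRegret P D b T Z p ≤ T * Rmax := by
  refine mixRegret_le_of_forall hK hT hb fun v hv => ?_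
  have h₁ := mul_le_mul_of_nonneg_left (mixFluidValues_le hD hv) (Nat.cast_nonneg (α := ℝ) T)
  have h₂ : 0 ≤ ∫ ω, totalReward K T ((T : ℝ) • b) (fun t => Z t ω) (fun t => p t ω) ∂P := by
    refine integral_nonneg_of_ae ?_
    filter_upwards [hrun.ae_boundedRequest hD] with ω hω using totalReward_nonneg _ _ hω
  linarith

/-- The path bound is integrated; on the exceptional set it is replaced by `T * v ≤ T * Rmax`, which
produces the last term. -/
lemma IsRun.mul_value_le (hrun : IsRun P ℱ D cg c₀ Rmax Amax b T α δ θ Z w p)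
    {U Bc bmin : ℝ} (hU : 1 ≤ U) (hR : 0 < Rmax) (hA : 0 < Amax)
    (hb : ∀ i, 0 < b i) (hbmin : ∀ i, bmin ≤ b i) (hbpos : 0 < bmin)
    (hD : ∀ k, BoundedRequests Rmax Amax (D k)) (hc : ∀ k, ContinuousValuation (D k))
    (hβ : ∀ n : ℕ, confRadius cg c₀ Rmax Amax b K T α δ n = Bc * (1 / Real.sqrt (max (n : ℝ) 1)))
    (hBc : Rmax * U ≤ Bc) (hKT : K ≤ T) (hT : 0 < T) {v : ℝ} (hv : v ∈ mixFluidValues D b) :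
    T * v ≤ ∫ ω, totalReward K T ((T : ℝ) • b) (fun t => Z t ω) (fun t => p t ω) ∂P +
      (Rmax + slack T * T * Rmax + K * Rmax +
      Rmax / bmin * (d * (Amax * Real.sqrt T) + Amax * U * (3 * Real.sqrt (K * T))) +
      2 * Bc * (3 * Real.sqrt (K * T)) +
      T * Rmax * (K * ((d + 2) *
        (T * (2 * ((2 * T + 1 : ℝ) ^ (d + 1) * Real.exp (-(U ^ 2 / 2)))))))) := by
  obtain ⟨N, hN, hPN, htyp⟩ := hrun.exists_measure_le_isTypical hD (zero_le_one.trans hU)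
  obtain ⟨hS, hS', hSeq⟩ := hrun.integral_sum_inBudget_mixMean
    (measurable_normScore Rmax Amax (some none)) (normScore_mem_Icc Rmax Amax (some none))
    ((T : ℝ) • b)
  obtain ⟨hW, hWle⟩ := hrun.integral_sum_mixInvSqrt_le
  have hM := fun i : Fin d => hrun.integral_abs_fluctuation_le
    (measurable_normScore Rmax Amax (some (some i))) (normScore_mem_Icc Rmax Amax (some (some i)))
    ((T : ℝ) • b) hKT hT
  have hv0 := mixFluidValues_nonneg hD hv
  have hvR := mixFluidValues_le hD hv
  have hBc0 : 0 ≤ Bc := (mul_nonneg hR.le (zero_le_one.trans hU)).trans hBc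
  have hwp : ∀ᵐ ω ∂P, ∀ t ∈ Finset.Ico K T,
      IsMaxMin (optLagrangian cg c₀ Rmax Amax b T α δ (fun s => θ s ω) (fun s => Z s ω) t)
        (w t ω) (p t ω) :=
    (ae_ball_iff (Finset.countable_toSet _)).2 fun t ht =>
      hrun.saddle t (Finset.mem_Ico.1 ht).2 (Finset.mem_Ico.1 ht).1
  set S : Ω → ℝ := fun ω => ∑ t ∈ Finset.Ico K T, runInBudget ((T : ℝ) • b) Z p K t ω *
    mixMean D (normScore Rmax Amax (some none)) (w t ω) (p t ω) with hSdef
  set S' : Ω → ℝ := fun ω => ∑ t ∈ Finset.Ico K T, runInBudget ((T : ℝ) • b) Z p K t ω *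
    scored (normScore Rmax Amax (some none)) (p t ω, 0) (Z t ω) with hSdef'
  set W : Ω → ℝ := fun ω => ∑ t ∈ Finset.Ico K T, mixInvSqrt (fun s => θ s ω) (w t ω) t with hWdef
  set M : Fin d → Ω → ℝ := fun i => fluctuation D (normScore Rmax Amax (some (some i)))
    ((T : ℝ) • b) Z w p T with hMdef
  set c : ℝ := slack T * T * Rmax + K * Rmax with hcdef
  have hc0 : 0 ≤ c := by
    have := slack_nonneg T
    positivity
  have hpath : ∀ᵐ ω ∂P, T * v ≤ Rmax * S ω + c + Rmax / bmin * (∑ i, Amax * |M i ω| +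
      Amax * U * W ω) + 2 * Bc * W ω + T * Rmax * N.indicator (fun _ => (1 : ℝ)) ω := by
    filter_upwards [htyp, hwp] with ω hω hωp
    have hW0 : 0 ≤ W ω := Finset.sum_nonneg fun t ht => mixInvSqrt_nonneg _ (hωp t ht).1 t
    have hS0 : 0 ≤ S ω := Finset.sum_nonneg fun t ht => mul_nonneg
      (inBudget_mem_Icc K _ _ _ t).1 (mixMean_mem_Icc (measurable_normScore Rmax Amax (some none))
        (normScore_mem_Icc Rmax Amax (some none)) (hωp t ht).1 _).1
    have hM0 : 0 ≤ ∑ i, Amax * |M i ω| :=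
      Finset.sum_nonneg fun i _ => mul_nonneg hA.le (abs_nonneg _)
    by_cases hωN : ω ∈ N
    · rw [Set.indicator_of_mem hωN, mul_one]
      have h₁ := mul_le_mul_of_nonneg_left hvR (Nat.cast_nonneg (α := ℝ) T)
      have h₂ : 0 ≤ Rmax * S ω + c + Rmax / bmin * (∑ i, Amax * |M i ω| +
        Amax * U * W ω) + 2 * Bc * W ω := by positivity
      linarith
    · rw [Set.indicator_of_notMem hωN, mul_zero, add_zero]
      have h := (hω hωN).mul_value_le hU hR hA hb hbmin hbpos hD hc hβ hBc hKT hωp hv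
      rw [add_assoc (Rmax * _)] at h
      exact h
  have hNint : Integrable (N.indicator fun _ => (1 : ℝ)) P := (integrable_const _).indicator hN
  have hsum : Integrable (fun ω => ∑ i, Amax * |M i ω|) P :=
    integrable_finsetSum _ fun i _ => (hM i).1.const_mul _
  have i₁ : Integrable (fun ω => Rmax * S ω + c) P := (hS.const_mul _).add (integrable_const _)
  have i₂ : Integrable (fun ω => ∑ i, Amax * |M i ω| + Amax * U * W ω) P :=
    hsum.add (hW.const_mul _)
  have i₃ : Integrable (fun ω => Rmax * S ω + c + Rmax / bmin * (∑ i, Amax * |M i ω| +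
      Amax * U * W ω)) P := i₁.add (i₂.const_mul _)
  have i₄ : Integrable (fun ω => Rmax * S ω + c + Rmax / bmin * (∑ i, Amax * |M i ω| +
      Amax * U * W ω) + 2 * Bc * W ω) P := i₃.add (hW.const_mul _)
  have hint := integral_mono_ae (integrable_const _) (i₄.add (hNint.const_mul _)) hpath
  simp only [Pi.add_apply] at hint
  rw [integral_add i₄ (hNint.const_mul _), integral_add i₃ (hW.const_mul _),
    integral_add i₁ (i₂.const_mul _), integral_add (hS.const_mul _) (integrable_const _),
    integral_const_mul Rmax, integral_const_mul (Rmax / bmin), integral_const_mul (2 * Bc),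
    integral_const_mul (T * Rmax), integral_add hsum (hW.const_mul _),
    integral_const_mul (Amax * U),
    integral_finsetSum _ fun i _ => (hM i).1.const_mul _, hSeq,
    integral_indicator_const _ hN] at hint
  simp only [integral_const, probReal_univ, smul_eq_mul, one_mul, mul_one] at hint
  have hMle : ∑ i, ∫ ω, Amax * |M i ω| ∂P ≤ d * (Amax * Real.sqrt T) := by
    refine (Finset.sum_le_card_nsmul _ _ (Amax * Real.sqrt T) fun i _ => ?_).trans_eq ?_
    · rw [integral_const_mul]
      exact mul_le_mul_of_nonneg_left (hM i).2 hA.le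
    · simp
  have hRew : Rmax * ∫ ω, S' ω ∂P ≤
      ∫ ω, totalReward K T ((T : ℝ) • b) (fun t => Z t ω) (fun t => p t ω) ∂P + Rmax := by
    have hRi := hrun.integrable_totalReward hR.le hD ((T : ℝ) • b)
    have : ∫ ω, Rmax * S' ω ∂P ≤
        ∫ ω, (totalReward K T ((T : ℝ) • b) (fun t => Z t ω) (fun t => p t ω) + Rmax) ∂P := by
      refine integral_mono_ae (hS'.const_mul _) (hRi.add (integrable_const _)) ?_
      filter_upwards [hrun.ae_boundedRequest hD] with ω hω
      refine le_trans (le_of_eq ?_) (sum_inBudget_reward_le (K := K) (B := (T : ℝ) • b)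
        (p := fun t => p t ω) hR.le hω)
      rw [hSdef', Finset.mul_sum]
      refine Finset.sum_congr rfl fun t ht => ?_
      rw [scored_fst_eq hR (hω t (Finset.mem_Ico.1 ht).2)]
      unfold runInBudget
      ring
    rw [integral_const_mul, integral_add hRi (integrable_const _)] at this
    simpa using this
  have hB2 : 0 ≤ Rmax / bmin := (div_pos hR hbpos).le
  have hB1 : 0 ≤ Amax * U := mul_nonneg hA.le (zero_le_one.trans hU)
  have h₁ := mul_le_mul_of_nonneg_left (add_le_add hMle (mul_le_mul_of_nonneg_left hWle hB1)) hB2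
  have h₂ := mul_le_mul_of_nonneg_left hWle (mul_nonneg zero_le_two hBc0)
  have h₃ := mul_le_mul_of_nonneg_left hPN (mul_nonneg (Nat.cast_nonneg (α := ℝ) T) hR.le)
  rw [hcdef] at hint
  linarith

end Run

/-! ### Estimates of the constants -/

lemma half_lt_log_two : (1 / 2 : ℝ) < Real.log 2 := by
  have := Real.log_two_gt_d9
  linarith

lemma half_le_log {T : ℕ} (hT : 2 ≤ T) : (1 / 2 : ℝ) ≤ Real.log T :=
  half_lt_log_two.le.trans (Real.log_le_log two_pos (by exact_mod_cast hT))

lemma one_le_two_mul_sqrt_log {T : ℕ} (hT : 2 ≤ T) : 1 ≤ 2 * Real.sqrt (Real.log T) := by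
  have h := half_le_log hT
  have : (1 / 2 : ℝ) ≤ Real.sqrt (Real.log T) := Real.le_sqrt_of_sq_le (by norm_num; linarith)
  linarith

/-- The exponential factor outweighs the number of traces and a union bound over the rounds. -/
lemma mul_growth_mul_exp_le {T : ℕ} (hT : 2 ≤ T) (hKT : K ≤ T) (d : ℕ) {U : ℝ}
    (hU : U ^ 2 = (6 * d + 16) * Real.log T) :
    T * (K * ((d + 2) * (T * (2 * ((2 * T + 1 : ℝ) ^ (d + 1) * Real.exp (-(U ^ 2 / 2))))))) ≤
      (d + 2 : ℝ) := by
  have hT2 : (2 : ℝ) ≤ T := by exact_mod_cast hT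
  have hT0 : (0 : ℝ) < T := by linarith
  have hK : (K : ℝ) ≤ T := by exact_mod_cast hKT
  -- Of the exponent `3 * d + 8`, the growth function takes `3 * (d + 1)` through `2 * T + 1 ≤ T ^
  -- 3`, the factors `T`, `K`, `T` and `2` take four, and one is spare.
  have hexp : Real.exp (-(U ^ 2 / 2)) = ((T : ℝ) ^ (3 * d + 8))⁻¹ := by
    rw [hU, Real.exp_neg, ← Real.exp_log (pow_pos hT0 (3 * d + 8)), Real.log_pow]
    congr 2
    push_cast
    ring
  have h3 : (2 * T + 1 : ℝ) ≤ T ^ 3 := by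
    have := mul_le_mul hT2 hT2 (by norm_num) hT0.le
    nlinarith
  have h4 : (2 * T + 1 : ℝ) ^ (d + 1) ≤ (T ^ 3) ^ (d + 1) :=
    pow_le_pow_left₀ (by positivity) h3 _
  have h5 : (T : ℝ) * (K * (T * (2 * (2 * T + 1 : ℝ) ^ (d + 1)))) ≤ T ^ (3 * d + 8) := by
    calc (T : ℝ) * (K * (T * (2 * (2 * T + 1 : ℝ) ^ (d + 1))))
        ≤ T * (T * (T * (T * (T ^ 3) ^ (d + 1)))) := by gcongr
      _ = T ^ (3 * d + 7) := by ring
      _ ≤ T ^ (3 * d + 8) := pow_le_pow_right₀ (by linarith) (by omega)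
  have h6 : 0 < (T : ℝ) ^ (3 * d + 8) := by positivity
  calc T * (K * ((d + 2) * (T * (2 * ((2 * T + 1 : ℝ) ^ (d + 1) * Real.exp (-(U ^ 2 / 2)))))))
      = (d + 2) * (T * (K * (T * (2 * (2 * T + 1 : ℝ) ^ (d + 1)))) / T ^ (3 * d + 8)) := by
        rw [hexp]
        field_simp
    _ ≤ (d + 2) * 1 := by
        gcongr
        exact (div_le_one h6).2 h5
    _ = d + 2 := mul_one _

/-- The logarithmic factor of the confidence radius, with `A = c₀ d Pmax Amax / Rmax`. -/
lemma logFactor_bounds {T : ℕ} (hT : 2 ≤ T) (hK : 0 < K) (hKT : K ≤ T) (hd : 0 < d) {A : ℝ}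
    (hA : 0 < A) (hAT : 1 ≤ A ^ 2 * T) :
    (d / 2 + 3) * Real.log T ≤ d * Real.log (A * T) + Real.log (K * T / (T : ℝ) ^ (-2 : ℤ)) ∧
      d * Real.log (A * T) + Real.log (K * T / (T : ℝ) ^ (-2 : ℤ)) ≤
        (d * (2 * |Real.log A| + 1) + 4) * Real.log T := by
  have hT0 : (0 : ℝ) < T := by exact_mod_cast (two_pos.trans_le hT)
  have hK0 : (0 : ℝ) < K := by exact_mod_cast hK
  have hd0 : (0 : ℝ) < d := by exact_mod_cast hd
  have hℓ := half_le_log hT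
  have h₁ : Real.log (K * T / (T : ℝ) ^ (-2 : ℤ)) = Real.log K + 3 * Real.log T := by
    have : K * T / (T : ℝ) ^ (-2 : ℤ) = K * (T : ℝ) ^ 3 := by
      rw [zpow_neg, div_inv_eq_mul]
      norm_cast
      ring
    rw [this, Real.log_mul hK0.ne' (by positivity), Real.log_pow]
    norm_num
  have hK1 : 0 ≤ Real.log K := Real.log_natCast_nonneg K
  have hK2 : Real.log K ≤ Real.log T := Real.log_le_log hK0 (by exact_mod_cast hKT)
  -- The hypothesis `1 ≤ A ^ 2 * T` says `log A ≥ -(log T) / 2`, so at least half of `d * log T`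
  -- survives in `d * log (A * T)`.
  have h₂ : 0 ≤ 2 * Real.log A + Real.log T := by
    have := Real.log_nonneg hAT
    rwa [Real.log_mul (by positivity) hT0.ne', Real.log_pow, Nat.cast_ofNat] at this
  have h₃ : Real.log A ≤ 2 * |Real.log A| * Real.log T := by
    have := le_abs_self (Real.log A)
    nlinarith [abs_nonneg (Real.log A)]
  rw [h₁, Real.log_mul hA.ne' hT0.ne']
  have h₄ := mul_nonneg hd0.le h₂
  have h₅ := mul_le_mul_of_nonneg_left h₃ hd0.le
  constructor <;> linarith

section Run

variable {Ω : Type*} {mΩ : MeasurableSpace Ω} {P : Measure Ω} [IsProbabilityMeasure P]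
  {ℱ : Filtration ℕ mΩ} {D : Fin K → Measure (Request d)} [∀ k, IsProbabilityMeasure (D k)]
  {cg c₀ Rmax Amax : ℝ} {b : Fin d → ℝ} {T : ℕ} {α : ℝ} {θ : ℕ → Ω → Fin K}
  {Z : ℕ → Ω → Request d} {w : ℕ → Ω → Fin K → ℝ} {p : ℕ → Ω → Fin d → ℝ}

/-- The regret bound for a horizon that is long compared with the constants of the model. -/
lemma IsRun.mixRegret_le (hrun : IsRun P ℱ D cg c₀ Rmax Amax b T α ((T : ℝ) ^ (-2 : ℤ)) θ Z w p)
    (hd : 0 < d) (hR : 0 < Rmax) (hA : 0 < Amax) (hb : ∀ i, 0 < b i) {bmin : ℝ}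
    (hbmin : ∀ i, bmin ≤ b i) (hbpos : 0 < bmin)
    (hD : ∀ k, BoundedRequests Rmax Amax (D k)) (hc : ∀ k, ContinuousValuation (D k))
    (hcg : 4 ≤ cg) (hα : 1 ≤ α) (hK : 0 < K) (hKT : K ≤ T) (hT : 2 ≤ T) {A : ℝ} (hA0 : 0 < A)
    (hAeq : A = c₀ * d * priceBound Rmax b * Amax / Rmax) (hAT : 1 ≤ A ^ 2 * T) :
    mixRegret P D b T Z p ≤
      (3 * (Rmax / bmin * Amax * Real.sqrt (6 * d + 16)) +
        6 * (cg * Rmax * Real.sqrt (d * (2 * |Real.log A| + 1) + 4))) * α *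
          Real.sqrt (K * T * (d * Real.log T)) +
      (3 * Rmax + 2 * (Rmax / bmin * d * Amax) + 2 * (Rmax * (d + 2))) *
        Real.sqrt (T * Real.log T) + K * Rmax := by
  have hT0 : (0 : ℝ) < T := by exact_mod_cast (two_pos.trans_le hT)
  have hd1 : (1 : ℝ) ≤ d := by exact_mod_cast hd
  set ℓ := Real.log T with hℓdef
  have hℓ : 1 / 2 ≤ ℓ := half_le_log hT
  have hℓ0 : 0 ≤ ℓ := by linarith
  set L := d * Real.log (A * T) + Real.log (K * T / (T : ℝ) ^ (-2 : ℤ)) with hL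
  obtain ⟨hL₁, hL₂⟩ := logFactor_bounds hT hK hKT hd hA0 hAT
  rw [← hL, ← hℓdef] at hL₁ hL₂
  set E := d * (2 * |Real.log A| + 1) + 4 with hE
  -- Large enough for the union bound and, as `6 * d + 16 ≤ 16 * (d / 2 + 3)`, at most `4 * √L`;
  -- this explains the requirement `4 ≤ cg`.
  set U := Real.sqrt ((6 * d + 16) * ℓ) with hU
  have hUsq : U ^ 2 = (6 * d + 16) * ℓ := Real.sq_sqrt (by positivity)
  have hU1 : 1 ≤ U := Real.one_le_sqrt.2 (by nlinarith)
  set Bc := α * cg * Rmax * Real.sqrt L with hBc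
  have hβ : ∀ n : ℕ, confRadius cg c₀ Rmax Amax b K T α ((T : ℝ) ^ (-2 : ℤ)) n =
      Bc * (1 / Real.sqrt (max (n : ℝ) 1)) := by
    intro n
    have h₁ : c₀ * d * priceBound Rmax b * Amax * T / Rmax = A * T := by
      rw [hAeq]
      ring
    unfold confRadius
    rw [h₁, ← hL, Real.sqrt_div' _ (le_trans zero_le_one (le_max_right _ _)), hBc]
    ring
  have hUL : Rmax * U ≤ Bc := by
    have h₁ : U ≤ 4 * Real.sqrt L := by
      refine Real.sqrt_le_iff.2 ⟨by positivity, ?_⟩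
      rw [mul_pow, Real.sq_sqrt (le_trans (by positivity) hL₁)]
      nlinarith
    have h₂ : (4 : ℝ) ≤ α * cg := by nlinarith
    calc Rmax * U ≤ Rmax * (4 * Real.sqrt L) := mul_le_mul_of_nonneg_left h₁ hR.le
      _ ≤ Rmax * (α * cg * Real.sqrt L) := by gcongr
      _ = Bc := by rw [hBc]; ring
  set S := Real.sqrt (K * T * (d * ℓ)) with hS
  set Q := Real.sqrt (T * ℓ) with hQ
  have hS1 : Real.sqrt ℓ * Real.sqrt (K * T) ≤ S := by
    rw [hS, ← Real.sqrt_mul hℓ0]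
    refine Real.sqrt_le_sqrt ?_
    have : 0 ≤ (K : ℝ) * T * ℓ := by positivity
    nlinarith
  have hS0 : 0 ≤ S := Real.sqrt_nonneg _
  have hQ0 : 0 ≤ Q := Real.sqrt_nonneg _
  have hUS : U * Real.sqrt (K * T) ≤ Real.sqrt (6 * d + 16) * (α * S) := by
    rw [hU, Real.sqrt_mul (by positivity), mul_assoc]
    refine mul_le_mul_of_nonneg_left (hS1.trans ?_) (Real.sqrt_nonneg _)
    exact le_mul_of_one_le_left hS0 hα
  have hBS : Bc * Real.sqrt (K * T) ≤ α * cg * Rmax * Real.sqrt E * S := by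
    have h₁ : Real.sqrt L ≤ Real.sqrt E * Real.sqrt ℓ := by
      rw [← Real.sqrt_mul (by positivity)]
      exact Real.sqrt_le_sqrt hL₂
    calc Bc * Real.sqrt (K * T)
        ≤ α * cg * Rmax * (Real.sqrt E * Real.sqrt ℓ) * Real.sqrt (K * T) := by
          rw [hBc]
          gcongr
      _ = α * cg * Rmax * Real.sqrt E * (Real.sqrt ℓ * Real.sqrt (K * T)) := by ring
      _ ≤ α * cg * Rmax * Real.sqrt E * S := by gcongr
  have hTQ : Real.sqrt T ≤ 2 * Q := by
    rw [hQ, Real.sqrt_mul hT0.le]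
    have := one_le_two_mul_sqrt_log hT
    nlinarith [Real.sqrt_nonneg (T : ℝ)]
  have hQ1 : 1 ≤ 2 * Q := (Real.one_le_sqrt.2 (by exact_mod_cast one_le_two.trans hT)).trans hTQ
  have hslack : slack T * T = Q := by
    unfold slack
    rw [← hℓdef, Real.sqrt_div' _ hT0.le, hQ, Real.sqrt_mul hT0.le]
    have h := Real.mul_self_sqrt hT0.le
    have h' := (Real.sqrt_pos.2 hT0).ne'
    field_simp
    rw [sq, h]
  have hprob := mul_growth_mul_exp_le hT hKT d hUsq
  refine mixRegret_le_of_forall hK (by omega) hb fun v hv => ?_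
  have hmain := hrun.mul_value_le hU1 hR hA hb hbmin hbpos hD hc hβ hUL hKT (by omega) hv
  refine hmain.trans (add_le_add le_rfl ?_)
  rw [hslack]
  have hG : 0 ≤ Rmax / bmin := (div_pos hR hbpos).le
  have t₁ : Rmax ≤ Rmax * (2 * Q) := le_mul_of_one_le_right hR.le hQ1
  have t₂ : Rmax / bmin * (d * (Amax * Real.sqrt T)) ≤ Rmax / bmin * (d * (Amax * (2 * Q))) := by
    gcongr
  have t₃ : Rmax / bmin * (3 * Amax * (U * Real.sqrt (K * T))) ≤
      Rmax / bmin * (3 * Amax * (Real.sqrt (6 * d + 16) * (α * S))) := by gcongr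
  have t₄ := mul_le_mul_of_nonneg_left hprob hR.le
  have t₅ : Rmax * (d + 2) ≤ Rmax * (d + 2) * (2 * Q) :=
    le_mul_of_one_le_right (by positivity) hQ1
  linarith

end Run

/-- The regret bound, with constants that depend only on the model. -/
theorem exists_mixRegret_le {cg c₀ Rmax Amax : ℝ} {b : Fin d → ℝ} (hcg : 4 ≤ cg) (hc₀ : 1 ≤ c₀)
    (hd : 0 < d) (hR : 0 < Rmax) (hA : 0 < Amax) (hb : ∀ i, 0 < b i) :
    ∃ C₁ > (0 : ℝ), ∃ C₂ > (0 : ℝ),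
      ∀ (K T : ℕ), 0 < K → 1 ≤ T → ∀ (α : ℝ), 1 ≤ α →
      ∀ (D : Fin K → Measure (Request d)) [∀ k, IsProbabilityMeasure (D k)],
      (∀ k, BoundedRequests Rmax Amax (D k)) →
      (∀ k, ContinuousValuation (D k)) →
      ∀ {Ω : Type*} {mΩ : MeasurableSpace Ω} (P : Measure Ω) [IsProbabilityMeasure P]
        (ℱ : Filtration ℕ mΩ) (θ : ℕ → Ω → Fin K) (Z : ℕ → Ω → Request d)
        (w : ℕ → Ω → Fin K → ℝ) (p : ℕ → Ω → Fin d → ℝ),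
      IsRun P ℱ D cg c₀ Rmax Amax b T α ((T : ℝ) ^ (-2 : ℤ)) θ Z w p →
      mixRegret P D b T Z p ≤ C₁ * α * Real.sqrt (K * T * (d * Real.log T)) +
        C₂ * Real.sqrt (T * Real.log T) + K * Rmax := by
  have : Nonempty (Fin d) := ⟨⟨0, hd⟩⟩
  have hd0 : (0 : ℝ) < d := by exact_mod_cast hd
  set bmin := ⨅ i, b i with hbmindef
  have hbmin : ∀ i, bmin ≤ b i := fun i => ciInf_le (Set.finite_range b).bddBelow i
  have hbpos : 0 < bmin := by
    obtain ⟨i, hi⟩ := exists_eq_ciInf_of_finite (f := b)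
    rw [hbmindef, ← hi]
    exact hb i
  obtain ⟨A, hAeq⟩ : ∃ A, A = c₀ * d * priceBound Rmax b * Amax / Rmax := ⟨_, rfl⟩
  have hA0 : 0 < A := by
    have : 0 < priceBound Rmax b := div_pos (by positivity) hbpos
    rw [hAeq]
    positivity
  -- The last summand of the second constant pays for horizons with `A ^ 2 * T < 1`, where the
  -- confidence radius may fail to dominate the deviations.
  refine ⟨3 * (Rmax / bmin * Amax * Real.sqrt (6 * d + 16)) +
    6 * (cg * Rmax * Real.sqrt (d * (2 * |Real.log A| + 1) + 4)), by positivity,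
    3 * Rmax + 2 * (Rmax / bmin * d * Amax) + 2 * (Rmax * (d + 2)) + 2 * (Rmax * (A ^ 2)⁻¹),
    by positivity, ?_⟩
  intro K T hK hT α hα D _ hD hc Ω mΩ P _ ℱ θ Z w p hrun
  have hT0 : (0 : ℝ) < T := by exact_mod_cast hT
  have hS0 := Real.sqrt_nonneg (K * T * (d * Real.log T))
  have hQ0 := Real.sqrt_nonneg (T * Real.log T)
  have hα0 : 0 < α := zero_lt_one.trans_le hα
  have htriv := hrun.mixRegret_le_mul hD hK hT hb
  rcases le_or_gt T K with hTK | hKT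
  · have h₁ : (T : ℝ) * Rmax ≤ K * Rmax :=
      mul_le_mul_of_nonneg_right (by exact_mod_cast hTK) hR.le
    refine (htriv.trans h₁).trans (le_add_of_nonneg_left ?_)
    positivity
  · have hT2 : 2 ≤ T := by omega
    rcases le_or_gt 1 (A ^ 2 * T) with hAT | hAT
    · have h := hrun.mixRegret_le hd hR hA hb hbmin hbpos hD hc hcg hα hK hKT.le hT2 hA0 hAeq hAT
      have h' : 0 ≤ 2 * (Rmax * (A ^ 2)⁻¹) * Real.sqrt (T * Real.log T) := by positivity
      linarith
    · have h₁ : (T : ℝ) ≤ (A ^ 2)⁻¹ := by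
        rw [← one_div, le_div_iff₀' (by positivity)]
        exact hAT.le
      have hQ1 : 1 ≤ 2 * Real.sqrt (T * Real.log T) := by
        rw [Real.sqrt_mul hT0.le]
        have h₂ := one_le_two_mul_sqrt_log hT2
        have h₃ : 1 ≤ Real.sqrt T := Real.one_le_sqrt.2 (by exact_mod_cast hT)
        nlinarith
      have h₂ : (T : ℝ) * Rmax ≤ Rmax * (A ^ 2)⁻¹ * (2 * Real.sqrt (T * Real.log T)) := by
        rw [mul_comm]
        exact (mul_le_mul_of_nonneg_left h₁ hR.le).trans
          (le_mul_of_one_le_right (by positivity) hQ1)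
      have h₃ : 0 ≤ (3 * (Rmax / bmin * Amax * Real.sqrt (6 * d + 16)) +
        6 * (cg * Rmax * Real.sqrt (d * (2 * |Real.log A| + 1) + 4))) * α *
          Real.sqrt (K * T * (d * Real.log T)) := by positivity
      have h₄ : 0 ≤ (3 * Rmax + 2 * (Rmax / bmin * d * Amax) + 2 * (Rmax * (d + 2))) *
        Real.sqrt (T * Real.log T) := by positivity
      have h₅ : 0 ≤ K * Rmax := by positivity
      linarith

/-- A bound with separate logarithmic terms is of order `α √(K T) log T`. -/
lemma regretBound_le {C₁ C₂ Rmax α : ℝ} {T : ℕ} (hC₁ : 0 ≤ C₁) (hC₂ : 0 ≤ C₂) (hR : 0 ≤ Rmax)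
    (hα : 1 ≤ α) (hK : 0 < K) (hKT : K ≤ T) (hT : 2 ≤ T) (d : ℕ) :
    C₁ * α * Real.sqrt (K * T * (d * Real.log T)) + C₂ * Real.sqrt (T * Real.log T) + K * Rmax ≤
      2 * (C₁ * Real.sqrt d + C₂ + Rmax) * (α * Real.sqrt (K * T)) * Real.log T := by
  have hT0 : (0 : ℝ) < T := by exact_mod_cast (two_pos.trans_le hT)
  have hK1 : (1 : ℝ) ≤ K := by exact_mod_cast hK
  have hKT' : (K : ℝ) ≤ T := by exact_mod_cast hKT
  have hℓ := half_le_log hT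
  set ℓ := Real.log T
  set R := Real.sqrt (K * T) with hRdef
  have hR0 : 0 ≤ R := Real.sqrt_nonneg _
  have hsℓ : Real.sqrt ℓ ≤ 2 * ℓ := Real.sqrt_le_iff.2 ⟨by linarith, by nlinarith⟩
  have h₁ : Real.sqrt (K * T * (d * ℓ)) ≤ R * (Real.sqrt d * (2 * ℓ)) := by
    rw [Real.sqrt_mul (by positivity), ← hRdef, Real.sqrt_mul (Nat.cast_nonneg d)]
    gcongr
  have hαR : R ≤ α * R := le_mul_of_one_le_left hR0 hα
  have h₂ : Real.sqrt (T * ℓ) ≤ α * R * (2 * ℓ) := by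
    rw [Real.sqrt_mul hT0.le]
    have : Real.sqrt T ≤ R := Real.sqrt_le_sqrt (le_mul_of_one_le_left hT0.le hK1)
    exact mul_le_mul (this.trans hαR) hsℓ (Real.sqrt_nonneg _) (by positivity)
  have h₃ : (K : ℝ) ≤ α * R * (2 * ℓ) := by
    have : (K : ℝ) ≤ R := Real.le_sqrt_of_sq_le (by nlinarith)
    exact (this.trans hαR).trans (le_mul_of_one_le_right (by positivity) (by linarith))
  have t₁ := mul_le_mul_of_nonneg_left h₁ (mul_nonneg hC₁ (zero_le_one.trans hα))
  have t₂ := mul_le_mul_of_nonneg_left h₂ hC₂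
  have t₃ := mul_le_mul_of_nonneg_right h₃ hR
  linarith

end SPUCB

end

theorem mainTheorem1 :
    -- `cg`, `c₀`: the absolute constants of the confidence radius, any sufficiently large ones
    ∃ cgMin > (0 : ℝ), ∃ c₀Min > (0 : ℝ), ∀ cg ≥ cgMin, ∀ c₀ ≥ c₀Min,
    ∀ (d : ℕ), 0 < d → ∀ (Rmax Amax : ℝ), 0 < Rmax → 0 < Amax →
    ∀ (b : Fin d → ℝ), (∀ i, 0 < b i) →
      -- the constants depend only on `d`, `Rmax`, `Amax`, `b`
      (∃ C₁ > (0 : ℝ), ∃ C₂ > (0 : ℝ),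
        ∀ (K T : ℕ), 0 < K → 1 ≤ T → ∀ (α : ℝ), 1 ≤ α →
        ∀ (D : Fin K → Measure (SPUCB.Request d)) [∀ k, IsProbabilityMeasure (D k)],
        (∀ k, SPUCB.BoundedRequests Rmax Amax (D k)) →
        (∀ k, SPUCB.ContinuousValuation (D k)) →
        ∀ {Ω : Type*} {mΩ : MeasurableSpace Ω} (P : Measure Ω) [IsProbabilityMeasure P]
          (ℱ : Filtration ℕ mΩ) (θ : ℕ → Ω → Fin K) (Z : ℕ → Ω → SPUCB.Request d)
          (w : ℕ → Ω → Fin K → ℝ) (p : ℕ → Ω → Fin d → ℝ),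
        SPUCB.IsRun P ℱ D cg c₀ Rmax Amax b T α ((T : ℝ) ^ (-2 : ℤ)) θ Z w p →
        SPUCB.mixRegret P D b T Z p ≤
          C₁ * α * Real.sqrt (K * T * (d * Real.log T)) +
            C₂ * Real.sqrt (T * Real.log T) + K * Rmax) ∧
      -- the regret is of order `α √(K T)` up to powers of `log T`
      (∃ C > (0 : ℝ), ∃ m : ℕ,
        ∀ (K T : ℕ), 0 < K → 2 ≤ T → ∀ (α : ℝ), 1 ≤ α →
        ∀ (D : Fin K → Measure (SPUCB.Request d)) [∀ k, IsProbabilityMeasure (D k)],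
        (∀ k, SPUCB.BoundedRequests Rmax Amax (D k)) →
        (∀ k, SPUCB.ContinuousValuation (D k)) →
        ∀ {Ω : Type*} {mΩ : MeasurableSpace Ω} (P : Measure Ω) [IsProbabilityMeasure P]
          (ℱ : Filtration ℕ mΩ) (θ : ℕ → Ω → Fin K) (Z : ℕ → Ω → SPUCB.Request d)
          (w : ℕ → Ω → Fin K → ℝ) (p : ℕ → Ω → Fin d → ℝ),
        SPUCB.IsRun P ℱ D cg c₀ Rmax Amax b T α ((T : ℝ) ^ (-2 : ℤ)) θ Z w p →
        SPUCB.mixRegret P D b T Z p ≤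
          C * (α * Real.sqrt (K * T)) * Real.log T ^ m) := by
  -- With `cg ≥ 4` the radii dominate the deviations; `c₀ ≥ 1` only keeps the argument of the
  -- logarithm positive.
  refine ⟨4, by norm_num, 1, one_pos, fun cg hcg c₀ hc₀ d hd Rmax Amax hR hA b hb => ?_⟩
  refine ⟨SPUCB.exists_mixRegret_le hcg hc₀ hd hR hA hb, ?_⟩
  obtain ⟨C₁, hC₁, C₂, hC₂, h⟩ := SPUCB.exists_mixRegret_le hcg hc₀ hd hR hA hb
  refine ⟨2 * (C₁ * Real.sqrt d + C₂ + Rmax), by positivity, 1, ?_⟩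
  intro K T hK hT α hα D _ hD hc Ω mΩ P _ ℱ θ Z w p hrun
  rw [pow_one]
  rcases le_or_gt K T with hKT | hTK
  · exact (h K T hK (by omega) α hα D hD hc P ℱ θ Z w p hrun).trans
      (SPUCB.regretBound_le hC₁.le hC₂.le hR.le hα hK hKT hT d)
  -- For `T < K` the term `K * Rmax` is not of the desired order, but the trivial bound suffices
  -- because `T ≤ √(K * T)`.
  · refine (hrun.mixRegret_le_mul hD hK (by omega) hb).trans ?_
    have hℓ := SPUCB.half_le_log hT
    have hT' : (T : ℝ) ≤ α * Real.sqrt (K * T) := by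
      refine (Real.le_sqrt_of_sq_le ?_).trans (le_mul_of_one_le_left (Real.sqrt_nonneg _) hα)
      rw [sq]
      exact mul_le_mul_of_nonneg_right (by exact_mod_cast hTK.le) (Nat.cast_nonneg T)
    have h₁ := mul_le_mul_of_nonneg_left hT' hR.le
    have h₂ : α * Real.sqrt (K * T) ≤ α * Real.sqrt (K * T) * (2 * Real.log T) :=
      le_mul_of_one_le_right (by positivity) (by linarith)
    have h₃ := mul_le_mul_of_nonneg_left h₂ hR.le
    have h₄ : 0 ≤ 2 * (C₁ * Real.sqrt d + C₂) * (α * Real.sqrt (K * T)) * Real.log T := by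
      positivity
    linarith
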